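/- Let $h$ be an indeterminate, $v=\exp(h/2)$, $q=v^2$ in $\mathbb Q[[h]]$. Let $U_h=U_h(sl_2)$ be the $h$-adically complete $\mathbb Q[[h]]$-algebra topologically generated by $H,E,F$ with relations $$HE-EH=2E,\quad HF-FH=-2F,\quad EF-FE=\frac{K-K^{-1}}{v-v^{-1}},\qquad K=\exp(hH/2),$$ and let $\hat\otimes$ be the $h$-adically completed tensor product over $\mathbb Q[[h]]$. Equip $U_h$ with the complete Hopf algebra structure $$\Delta(H)=H\otimes1+1\otimes H,\quad \Delta(E)=E\otimes 1+K\otimes E,\quad \Delta(F)=F\otimes K^{-1}+1\otimes F,$$ $$\epsilon(H)=\epsilon(E)=\epsilon(F)=0,\quad S(H)=-H,\quad S(E)=-K^{-1}E,\quad S(F)=-FK,$$ with multiplication $\mu$ and unit $\eta$, and with the universal $R$-matrix $$R=\exp\Bigl(\tfrac h4H\otimes H\Bigr)\sum_{n\ge0}v^{n(n-1)/2}\frac{(v-v^{-1})^n}{[n]!}F^n\otimes E^n=\sum\alpha\otimes\beta ,\qquad [n]=\frac{v^n-v^{-n}}{v-v^{-1}},\quad [n]!=[n]\cdots[1].$$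 Let $x\triangleright y=\sum x_{(1)}yS(x_{(2)})$ be the left adjoint action. The transmutation of $U_h$ has the structure maps $\mu,\eta,\epsilon$ and $$\psi(x\otimes y)=\sum(\beta\triangleright y)\otimes(\alpha\triangleright x),\quad \psi^{-1}(x\otimes y)=\sum(S(\alpha)\triangleright y)\otimes(\beta\triangleright x),$$ $$\underline\Delta(x)=\sum x_{(1)}S(\beta)\otimes(\alpha\triangleright x_{(2)}),\quad \underline S(x)=\sum\beta\,S(\alpha\triangleright x),\quad \underline S^{-1}(x)=\sum S^{-1}(\alpha\triangleright x)\,\beta .$$ Put $e=(v-v^{-1})E$ and $\tilde F^{(n)}=F^nK^n/[n]_q!$, where $[n]_q!=\prod_{i=1}^n\frac{q^i-1}{q-1}$. Let $U_q^{ev}\subset U_h$ be the $\mathbb Z[q,q^{-1}]$-subalgebra generated by $K^2,K^{-2},e$ and $\tilde F^{(n)}$ ($n\ge1$). For $p\ge 0$ put $\mathcal F_p(U_q^{ev})=U_q^{ev}e^pU_q^{ev}$ and $$\mathcal F_p((U_q^{ev})^{\otimes n})=\sum_{i=1}^n (U_q^{ev})^{\otimes(i-1)}\otimes\mathcal F_p(U_q^{ev})\otimes(U_q^{ev})^{\otimes(n-i)}\quad(n\ge1);$$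 for $n=0$ put $\mathcal F_0=\mathbb Z[q,q^{-1}]$ and $\mathcal F_p=0$ for $p>0$. Let $(\tilde U_q^{ev})^{\tilde\otimes n}\subset U_h^{\hat\otimes n}$ be the image of the natural map $\varprojlim_p (U_q^{ev})^{\otimes n}/\mathcal F_p\to U_h^{\hat\otimes n}$, with the quotient of the inverse limit topology; thus the images of the kernels of the projections of the inverse limit to the quotients by $\mathcal F_p$ form a basis of neighbourhoods of $0$. In particular $(\tilde U_q^{ev})^{\tilde\otimes 0}=\mathbb Z[q,q^{-1}]$ is discrete. **Theorem.** The braided Hopf algebra structure of the transmutation of $U_h$ induces a braided Hopf algebra structure with invertible antipode on $\tilde U_q^{ev}$, in the following sense. For every $$f\in\{\psi,\psi^{-1},\mu,\eta,\underline\Delta,\epsilon,\underline S,\underline S^{-1}\},\qquad f\colon U_h^{\hat\otimes i}\to U_h^{\hat\otimes j},$$ one has $f((\tilde U_q^{ev})^{\tilde\otimes i})\subset(\tilde U_q^{ev})^{\tilde\otimes j}$, and the induced map $f\colon(\tilde U_q^{ev})^{\tilde\otimes i}\to(\tilde U_q^{ev})^{\tilde\otimes j}$ is continuous. Moreover $\psi^{-1}$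 and $\underline S^{-1}$, as given by the formulas above, are two-sided inverses of $\psi$ and $\underline S$. -/

import Mathlib

open scoped TensorProduct

noncomputable section

namespace QuantumSl2

/-! ### The `h`-adic completion -/

/-- The ground ring `ℚ⟦h⟧`. -/
abbrev Rh : Type := PowerSeries ℚ

/-- The ideal `(h)` of `ℚ⟦h⟧`. -/
abbrev hId : Ideal Rh := Ideal.span {PowerSeries.X}

/-- The submodule `h ^ k M` of a `ℚ⟦h⟧`-module `M`. -/
abbrev hPow (M : Type*) [AddCommGroup M] [Module Rh M] (k : ℕ) : Submodule Rh M :=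
  hId ^ k • ⊤

/-- The `h`-adic completion of a `ℚ⟦h⟧`-module. -/
def HComp (M : Type*) [AddCommGroup M] [Module Rh M] : Type _ := AdicCompletion hId M

section Completion

variable {M : Type*} [AddCommGroup M] [Module Rh M]
variable {N : Type*} [AddCommGroup N] [Module Rh N]

instance : AddCommGroup (HComp M) := inferInstanceAs (AddCommGroup (AdicCompletion hId M))

instance : Module Rh (HComp M) := inferInstanceAs (Module Rh (AdicCompletion hId M))

theorem hId_fg : hId.FG := ⟨{PowerSeries.X}, by simp⟩

instance : IsAdicComplete hId (HComp M) := AdicCompletion.isAdicComplete hId_fg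

/-- The canonical map from a module to its `h`-adic completion. -/
def hof : M →ₗ[Rh] HComp M := AdicCompletion.of hId M

/-- The extension of a linear map `f` with `h`-adically complete target to the completion of its
source. -/
def hExtend [IsAdicComplete hId N] (f : M →ₗ[Rh] N) : HComp M →ₗ[Rh] N :=
  (AdicCompletion.ofLinearEquiv hId N).symm.toLinearMap ∘ₗ
    (AdicCompletion.map hId f).restrictScalars Rh

theorem mem_hPow_iff {k : ℕ} {x : M} : x ∈ hPow M k ↔ ∃ y, (PowerSeries.X : Rh) ^ k • y = x := by
  rw [hPow, hId, Ideal.span_singleton_pow, Submodule.ideal_span_singleton_smul,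
    Submodule.mem_smul_pointwise_iff_exists]
  simp

theorem mem_hPow_zero (x : M) : x ∈ hPow M 0 := mem_hPow_iff.2 ⟨x, by simp⟩

theorem map_mem_hPow (f : M →ₗ[Rh] N) {k : ℕ} {x : M} (hx : x ∈ hPow M k) : f x ∈ hPow N k := by
  obtain ⟨y, rfl⟩ := mem_hPow_iff.1 hx
  exact mem_hPow_iff.2 ⟨f y, by simp⟩

theorem eq_of_sub_mem_hPow [IsHausdorff hId M] {x y : M} (h : ∀ k, x - y ∈ hPow M k) : x = y := by
  refine sub_eq_zero.1 (IsHausdorff.haus inferInstance (I := hId) _ fun n => ?_)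
  rw [SModEq.zero]
  exact h n

theorem exists_hof_sub_mem (x : HComp M) (k : ℕ) : ∃ m : M, x - hof m ∈ hPow (HComp M) k := by
  obtain ⟨m, hm⟩ := Submodule.mkQ_surjective _ (AdicCompletion.eval hId M k x)
  refine ⟨m, ?_⟩
  have h2 : ∀ y : AdicCompletion hId M, AdicCompletion.eval hId M k y = 0 →
      y ∈ hPow (AdicCompletion hId M) k := fun y hy => by
    rw [hPow, AdicCompletion.pow_smul_top_eq_ker_eval hId_fg]
    exact hy
  exact h2 _ ((map_sub (AdicCompletion.eval hId M k) x (AdicCompletion.of hId M m)).trans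
    (sub_eq_zero.2 hm.symm))

/-- Linear maps out of a completion are determined on the dense submodule. -/
theorem hcomp_ext [IsHausdorff hId N] {f g : HComp M →ₗ[Rh] N}
    (h : ∀ m, f (hof m) = g (hof m)) : f = g := by
  ext x
  refine eq_of_sub_mem_hPow fun k => ?_
  obtain ⟨m, hm⟩ := exists_hof_sub_mem x k
  have := map_mem_hPow (f - g) hm
  simpa [h] using this

@[simp]
theorem hExtend_hof [IsAdicComplete hId N] (f : M →ₗ[Rh] N) (m : M) :
    hExtend f (hof m) = f m := by
  have : AdicCompletion.map hId f (AdicCompletion.of hId M m) = AdicCompletion.of hId N (f m) :=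
    AdicCompletion.map_of ..
  change (AdicCompletion.ofLinearEquiv hId N).symm (AdicCompletion.map hId f
    (AdicCompletion.of hId M m)) = _
  rw [this, AdicCompletion.ofLinearEquiv_symm_of]

/-- `hPair x f` is the value at `x` of the extension of `f` to the completion. If
`x = ∑ mᵢ` is an `h`-adically convergent sum of elements of `M`, then `hPair x f = ∑ f mᵢ`. -/
def hPair [IsAdicComplete hId N] : HComp M →ₗ[Rh] (M →ₗ[Rh] N) →ₗ[Rh] N :=
  LinearMap.mk₂ Rh (fun x f => hExtend f x)
    (fun x y f => map_add _ _ _) (fun c x f => map_smul _ _ _)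
    (fun x f g => by
      have : hExtend (f + g) = hExtend f + hExtend g := hcomp_ext fun m => by simp
      simp [this])
    (fun c x f => by
      have : hExtend (c • f) = c • hExtend f := hcomp_ext fun m => by simp
      simp [this])

@[simp]
theorem hPair_hof [IsAdicComplete hId N] (m : M) (f : M →ₗ[Rh] N) :
    hPair (hof m) f = f m := hExtend_hof f m

end Completion

section Algebra

variable {A : Type*} [Ring A] [Algebra Rh A]
variable {B : Type*} [Ring B] [Algebra Rh B]

/-- The multiplication of the `h`-adic completion of an algebra. -/
def hMul : HComp A →ₗ[Rh] HComp A →ₗ[Rh] HComp A :=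
  LinearMap.mk₂ Rh (fun x y => hPair x (hPair y ∘ₗ (LinearMap.compRight Rh hof ∘ₗ LinearMap.mul Rh A)))
    (fun x y f => by simp) (fun c x f => by simp)
    (fun x f g => by rw [map_add, LinearMap.add_comp, map_add])
    (fun c x f => by rw [map_smul, LinearMap.smul_comp, map_smul])

@[simp]
theorem hMul_hof (a b : A) : hMul (hof a) (hof b) = hof (a * b) := by
  simp [hMul]

theorem hMul_assoc (x y z : HComp A) : hMul (hMul x y) z = hMul x (hMul y z) := by
  have h1 : ∀ a b : A, hMul (hof (a * b)) = hMul (hof a) ∘ₗ hMul (hof b) := fun a b =>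
    hcomp_ext fun c => by simp [mul_assoc]
  have h2 : ∀ a : A, hMul.flip z ∘ₗ hMul (hof a) = hMul (hof a) ∘ₗ hMul.flip z := fun a =>
    hcomp_ext fun b => by simp [h1]
  have h3 : hMul.flip z ∘ₗ hMul.flip y = hMul.flip (hMul y z) :=
    hcomp_ext fun a => by simpa using LinearMap.congr_fun (h2 a) y
  exact LinearMap.congr_fun h3 x

instance : Mul (HComp A) := ⟨fun x y => hMul x y⟩

instance : One (HComp A) := ⟨hof 1⟩

theorem hcomp_mul_def (x y : HComp A) : x * y = hMul x y := rfl

theorem hof_one : hof (1 : A) = 1 := rfl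

theorem hof_mul (a b : A) : hof (a * b) = hof a * hof b := (hMul_hof a b).symm

instance : Ring (HComp A) :=
  { (inferInstance : AddCommGroup (HComp A)), (inferInstance : Mul (HComp A)),
    (inferInstance : One (HComp A)) with
    left_distrib := fun x y z => map_add (hMul x) y z
    right_distrib := fun x y z => LinearMap.map_add₂ hMul x y z
    zero_mul := fun x => LinearMap.map_zero₂ hMul x
    mul_zero := fun x => map_zero (hMul x)
    mul_assoc := hMul_assoc
    one_mul := fun x => LinearMap.congr_fun
      (hcomp_ext (f := hMul (hof (1 : A))) (g := LinearMap.id) fun a => by simp) x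
    mul_one := fun x => LinearMap.congr_fun
      (hcomp_ext (f := hMul.flip (hof (1 : A))) (g := LinearMap.id) fun a => by simp) x }

instance : Algebra Rh (HComp A) :=
  Algebra.ofModule (fun r x y => LinearMap.map_smul₂ hMul r x y) (fun r x y => map_smul (hMul x) r y)

/-- The canonical map from an algebra to its `h`-adic completion. -/
def hofAlg : A →ₐ[Rh] HComp A := AlgHom.ofLinearMap hof hof_one hof_mul

@[simp]
theorem hofAlg_apply (a : A) : hofAlg a = hof a := rfl

/-- The extension of an algebra homomorphism with `h`-adically complete target to the completion
of its source. -/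
def hExtendAlg [IsAdicComplete hId B] (f : A →ₐ[Rh] B) : HComp A →ₐ[Rh] B :=
  AlgHom.ofLinearMap (hExtend f.toLinearMap) (by rw [← hof_one, hExtend_hof]; simp) <| by
    intro x y
    have h1 : ∀ a : A, hExtend f.toLinearMap ∘ₗ LinearMap.mulLeft Rh (hof a) =
        LinearMap.mulLeft Rh (f a) ∘ₗ hExtend f.toLinearMap := fun a =>
      hcomp_ext fun b => by simp [← hof_mul]
    have h2 : hExtend f.toLinearMap ∘ₗ LinearMap.mulRight Rh y =
        LinearMap.mulRight Rh (hExtend f.toLinearMap y) ∘ₗ hExtend f.toLinearMap :=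
      hcomp_ext fun a => by simpa using LinearMap.congr_fun (h1 a) y
    exact LinearMap.congr_fun h2 x

@[simp]
theorem hExtendAlg_hof [IsAdicComplete hId B] (f : A →ₐ[Rh] B) (a : A) :
    hExtendAlg f (hof a) = f a := hExtend_hof f.toLinearMap a

theorem hcomp_algHom_ext [IsHausdorff hId B] {f g : HComp A →ₐ[Rh] B}
    (h : f.comp hofAlg = g.comp hofAlg) : f = g :=
  AlgHom.toLinearMap_injective (hcomp_ext fun a => AlgHom.congr_fun h a)

instance [IsAdicComplete hId B] : IsAdicComplete hId Bᵐᵒᵖ where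
  haus' x hx := MulOpposite.unop_injective <| IsHausdorff.haus (I := hId) inferInstance _ fun n => by
    have := hx n
    rw [SModEq.zero] at this ⊢
    exact map_mem_hPow (MulOpposite.opLinearEquiv Rh).symm.toLinearMap this
  prec' f hf := by
    obtain ⟨L, hL⟩ := IsPrecomplete.prec (I := hId) (M := B) inferInstance
      (f := fun n => (f n).unop) fun {m n} hmn => by
        have := hf hmn
        rw [SModEq.sub_mem] at this ⊢
        exact map_mem_hPow (MulOpposite.opLinearEquiv Rh).symm.toLinearMap this
    refine ⟨MulOpposite.op L, fun n => ?_⟩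
    have := hL n
    rw [SModEq.sub_mem] at this ⊢
    exact map_mem_hPow (MulOpposite.opLinearEquiv Rh).toLinearMap this

/-! ### Convergent power series in `h` -/

theorem exists_hSum [IsAdicComplete hId B] (a : PowerSeries B) : ∃ L : B, ∀ k,
    L - ∑ n ∈ Finset.range k, (PowerSeries.X : Rh) ^ n • PowerSeries.coeff n a ∈ hPow B k := by
  obtain ⟨L, hL⟩ := IsPrecomplete.prec (I := hId) (M := B) inferInstance
    (f := fun k => ∑ n ∈ Finset.range k, (PowerSeries.X : Rh) ^ n • PowerSeries.coeff n a)
    fun {m n} hmn => by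
      rw [SModEq.comm, SModEq.sub_mem, ← Finset.sum_range_add_sum_Ico _ hmn, add_sub_cancel_left]
      refine Submodule.sum_mem _ fun i hi => mem_hPow_iff.2
        ⟨(PowerSeries.X : Rh) ^ (i - m) • PowerSeries.coeff i a, ?_⟩
      rw [smul_smul, ← pow_add, Nat.add_sub_cancel' (Finset.mem_Ico.1 hi).1]
  exact ⟨L, fun k => (SModEq.sub_mem).1 (hL k).symm⟩

/-- The sum `∑ hⁿ aₙ` of a power series with coefficients in an `h`-adically complete algebra. -/
def hSum [IsAdicComplete hId B] (a : PowerSeries B) : B := (exists_hSum a).choose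

theorem hSum_spec [IsAdicComplete hId B] (a : PowerSeries B) (k : ℕ) :
    hSum a - ∑ n ∈ Finset.range k, (PowerSeries.X : Rh) ^ n • PowerSeries.coeff n a ∈ hPow B k :=
  (exists_hSum a).choose_spec k

theorem hSum_unique [IsAdicComplete hId B] {a : PowerSeries B} {x : B} (h : ∀ k,
    x - ∑ n ∈ Finset.range k, (PowerSeries.X : Rh) ^ n • PowerSeries.coeff n a ∈ hPow B k) :
    hSum a = x :=
  eq_of_sub_mem_hPow fun k => by
    simpa using Submodule.sub_mem _ (hSum_spec a k) (h k)

theorem hSum_map {C : Type*} [Ring C] [Algebra Rh C] [IsAdicComplete hId B] [IsAdicComplete hId C]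
    (f : B →ₐ[Rh] C) (a : PowerSeries B) : hSum (PowerSeries.map (f : B →+* C) a) = f (hSum a) :=
  hSum_unique fun k => by
    simpa using map_mem_hPow f.toLinearMap (hSum_spec a k)

theorem hSum_add [IsAdicComplete hId B] (a b : PowerSeries B) :
    hSum (a + b) = hSum a + hSum b :=
  hSum_unique fun k => by
    have := Submodule.add_mem _ (hSum_spec a k) (hSum_spec b k)
    simp only [map_add, smul_add, Finset.sum_add_distrib]
    convert this using 1
    abel

theorem hSum_C [IsAdicComplete hId B] (b : B) : hSum (PowerSeries.C b) = b :=
  hSum_unique fun k => by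
    rcases k with _ | k
    · exact mem_hPow_zero _
    · rw [Finset.sum_range_succ', Finset.sum_eq_zero]
      · simp
      · intro i _
        simp

theorem hSum_X_mul [IsAdicComplete hId B] (a : PowerSeries B) :
    hSum (PowerSeries.X * a) = (PowerSeries.X : Rh) • hSum a :=
  hSum_unique fun k => by
    rcases k with _ | k
    · exact mem_hPow_zero _
    · rw [Finset.sum_range_succ']
      obtain ⟨y, hy⟩ := mem_hPow_iff.1 (hSum_spec a k)
      refine mem_hPow_iff.2 ⟨y, ?_⟩
      rw [pow_succ', mul_smul, hy]
      simp [smul_sub, Finset.smul_sum, smul_smul, ← pow_succ', PowerSeries.coeff_succ_X_mul]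

theorem hSum_C_mul [IsAdicComplete hId B] (b : B) (a : PowerSeries B) :
    hSum (PowerSeries.C b * a) = b * hSum a :=
  hSum_unique fun k => by
    simpa [mul_sub, Finset.mul_sum] using
      map_mem_hPow (LinearMap.mulLeft Rh b) (hSum_spec a k)

theorem hSum_mul [IsAdicComplete hId B] (a b : PowerSeries B) :
    hSum (a * b) = hSum a * hSum b := by
  refine eq_of_sub_mem_hPow fun k => ?_
  induction k generalizing a with
  | zero => exact mem_hPow_zero _
  | succ k ih =>
    have ha : a = PowerSeries.X * PowerSeries.mk (fun p => PowerSeries.coeff (p + 1) a) +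
        PowerSeries.C (PowerSeries.constantCoeff a) := PowerSeries.eq_X_mul_shift_add_const a
    generalize PowerSeries.mk (fun p => PowerSeries.coeff (p + 1) a) = a' at ha
    obtain ⟨y, hy⟩ := mem_hPow_iff.1 (ih a')
    refine mem_hPow_iff.2 ⟨y, ?_⟩
    rw [ha, add_mul, hSum_add, hSum_add, hSum_C_mul, hSum_C, mul_assoc, hSum_X_mul, hSum_X_mul,
      pow_succ', mul_smul, hy, smul_sub, add_mul, smul_mul_assoc]
    abel

theorem hSum_one [IsAdicComplete hId B] : hSum (1 : PowerSeries B) = 1 := by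
  simpa using hSum_C (1 : B)

theorem hSum_neg [IsAdicComplete hId B] (a : PowerSeries B) : hSum (-a) = -hSum a := by
  refine eq_neg_of_add_eq_zero_left ?_
  rw [← hSum_add]
  simpa using hSum_C (0 : B)

/-- The rational number `c` as an element of `ℚ⟦h⟧`. -/
abbrev cst (c : ℚ) : Rh := PowerSeries.C c

/-- The formal exponential `∑ xⁿ Tⁿ / n!`. -/
def expS (x : B) : PowerSeries B :=
  PowerSeries.mk fun n => cst ((n.factorial : ℚ)⁻¹) • x ^ n

/-- The coefficients of `exp (t / 2) - exp (-t / 2)`. -/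
def shCoeff (n : ℕ) : ℚ := ((1 / 2) ^ n - (-1 / 2) ^ n) * (n.factorial : ℚ)⁻¹

/-- The formal power series `(exp (x T / 2) - exp (-x T / 2)) / T`. -/
def shS (x : B) : PowerSeries B :=
  PowerSeries.mk fun n => cst (shCoeff (n + 1)) • x ^ (n + 1)

/-- The exponential `exp (h x)` in an `h`-adically complete algebra. -/
def hExp [IsAdicComplete hId B] (x : B) : B := hSum (expS x)

/-- `v ^ a = exp (a h / 2)`; in particular `v = vPow 1` and `q ^ a = vPow (2 * a)`. -/
def vPow (a : ℤ) : Rh := PowerSeries.rescale ((a : ℚ) / 2) (PowerSeries.exp ℚ)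

/-- The invertible power series `(v - v⁻¹) / h`. -/
def sh : Rh := PowerSeries.mk fun n => shCoeff (n + 1)

/-- The element `(exp (h x / 2) - exp (-h x / 2)) / (v - v⁻¹)`. Numerator and
denominator are both divided by `h`. -/
def qBr [IsAdicComplete hId B] (x : B) : B := (sh⁻¹ : Rh) • hSum (shS x)

theorem X_mul_shS (x : B) :
    PowerSeries.X * shS x = expS (cst (1 / 2) • x) - expS (-(cst (1 / 2) • x)) := by
  ext n
  rcases n with _ | n
  · simp [expS]
  · rw [PowerSeries.coeff_succ_X_mul]
    simp only [shS, expS, PowerSeries.coeff_mk, map_sub, ← neg_smul, smul_pow, smul_smul, ← sub_smul]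
    congr 1
    simp only [shCoeff, cst, ← map_neg, ← map_pow, ← map_mul, ← map_sub]
    congr 1
    ring

theorem X_mul_sh : PowerSeries.X * sh = vPow 1 - vPow (-1) := by
  ext n
  rcases n with _ | n
  · rw [PowerSeries.coeff_zero_X_mul, map_sub, vPow, vPow, PowerSeries.coeff_rescale,
      PowerSeries.coeff_rescale, pow_zero, pow_zero, sub_self]
  · rw [PowerSeries.coeff_succ_X_mul]
    simp [sh, vPow, PowerSeries.coeff_rescale, shCoeff, PowerSeries.coeff_exp]
    ring

theorem sh_mul_inv : sh * sh⁻¹ = 1 := PowerSeries.mul_inv_cancel _ (by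
  simp [sh, shCoeff]; norm_num)

/-- `qBr x` is the quotient of `exp (h x / 2) - exp (-h x / 2)` by `v - v⁻¹`. -/
theorem smul_qBr [IsAdicComplete hId B] (x : B) : (vPow 1 - vPow (-1)) • qBr x =
    hExp (cst (1 / 2) • x) - hExp (-(cst (1 / 2) • x)) := by
  rw [← X_mul_sh, qBr, smul_smul, mul_assoc, sh_mul_inv, mul_one, ← hSum_X_mul, X_mul_shS, hExp,
    hExp, sub_eq_add_neg, hSum_add, hSum_neg, sub_eq_add_neg]

theorem expS_add {x y : B} (h : Commute x y) : expS (x + y) = expS x * expS y := by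
  ext n
  simp only [expS, PowerSeries.coeff_mul, PowerSeries.coeff_mk, h.add_pow', Finset.smul_sum,
    smul_mul_smul_comm]
  refine Finset.sum_congr rfl fun m hm => ?_
  rw [← Nat.cast_smul_eq_nsmul Rh, smul_smul]
  congr 1
  have : ((n.choose m.1 : ℕ) : Rh) = cst (n.choose m.1 : ℚ) := by simp [cst]
  rw [this, ← map_mul, ← map_mul]
  congr 1
  rw [Finset.HasAntidiagonal.mem_antidiagonal] at hm
  rw [← hm, Nat.choose_symm_add, Nat.add_choose, Nat.cast_div (Nat.factorial_mul_factorial_dvd_factorial_add _ _)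
    (by positivity)]
  have := Nat.factorial_ne_zero (m.1 + m.2)
  push_cast
  field_simp

theorem expS_zero : expS (0 : B) = 1 := by
  ext n
  rcases n with _ | n <;> simp [expS, PowerSeries.coeff_one]

theorem hExp_add [IsAdicComplete hId B] {x y : B} (h : Commute x y) :
    hExp (x + y) = hExp x * hExp y := by
  rw [hExp, expS_add h, hSum_mul, hExp, hExp]

theorem hExp_zero [IsAdicComplete hId B] : hExp (0 : B) = 1 := by
  rw [hExp, expS_zero, hSum_one]

theorem map_expS {C : Type*} [Ring C] [Algebra Rh C] (f : B →ₐ[Rh] C) (x : B) :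
    PowerSeries.map (f : B →+* C) (expS x) = expS (f x) := by
  ext n
  simp [expS]

theorem map_hExp {C : Type*} [Ring C] [Algebra Rh C] [IsAdicComplete hId B] [IsAdicComplete hId C]
    (f : B →ₐ[Rh] C) (x : B) : f (hExp x) = hExp (f x) := by
  rw [hExp, ← hSum_map, map_expS, hExp]

theorem map_qBr {C : Type*} [Ring C] [Algebra Rh C] [IsAdicComplete hId B] [IsAdicComplete hId C]
    (f : B →ₐ[Rh] C) (x : B) : f (qBr x) = qBr (f x) := by
  rw [qBr, map_smul, ← hSum_map, qBr]
  congr 2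
  ext n
  simp [shS]

theorem hExp_cst [IsAdicComplete hId B] (a : ℤ) :
    hExp (algebraMap Rh B (cst (a / 2))) = algebraMap Rh B (vPow a) := by
  have h1 : hExp (cst (a / 2)) = vPow a := hSum_unique fun k => by
    refine mem_hPow_iff.2 ?_
    have h2 : (PowerSeries.X : Rh) ^ k ∣ vPow a - ∑ n ∈ Finset.range k,
        (PowerSeries.X : Rh) ^ n • PowerSeries.coeff n (expS (cst ((a : ℚ) / 2))) := by
      rw [PowerSeries.X_pow_dvd_iff]
      intro m hm
      have h3 : ∀ n, (PowerSeries.X : Rh) ^ n • PowerSeries.coeff n (expS (cst ((a : ℚ) / 2))) =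
          PowerSeries.monomial n (((a : ℚ) / 2) ^ n * (n.factorial : ℚ)⁻¹) := fun n => by
        rw [expS, PowerSeries.coeff_mk, smul_eq_mul, smul_eq_mul, ← map_pow, ← map_mul, mul_comm,
          mul_comm (a := _ ^ n)]
        ext i
        rw [PowerSeries.coeff_C_mul_X_pow, PowerSeries.coeff_monomial]
      simp only [h3, map_sub, map_sum, PowerSeries.coeff_monomial]
      rw [Finset.sum_ite_eq, if_pos (Finset.mem_range.2 hm)]
      simp [vPow, PowerSeries.coeff_rescale, PowerSeries.coeff_exp]
    obtain ⟨y, hy⟩ := h2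
    exact ⟨y, hy.symm⟩
  rw [← h1]
  exact (map_hExp (Algebra.ofId Rh B) _).symm

theorem vPow_add (a b : ℤ) : vPow (a + b) = vPow a * vPow b := by
  have := hExp_add (B := Rh) (Commute.all (cst (a / 2)) (cst (b / 2)))
  rw [← map_add, ← add_div, ← Int.cast_add] at this
  have h := fun c : ℤ => hExp_cst (B := Rh) c
  simp only [Algebra.algebraMap_self, RingHom.id_apply] at h
  rwa [h, h, h] at this

theorem vPow_zero : vPow 0 = 1 := by
  ext n
  rcases n with _ | n <;> simp [vPow]

/-- A function of `x` passes through `y` if `x y = y x'`. -/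
theorem hExp_mul_comm [IsAdicComplete hId B] {x x' y : B} (h : x * y = y * x') :
    hExp x * y = y * hExp x' := by
  have h1 : ∀ n, x ^ n * y = y * x' ^ n := fun n => by
    induction n with
    | zero => simp
    | succ n ih => rw [pow_succ, mul_assoc, h, ← mul_assoc, ih, mul_assoc, ← pow_succ]
  have h2 : expS x * PowerSeries.C y = PowerSeries.C y * expS x' := by
    ext n
    simp [expS, h1]
  have := congrArg hSum h2
  rwa [hSum_mul, hSum_mul, hSum_C] at this

theorem hExp_shift [IsAdicComplete hId B] {x y : B} (a : ℤ)
    (h : x * y = y * (x + algebraMap Rh B (cst (a / 2)))) :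
    hExp x * y = vPow a • (y * hExp x) := by
  rw [hExp_mul_comm h, hExp_add (Algebra.commutes' _ x).symm, hExp_cst, ← mul_assoc,
    ← Algebra.commutes, Algebra.smul_def]

theorem qBr_neg [IsAdicComplete hId B] (x : B) : qBr (-x) = -qBr x := by
  have : shS (-x) = - shS x := by
    ext n
    simp only [shS, PowerSeries.coeff_mk, map_neg]
    rcases Nat.even_or_odd (n + 1) with h | h
    · have : shCoeff (n + 1) = 0 := by
        rw [shCoeff, neg_div, h.neg_pow, sub_self, zero_mul]
      simp [this]
    · rw [h.neg_pow, smul_neg]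
  rw [qBr, this, hSum_neg, smul_neg, qBr]

theorem qBr_zero [IsAdicComplete hId B] : qBr (0 : B) = 0 := by
  have : shS (0 : B) = 0 := by
    ext n
    simp [shS]
  rw [qBr, this]
  have := hSum_C (0 : B)
  rw [map_zero] at this
  rw [this, smul_zero]

theorem qBr_add [IsAdicComplete hId B] {x y : B} (h : Commute x y) :
    qBr (x + y) = qBr x * hExp (-(cst (1 / 2) • y)) + hExp (cst (1 / 2) • x) * qBr y := by
  have key : shS (x + y) = shS x * expS (-(cst (1 / 2) • y)) + expS (cst (1 / 2) • x) * shS y := by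
    have hX : ∀ a b : PowerSeries B, PowerSeries.X * a = PowerSeries.X * b → a = b :=
      fun a b hab => by
        ext n
        rw [← PowerSeries.coeff_succ_X_mul, hab, PowerSeries.coeff_succ_X_mul]
    apply hX
    have h1 : Commute (cst (1 / 2) • x) (cst (1 / 2) • y) :=
      (h.smul_left _).smul_right _
    rw [mul_add, ← mul_assoc, ← mul_assoc, ← (PowerSeries.commute_X (expS (cst (1 / 2) • x))).eq,
      mul_assoc (expS _), X_mul_shS, X_mul_shS, X_mul_shS, smul_add, neg_add, expS_add h1,
      expS_add h1.neg_left.neg_right]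
    noncomm_ring
  rw [qBr, key, hSum_add, hSum_mul, hSum_mul, smul_add, qBr, qBr, hExp, hExp, smul_mul_assoc,
    mul_smul_comm]

end Algebra

/-! ### The algebra `U_h(sl₂)` -/

/-- The names of the topological generators. -/
inductive Gen
  | H
  | E
  | F

/-- The `h`-adically completed free algebra on `H`, `E`, `F`. -/
def FreeH : Type := HComp (FreeAlgebra Rh Gen)

instance : Ring FreeH := inferInstanceAs (Ring (HComp (FreeAlgebra Rh Gen)))

instance : Algebra Rh FreeH := inferInstanceAs (Algebra Rh (HComp (FreeAlgebra Rh Gen)))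

instance : IsAdicComplete hId FreeH :=
  inferInstanceAs (IsAdicComplete hId (HComp (FreeAlgebra Rh Gen)))

/-- The generators of the completed free algebra. -/
def freeGen (g : Gen) : FreeH := hof (M := FreeAlgebra Rh Gen) (FreeAlgebra.ι Rh g)

/-- The relations of `U_h(sl₂)`; here `qBr H = (K - K⁻¹) / (v - v⁻¹)` with `K = exp (h H / 2)`. -/
inductive UhRel : FreeH → FreeH → Prop
  | HE : UhRel (freeGen .H * freeGen .E - freeGen .E * freeGen .H) ((2 : ℕ) • freeGen .E)
  | HF : UhRel (freeGen .H * freeGen .F - freeGen .F * freeGen .H) (-((2 : ℕ) • freeGen .F))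
  | EF : UhRel (freeGen .E * freeGen .F - freeGen .F * freeGen .E) (qBr (freeGen .H))

/-- The algebra `U_h(sl₂)`: the `h`-adically complete algebra topologically generated by
`H`, `E`, `F` subject to the relations `UhRel`, i.e. the separated completion of the quotient of
the completed free algebra by the two-sided ideal generated by the relations (equivalently, its
quotient by the closure of that ideal). -/
def Uh : Type := HComp (RingQuot UhRel)

instance : Ring Uh := inferInstanceAs (Ring (HComp (RingQuot UhRel)))

instance : Algebra Rh Uh := inferInstanceAs (Algebra Rh (HComp (RingQuot UhRel)))

instance : IsAdicComplete hId Uh := inferInstanceAs (IsAdicComplete hId (HComp (RingQuot UhRel)))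

/-- The canonical map from the completed free algebra to `U_h`. -/
def freeToUh : FreeH →ₐ[Rh] Uh :=
  (hofAlg (A := RingQuot UhRel)).comp (RingQuot.mkAlgHom Rh UhRel)

/-- The generators of `U_h`. -/
def gen (g : Gen) : Uh := freeToUh (freeGen g)

section UniversalProperty

variable {B : Type*} [Ring B] [Algebra Rh B] [IsAdicComplete hId B]

/-- The relations of `U_h(sl₂)` for elements of an `h`-adically complete algebra. -/
structure SatRel (f : Gen → B) : Prop where
  HE : f .H * f .E - f .E * f .H = (2 : ℕ) • f .E
  HF : f .H * f .F - f .F * f .H = -((2 : ℕ) • f .F)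
  EF : f .E * f .F - f .F * f .E = qBr (f .H)

/-- The homomorphism from the completed free algebra with prescribed values. -/
def freeLift (f : Gen → B) : FreeH →ₐ[Rh] B :=
  hExtendAlg (A := FreeAlgebra Rh Gen) (FreeAlgebra.lift Rh f)

theorem freeLift_gen (f : Gen → B) (g : Gen) : freeLift f (freeGen g) = f g :=
  (hExtendAlg_hof (A := FreeAlgebra Rh Gen) _ _).trans (FreeAlgebra.lift_ι_apply f g)

/-- The homomorphism from `U_h` with prescribed values on the generators. -/
def uhLift (f : Gen → B) (hf : SatRel f) : Uh →ₐ[Rh] B :=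
  hExtendAlg (A := RingQuot UhRel) (RingQuot.liftAlgHom Rh ⟨freeLift f, by
    intro x y hxy
    cases hxy with
    | HE => simpa only [map_sub, map_mul, map_nsmul, freeLift_gen] using hf.HE
    | HF => simpa only [map_sub, map_mul, map_neg, map_nsmul, freeLift_gen] using hf.HF
    | EF => simpa only [map_sub, map_mul, map_qBr, freeLift_gen] using hf.EF⟩)

@[simp]
theorem uhLift_gen (f : Gen → B) (hf : SatRel f) (g : Gen) : uhLift f hf (gen g) = f g := by
  refine (hExtendAlg_hof (A := RingQuot UhRel) _ _).trans ?_
  erw [RingQuot.liftAlgHom_mkAlgHom_apply]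
  exact freeLift_gen f g

theorem uh_hom_ext {f g : Uh →ₐ[Rh] B} (h : ∀ x, f (gen x) = g (gen x)) : f = g := by
  refine hcomp_algHom_ext (A := RingQuot UhRel) (RingQuot.ringQuot_ext' Rh _ _ ?_)
  refine hcomp_algHom_ext (A := FreeAlgebra Rh Gen) (FreeAlgebra.hom_ext ?_)
  ext x
  exact h x

end UniversalProperty

theorem satRel_gen : SatRel gen where
  HE := by
    have := congrArg (hofAlg (A := RingQuot UhRel)) (RingQuot.mkAlgHom_rel Rh UhRel.HE)
    change freeToUh _ = freeToUh _ at this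
    simpa only [gen, map_sub, map_mul, map_nsmul] using this
  HF := by
    have := congrArg (hofAlg (A := RingQuot UhRel)) (RingQuot.mkAlgHom_rel Rh UhRel.HF)
    change freeToUh _ = freeToUh _ at this
    simpa only [gen, map_sub, map_mul, map_neg, map_nsmul] using this
  EF := by
    have := congrArg (hofAlg (A := RingQuot UhRel)) (RingQuot.mkAlgHom_rel Rh UhRel.EF)
    change freeToUh _ = freeToUh _ at this
    simpa only [gen, map_sub, map_mul, map_qBr] using this

section Commutation

theorem half_mul_two {B : Type*} [Ring B] [Algebra Rh B] (x : B) : cst (1 / 2) • ((2 : ℕ) • x) = x := by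
  rw [← Nat.cast_smul_eq_nsmul Rh, smul_smul]
  have : cst (1 / 2) * ((2 : ℕ) : Rh) = 1 := by
    rw [← map_natCast (PowerSeries.C (R := ℚ)), ← map_mul]
    norm_num
  rw [this, one_smul]

variable {B : Type*} [Ring B] [Algebra Rh B] [IsAdicComplete hId B] {f : Gen → B}

theorem SatRel.K_E (hf : SatRel f) : hExp (cst (1 / 2) • f .H) * f .E =
    vPow 2 • (f .E * hExp (cst (1 / 2) • f .H)) := by
  refine hExp_shift 2 ?_
  have h := congrArg (cst (1 / 2) • ·) (sub_eq_iff_eq_add.1 hf.HE)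
  simp only [smul_add, half_mul_two] at h
  simpa [mul_add, add_comm] using h

theorem SatRel.Kinv_E (hf : SatRel f) : hExp (-(cst (1 / 2) • f .H)) * f .E =
    vPow (-2) • (f .E * hExp (-(cst (1 / 2) • f .H))) := by
  refine hExp_shift (-2) ?_
  have h := congrArg (cst (1 / 2) • ·) (sub_eq_iff_eq_add.1 hf.HE)
  simp only [smul_add, half_mul_two] at h
  simpa [mul_add, add_comm] using congrArg Neg.neg h

theorem SatRel.K_F (hf : SatRel f) : hExp (cst (1 / 2) • f .H) * f .F =
    vPow (-2) • (f .F * hExp (cst (1 / 2) • f .H)) := by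
  refine hExp_shift (-2) ?_
  have h := congrArg (cst (1 / 2) • ·) (sub_eq_iff_eq_add.1 hf.HF)
  simp only [smul_add, smul_neg, half_mul_two] at h
  simpa [mul_add, add_comm] using h

theorem SatRel.Kinv_F (hf : SatRel f) : hExp (-(cst (1 / 2) • f .H)) * f .F =
    vPow 2 • (f .F * hExp (-(cst (1 / 2) • f .H))) := by
  refine hExp_shift 2 ?_
  have h := congrArg (cst (1 / 2) • ·) (sub_eq_iff_eq_add.1 hf.HF)
  simp only [smul_add, smul_neg, half_mul_two] at h
  simpa [mul_add, add_comm] using congrArg Neg.neg h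

end Commutation

namespace Uh

/-- The generator `H`. -/
def H : Uh := gen .H

/-- The generator `E`. -/
def E : Uh := gen .E

/-- The generator `F`. -/
def F : Uh := gen .F

/-- `K = exp (h H / 2)`. -/
def K : Uh := hExp (cst (1 / 2) • H)

/-- `K⁻¹ = exp (-h H / 2)`. -/
def Kinv : Uh := hExp (-(cst (1 / 2) • H))

theorem K_mul_Kinv : K * Kinv = 1 := by
  rw [K, Kinv, ← hExp_add ((Commute.refl _).neg_right), add_neg_cancel, hExp_zero]

theorem Kinv_mul_K : Kinv * K = 1 := by
  rw [K, Kinv, ← hExp_add ((Commute.refl _).neg_left), neg_add_cancel, hExp_zero]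

end Uh

/-! ### The completed tensor square and the Hopf algebra structure -/

/-- The `h`-adically completed tensor product `U_h ⊗̂ U_h`. -/
def Uh2 : Type := HComp (Uh ⊗[Rh] Uh)

instance : Ring Uh2 := inferInstanceAs (Ring (HComp (Uh ⊗[Rh] Uh)))

instance : Algebra Rh Uh2 := inferInstanceAs (Algebra Rh (HComp (Uh ⊗[Rh] Uh)))

instance : IsAdicComplete hId Uh2 := inferInstanceAs (IsAdicComplete hId (HComp (Uh ⊗[Rh] Uh)))

/-- The canonical map from the algebraic tensor square to the completed one. -/
def toUh2 : Uh ⊗[Rh] Uh →ₐ[Rh] Uh2 := hofAlg (A := Uh ⊗[Rh] Uh)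

/-- The tensor `x ⊗ y` in the completed tensor square. -/
def tm (x y : Uh) : Uh2 := toUh2 (x ⊗ₜ[Rh] y)

/-- `x ↦ x ⊗ 1`. -/
def inl : Uh →ₐ[Rh] Uh2 := toUh2.comp Algebra.TensorProduct.includeLeft

/-- `x ↦ 1 ⊗ x`. -/
def inr : Uh →ₐ[Rh] Uh2 := toUh2.comp Algebra.TensorProduct.includeRight

theorem tm_mul (a b c d : Uh) : tm a b * tm c d = tm (a * c) (b * d) := by
  rw [tm, tm, ← map_mul, Algebra.TensorProduct.tmul_mul_tmul, tm]

theorem inl_apply (x : Uh) : inl x = tm x 1 := rfl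

theorem inr_apply (x : Uh) : inr x = tm 1 x := rfl

theorem tm_eq (x y : Uh) : tm x y = inl x * inr y := by
  rw [inl_apply, inr_apply, tm_mul, mul_one, one_mul]

theorem commute_inl_inr (x y : Uh) : Commute (inl x) (inr y) := by
  rw [Commute, SemiconjBy, inl_apply, inr_apply, tm_mul, tm_mul]
  simp

theorem tm_add_left (x y z : Uh) : tm (x + y) z = tm x z + tm y z := by
  rw [tm, TensorProduct.add_tmul, map_add, tm, tm]

theorem tm_add_right (x y z : Uh) : tm x (y + z) = tm x y + tm x z := by
  rw [tm, TensorProduct.tmul_add, map_add, tm, tm]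

theorem tm_smul_left (c : Rh) (x y : Uh) : tm (c • x) y = c • tm x y := by
  rw [tm, ← TensorProduct.smul_tmul', map_smul, tm]

theorem tm_smul_right (c : Rh) (x y : Uh) : tm x (c • y) = c • tm x y := by
  rw [tm, TensorProduct.tmul_smul, map_smul, tm]

open Uh

theorem H_mul_E : H * E = (2 : Rh) • E + E * H := by
  have h := sub_eq_iff_eq_add.1 satRel_gen.HE
  rwa [← Nat.cast_smul_eq_nsmul Rh] at h

theorem H_mul_F : H * F = (-2 : Rh) • F + F * H := by
  have h := sub_eq_iff_eq_add.1 satRel_gen.HF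
  rwa [← Nat.cast_smul_eq_nsmul Rh, ← neg_smul] at h

theorem E_mul_F : E * F = qBr H + F * E := sub_eq_iff_eq_add.1 satRel_gen.EF

theorem H_mul_K : H * K = K * H :=
  (hExp_mul_comm (by rw [smul_mul_assoc, mul_smul_comm])).symm

theorem H_mul_Kinv : H * Kinv = Kinv * H :=
  (hExp_mul_comm (by rw [neg_mul, mul_neg, smul_mul_assoc, mul_smul_comm])).symm

theorem K_mul_E : K * E = vPow 2 • (E * K) := satRel_gen.K_E

theorem Kinv_mul_E : Kinv * E = vPow (-2) • (E * Kinv) := satRel_gen.Kinv_E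

theorem K_mul_F : K * F = vPow (-2) • (F * K) := satRel_gen.K_F

theorem Kinv_mul_F : Kinv * F = vPow 2 • (F * Kinv) := satRel_gen.Kinv_F

/-- The values of the comultiplication on the generators. -/
def comulGen : Gen → Uh2
  | .H => tm H 1 + tm 1 H
  | .E => tm E 1 + tm K E
  | .F => tm F Kinv + tm 1 F

theorem satRel_comulGen : SatRel comulGen where
  HE := by
    rw [← Nat.cast_smul_eq_nsmul Rh]
    simp only [comulGen, mul_add, add_mul, tm_mul, mul_one, one_mul, H_mul_K, H_mul_E,
      tm_add_left, tm_add_right, tm_smul_left, tm_smul_right, smul_add, Nat.cast_ofNat]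
    abel
  HF := by
    rw [← Nat.cast_smul_eq_nsmul Rh, ← neg_smul]
    simp only [comulGen, mul_add, add_mul, tm_mul, mul_one, one_mul, H_mul_Kinv, H_mul_F,
      tm_add_left, tm_add_right, tm_smul_left, tm_smul_right, smul_add, Nat.cast_ofNat]
    abel
  EF := by
    have h1 : qBr (inl H + inr H) = tm (qBr H) Kinv + tm K (qBr H) := by
      rw [qBr_add (commute_inl_inr H H), tm_eq, tm_eq, map_qBr, map_qBr, Kinv, map_hExp, K,
        map_hExp, map_neg, map_smul, map_smul]
    change _ = qBr (inl H + inr H)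
    have h2 : (vPow 2 * vPow (-2) : Rh) = 1 := by
      rw [← vPow_add]
      exact vPow_zero
    have h3 : E * Kinv = vPow 2 • (Kinv * E) := by
      rw [Kinv_mul_E, smul_smul, h2, one_smul]
    rw [h1]
    simp only [comulGen, mul_add, add_mul, tm_mul, mul_one, one_mul, K_mul_F, h3, E_mul_F,
      tm_add_left, tm_add_right, tm_smul_left, tm_smul_right, smul_smul, h2, one_smul]
    abel

/-- The comultiplication `Δ : U_h → U_h ⊗̂ U_h`. -/
def comul : Uh →ₐ[Rh] Uh2 := uhLift comulGen satRel_comulGen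

theorem satRel_counit : SatRel (fun _ : Gen => (0 : Rh)) where
  HE := by simp
  HF := by simp
  EF := by simp [qBr_zero]

/-- The counit `ε : U_h → ℚ⟦h⟧`, which vanishes on the generators. -/
def counit : Uh →ₐ[Rh] Rh := uhLift (fun _ => 0) satRel_counit

/-- The values of the antipode on the generators. -/
def antipodeGen : Gen → Uhᵐᵒᵖ
  | .H => .op (-H)
  | .E => .op (-(Kinv * E))
  | .F => .op (-(F * K))

/-- The values of the inverse of the antipode on the generators. -/
def antipodeInvGen : Gen → Uhᵐᵒᵖ
  | .H => .op (-H)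
  | .E => .op (-(E * Kinv))
  | .F => .op (-(K * F))

theorem qBr_op (x : Uh) : qBr (MulOpposite.op x) = MulOpposite.op (qBr x) := by
  rw [qBr, qBr, MulOpposite.op_smul]
  congr 1
  refine hSum_unique fun k => ?_
  have := map_mem_hPow (MulOpposite.opLinearEquiv Rh).toLinearMap (hSum_spec (shS x) k)
  simpa [shS] using this

theorem hExp_op (x : Uh) : hExp (MulOpposite.op x) = MulOpposite.op (hExp x) := by
  refine hSum_unique fun k => ?_
  have := map_mem_hPow (MulOpposite.opLinearEquiv Rh).toLinearMap (hSum_spec (expS x) k)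
  simpa [hExp, expS] using this

theorem EF_comm_Kinv : Kinv * (E * F) = E * F * Kinv := by
  have h2 : (vPow (-2) * vPow 2 : Rh) = 1 := by
    rw [← vPow_add]
    exact vPow_zero
  rw [← mul_assoc, Kinv_mul_E, smul_mul_assoc, mul_assoc, Kinv_mul_F, mul_smul_comm, smul_smul,
    h2, one_smul, mul_assoc]

theorem satRel_antipodeGen : SatRel antipodeGen where
  HE := by
    rw [← Nat.cast_smul_eq_nsmul Rh]
    apply MulOpposite.unop_injective
    simp only [antipodeGen, MulOpposite.unop_sub, MulOpposite.unop_mul, MulOpposite.unop_op,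
      MulOpposite.unop_smul, neg_mul_neg, ← mul_assoc, H_mul_Kinv]
    simp only [mul_assoc, H_mul_E, mul_add, mul_smul_comm, smul_neg, Nat.cast_ofNat]
    abel
  HF := by
    rw [← Nat.cast_smul_eq_nsmul Rh, ← neg_smul]
    apply MulOpposite.unop_injective
    simp only [antipodeGen, MulOpposite.unop_sub, MulOpposite.unop_mul, MulOpposite.unop_op,
      MulOpposite.unop_smul, neg_mul_neg, ← mul_assoc, H_mul_F, add_mul, smul_mul_assoc]
    simp only [mul_assoc, H_mul_K, smul_neg, Nat.cast_ofNat, neg_smul]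
    abel
  EF := by
    change _ = qBr (MulOpposite.op (-H))
    rw [qBr_op, qBr_neg]
    apply MulOpposite.unop_injective
    simp only [antipodeGen, MulOpposite.unop_sub, MulOpposite.unop_mul, MulOpposite.unop_op,
      neg_mul_neg]
    have h1 : F * K * (Kinv * E) = F * E := by
      rw [mul_assoc, ← mul_assoc K, K_mul_Kinv, one_mul]
    have h2 : Kinv * E * (F * K) = E * F := by
      rw [mul_assoc, ← mul_assoc E, ← mul_assoc Kinv, EF_comm_Kinv, mul_assoc, Kinv_mul_K, mul_one]
    rw [h1, h2, E_mul_F]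
    abel

theorem satRel_antipodeInvGen : SatRel antipodeInvGen where
  HE := by
    rw [← Nat.cast_smul_eq_nsmul Rh]
    apply MulOpposite.unop_injective
    simp only [antipodeInvGen, MulOpposite.unop_sub, MulOpposite.unop_mul, MulOpposite.unop_op,
      MulOpposite.unop_smul, neg_mul_neg, ← mul_assoc, H_mul_E, add_mul, smul_mul_assoc]
    simp only [mul_assoc, H_mul_Kinv, smul_neg, Nat.cast_ofNat]
    abel
  HF := by
    rw [← Nat.cast_smul_eq_nsmul Rh, ← neg_smul]
    apply MulOpposite.unop_injective
    simp only [antipodeInvGen, MulOpposite.unop_sub, MulOpposite.unop_mul, MulOpposite.unop_op,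
      MulOpposite.unop_smul, neg_mul_neg, ← mul_assoc, H_mul_K]
    simp only [mul_assoc, H_mul_F, mul_add, mul_smul_comm, smul_neg, Nat.cast_ofNat]
    simp only [neg_smul]
    abel
  EF := by
    change _ = qBr (MulOpposite.op (-H))
    rw [qBr_op, qBr_neg]
    apply MulOpposite.unop_injective
    simp only [antipodeInvGen, MulOpposite.unop_sub, MulOpposite.unop_mul, MulOpposite.unop_op,
      neg_mul_neg]
    have h1 : K * F * (E * Kinv) = F * E := by
      have h3 : (vPow 2 * vPow (-2) : Rh) = 1 := by
        rw [← vPow_add]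
        exact vPow_zero
      have h4 : E * Kinv = vPow 2 • (Kinv * E) := by
        rw [Kinv_mul_E, smul_smul, h3, one_smul]
      rw [h4, K_mul_F, smul_mul_smul_comm, mul_comm, h3, one_smul, mul_assoc, ← mul_assoc K,
        K_mul_Kinv, one_mul]
    have h2 : E * Kinv * (K * F) = E * F := by
      rw [mul_assoc, ← mul_assoc Kinv, Kinv_mul_K, one_mul]
    rw [h1, h2, E_mul_F]
    abel

/-- The antipode as a homomorphism to the opposite algebra. -/
def antipodeOp : Uh →ₐ[Rh] Uhᵐᵒᵖ := uhLift antipodeGen satRel_antipodeGen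

/-- The inverse of the antipode as a homomorphism to the opposite algebra. -/
def antipodeInvOp : Uh →ₐ[Rh] Uhᵐᵒᵖ := uhLift antipodeInvGen satRel_antipodeInvGen

/-- The antipode `S : U_h → U_h`. -/
def antipode : Uh →ₗ[Rh] Uh :=
  (MulOpposite.opLinearEquiv Rh).symm.toLinearMap ∘ₗ antipodeOp.toLinearMap

/-- The inverse `S⁻¹ : U_h → U_h` of the antipode. -/
def antipodeInv : Uh →ₗ[Rh] Uh :=
  (MulOpposite.opLinearEquiv Rh).symm.toLinearMap ∘ₗ antipodeInvOp.toLinearMap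

theorem antipode_mul (x y : Uh) : antipode (x * y) = antipode y * antipode x := by
  simp [antipode]

theorem antipodeInv_mul (x y : Uh) : antipodeInv (x * y) = antipodeInv y * antipodeInv x := by
  simp [antipodeInv]

theorem antipode_H : antipode H = -H :=
  congrArg MulOpposite.unop (uhLift_gen antipodeGen satRel_antipodeGen .H)

theorem antipode_E : antipode E = -(Kinv * E) :=
  congrArg MulOpposite.unop (uhLift_gen antipodeGen satRel_antipodeGen .E)

theorem antipode_F : antipode F = -(F * K) :=
  congrArg MulOpposite.unop (uhLift_gen antipodeGen satRel_antipodeGen .F)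

theorem antipodeInv_H : antipodeInv H = -H :=
  congrArg MulOpposite.unop (uhLift_gen antipodeInvGen satRel_antipodeInvGen .H)

theorem antipodeInv_E : antipodeInv E = -(E * Kinv) :=
  congrArg MulOpposite.unop (uhLift_gen antipodeInvGen satRel_antipodeInvGen .E)

theorem antipodeInv_F : antipodeInv F = -(K * F) :=
  congrArg MulOpposite.unop (uhLift_gen antipodeInvGen satRel_antipodeInvGen .F)

theorem antipode_hExp (x : Uh) : antipode (hExp x) = hExp (antipode x) := by
  apply MulOpposite.op_injective
  rw [← hExp_op]
  exact map_hExp antipodeOp x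

theorem antipodeInv_hExp (x : Uh) : antipodeInv (hExp x) = hExp (antipodeInv x) := by
  apply MulOpposite.op_injective
  rw [← hExp_op]
  exact map_hExp antipodeInvOp x

theorem antipode_K : antipode K = Kinv := by
  rw [K, antipode_hExp, map_smul, antipode_H, smul_neg, Kinv]

theorem antipode_Kinv : antipode Kinv = K := by
  rw [Kinv, antipode_hExp, map_neg, map_smul, antipode_H, smul_neg, neg_neg, K]

theorem antipodeInv_K : antipodeInv K = Kinv := by
  rw [K, antipodeInv_hExp, map_smul, antipodeInv_H, smul_neg, Kinv]

theorem antipodeInv_Kinv : antipodeInv Kinv = K := by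
  rw [Kinv, antipodeInv_hExp, map_neg, map_smul, antipodeInv_H, smul_neg, neg_neg, K]

theorem antipodeInv_antipode (x : Uh) : antipodeInv (antipode x) = x := by
  have h := uh_hom_ext (f := AlgHom.ofLinearMap (antipodeInv ∘ₗ antipode)
    (by simp [antipode, antipodeInv])
    (fun x y => by simp [antipode_mul, antipodeInv_mul])) (g := AlgHom.id Rh Uh) (by
      rintro (_ | _ | _)
      · change antipodeInv (antipode H) = H
        rw [antipode_H, map_neg, antipodeInv_H, neg_neg]
      · change antipodeInv (antipode E) = E
        rw [antipode_E, map_neg, antipodeInv_mul, antipodeInv_E, antipodeInv_Kinv, neg_mul,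
          neg_neg, mul_assoc, Kinv_mul_K, mul_one]
      · change antipodeInv (antipode F) = F
        rw [antipode_F, map_neg, antipodeInv_mul, antipodeInv_F, antipodeInv_K, mul_neg,
          neg_neg, ← mul_assoc, Kinv_mul_K, one_mul])
  exact AlgHom.congr_fun h x

theorem antipode_antipodeInv (x : Uh) : antipode (antipodeInv x) = x := by
  have h := uh_hom_ext (f := AlgHom.ofLinearMap (antipode ∘ₗ antipodeInv)
    (by simp [antipode, antipodeInv])
    (fun x y => by simp [antipode_mul, antipodeInv_mul])) (g := AlgHom.id Rh Uh) (by
      rintro (_ | _ | _)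
      · change antipode (antipodeInv H) = H
        rw [antipodeInv_H, map_neg, antipode_H, neg_neg]
      · change antipode (antipodeInv E) = E
        rw [antipodeInv_E, map_neg, antipode_mul, antipode_E, antipode_Kinv, mul_neg,
          neg_neg, ← mul_assoc, K_mul_Kinv, one_mul]
      · change antipode (antipodeInv F) = F
        rw [antipodeInv_F, map_neg, antipode_mul, antipode_F, antipode_K, neg_mul,
          neg_neg, mul_assoc, K_mul_Kinv, mul_one])
  exact AlgHom.congr_fun h x

/-! ### The universal `R`-matrix -/

/-- The quantum integer `[n] = (vⁿ - v⁻ⁿ) / (v - v⁻¹) = v^(n-1) + v^(n-3) + ⋯ + v^(1-n)`. -/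
def qInt (n : ℕ) : Rh := ∑ j ∈ Finset.range n, vPow ((n : ℤ) - 1 - 2 * j)

/-- The quantum factorial `[n]!`. -/
def qFact (n : ℕ) : Rh := ∏ i ∈ Finset.range n, qInt (i + 1)

/-- `D = exp (h / 4 H ⊗ H)`. -/
def Dmat : Uh2 := hExp (cst (1 / 4) • tm H H)

/-- The universal `R`-matrix
`D (∑ v^(n(n-1)/2) (v - v⁻¹)ⁿ / [n]! Fⁿ ⊗ Eⁿ)`, where `v - v⁻¹ = h sh`. -/
def Rmat : Uh2 :=
  Dmat * hSum (PowerSeries.mk fun n =>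
    (vPow (n * (n - 1) / 2) * sh ^ n * (qFact n)⁻¹) • tm (F ^ n) (E ^ n))

/-! ### The transmutation of `U_h` -/

/-- Summation `∑ f (x' ⊗ x'')` over the tensors of an element `x = ∑ x' ⊗ x''` of the completed
tensor square. -/
def sum2 {N : Type*} [AddCommGroup N] [Module Rh N] [IsAdicComplete hId N] :
    Uh2 →ₗ[Rh] (Uh ⊗[Rh] Uh →ₗ[Rh] N) →ₗ[Rh] N := hPair (M := Uh ⊗[Rh] Uh)

/-- The extension to the completed tensor square. -/
def ext2 {N : Type*} [AddCommGroup N] [Module Rh N] [IsAdicComplete hId N]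
    (f : Uh ⊗[Rh] Uh →ₗ[Rh] N) : Uh2 →ₗ[Rh] N := hExtend (M := Uh ⊗[Rh] Uh) f

/-- The left adjoint action `x ▷ y = ∑ x₍₁₎ y S(x₍₂₎)`. -/
def ad : Uh →ₗ[Rh] Uh →ₗ[Rh] Uh :=
  LinearMap.mk₂ Rh
    (fun x y => sum2 (comul x)
      (LinearMap.mul' Rh Uh ∘ₗ TensorProduct.map (LinearMap.mulRight Rh y) antipode))
    (fun x x' y => by simp) (fun c x y => by simp)
    (fun x y y' => by
      rw [← map_add]
      congr 1
      exact TensorProduct.ext' fun a b => by simp [mul_add, add_mul])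
    (fun c x y => by
      rw [← map_smul]
      congr 1
      exact TensorProduct.ext' fun a b => by simp)

/-- The map `a ⊗ b ↦ g b ⊗ f a` into the completed tensor square. -/
def swapMap (f g : Uh →ₗ[Rh] Uh) : Uh ⊗[Rh] Uh →ₗ[Rh] Uh2 :=
  toUh2.toLinearMap ∘ₗ TensorProduct.map g f ∘ₗ (TensorProduct.comm Rh Uh Uh).toLinearMap

theorem swapMap_tmul (f g : Uh →ₗ[Rh] Uh) (a b : Uh) :
    swapMap f g (a ⊗ₜ b) = tm (g b) (f a) := rfl

theorem tm_zero_left (x : Uh) : tm 0 x = 0 := by simp [tm]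

/-- The bilinear map `(f, g) ↦ swapMap f g`. -/
def swapMap₂ : (Uh →ₗ[Rh] Uh) →ₗ[Rh] (Uh →ₗ[Rh] Uh) →ₗ[Rh] (Uh ⊗[Rh] Uh →ₗ[Rh] Uh2) :=
  LinearMap.mk₂ Rh swapMap
    (fun f f' g => TensorProduct.ext' fun a b => by simp [swapMap_tmul, tm_add_right])
    (fun c f g => TensorProduct.ext' fun a b => by simp [swapMap_tmul, tm_smul_right])
    (fun f g g' => TensorProduct.ext' fun a b => by simp [swapMap_tmul, tm_add_left])
    (fun c f g => TensorProduct.ext' fun a b => by simp [swapMap_tmul, tm_smul_left])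

/-- The braiding `ψ (x ⊗ y) = ∑ (β ▷ y) ⊗ (α ▷ x)`, where `R = ∑ α ⊗ β`. -/
def braiding : Uh2 →ₗ[Rh] Uh2 :=
  ext2 (TensorProduct.lift (LinearMap.mk₂ Rh
    (fun x y => sum2 Rmat (swapMap₂ (ad.flip x) (ad.flip y)))
    (fun x x' y => by simp) (fun c x y => by simp)
    (fun x y y' => by simp) (fun c x y => by simp)))

/-- The inverse braiding `ψ⁻¹ (x ⊗ y) = ∑ (S(α) ▷ y) ⊗ (β ▷ x)`, where `R = ∑ α ⊗ β`. -/
def braidingInv : Uh2 →ₗ[Rh] Uh2 :=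
  ext2 (TensorProduct.lift (LinearMap.mk₂ Rh
    (fun x y => sum2 Rmat (toUh2.toLinearMap ∘ₗ
      TensorProduct.map (ad.flip y ∘ₗ antipode) (ad.flip x)))
    (fun x x' y => by
      rw [← map_add]
      congr 1
      exact TensorProduct.ext' fun a b => by simp [TensorProduct.tmul_add])
    (fun c x y => by
      rw [← map_smul]
      congr 1
      exact TensorProduct.ext' fun a b => by simp)
    (fun x y y' => by
      rw [← map_add]
      congr 1
      exact TensorProduct.ext' fun a b => by simp [TensorProduct.add_tmul])
    (fun c x y => by
      rw [← map_smul]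
      congr 1
      exact TensorProduct.ext' fun a b => by simp [← TensorProduct.smul_tmul'])))

/-- The multiplication `μ : U_h ⊗̂ U_h → U_h`. -/
def mult : Uh2 →ₗ[Rh] Uh := ext2 (LinearMap.mul' Rh Uh)

/-- The unit `η : ℚ⟦h⟧ → U_h`. -/
def unit : Rh →ₗ[Rh] Uh := Algebra.linearMap Rh Uh

/-- The braided comultiplication `x ↦ ∑ x₍₁₎ S(β) ⊗ (α ▷ x₍₂₎)`, where `R = ∑ α ⊗ β`. -/
def bComul : Uh →ₗ[Rh] Uh2 :=
  ext2 (TensorProduct.lift (LinearMap.mk₂ Rh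
    (fun x y => sum2 Rmat (swapMap₂ (ad.flip y) (LinearMap.mulLeft Rh x ∘ₗ antipode)))
    (fun x x' y => by
      rw [← map_add]
      congr 1
      exact TensorProduct.ext' fun a b => by simp [swapMap₂, swapMap_tmul, add_mul, tm_add_left])
    (fun c x y => by
      rw [← map_smul]
      congr 1
      exact TensorProduct.ext' fun a b => by simp [swapMap₂, swapMap_tmul, tm_smul_left])
    (fun x y y' => by simp) (fun c x y => by simp))) ∘ₗ comul.toLinearMap

/-- The braided antipode `x ↦ ∑ β S(α ▷ x)`, where `R = ∑ α ⊗ β`. -/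
def bAntipode : Uh →ₗ[Rh] Uh :=
  sum2 Rmat ∘ₗ
    { toFun := fun x => LinearMap.mul' Rh Uh ∘ₗ
        TensorProduct.map LinearMap.id (antipode ∘ₗ ad.flip x) ∘ₗ
          (TensorProduct.comm Rh Uh Uh).toLinearMap
      map_add' := fun x y => TensorProduct.ext' fun a b => by simp [mul_add]
      map_smul' := fun c x => TensorProduct.ext' fun a b => by simp }

/-- The inverse braided antipode `x ↦ ∑ S⁻¹(α ▷ x) β`, where `R = ∑ α ⊗ β`. -/
def bAntipodeInv : Uh →ₗ[Rh] Uh :=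
  sum2 Rmat ∘ₗ
    { toFun := fun x => LinearMap.mul' Rh Uh ∘ₗ
        TensorProduct.map (antipodeInv ∘ₗ ad.flip x) LinearMap.id
      map_add' := fun x y => TensorProduct.ext' fun a b => by simp [add_mul]
      map_smul' := fun c x => TensorProduct.ext' fun a b => by simp }

/-! ### The even integral form and its completions -/

/-- The subring `ℤ[q, q⁻¹]` of `ℚ⟦h⟧`. -/
def Zq : Subring Rh := Subring.closure {vPow 2, vPow (-2)}

/-- `e = (v - v⁻¹) E`. -/
def e : Uh := (vPow 1 - vPow (-1)) • E

/-- The quantum integer `[n]_q = (qⁿ - 1) / (q - 1) = 1 + q + ⋯ + q^(n-1)`. -/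
def qIntQ (n : ℕ) : Rh := ∑ j ∈ Finset.range n, vPow (2 * j)

/-- The quantum factorial `[n]_q!`. -/
def qFactQ (n : ℕ) : Rh := ∏ i ∈ Finset.range n, qIntQ (i + 1)

/-- The divided power `Fⁿ Kⁿ / [n]_q!`. -/
def Fdiv (n : ℕ) : Uh := (qFactQ n)⁻¹ • (F ^ n * K ^ n)

/-- The even integral form: the `ℤ[q, q⁻¹]`-subalgebra of `U_h` generated by `K²`, `K⁻²`, `e` and
`Fdiv n` for `n ≥ 1`. -/
def Uev : Subalgebra Zq Uh :=
  Algebra.adjoin Zq ({K ^ 2, Kinv ^ 2, e} ∪ {x | ∃ n : ℕ, 1 ≤ n ∧ x = Fdiv n})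

/-- The two-sided ideal of the even integral form generated by `eᵖ`. -/
def fil1 (p : ℕ) : Submodule Zq Uh :=
  Submodule.span Zq {x | ∃ a ∈ Uev, ∃ b ∈ Uev, x = a * e ^ p * b}

/-- The filtration of the tensor square of the even integral form, inside `U_h ⊗̂ U_h`. -/
def fil2 (p : ℕ) : Submodule Zq Uh2 :=
  Submodule.span Zq {z | ∃ x ∈ fil1 p, ∃ y ∈ Uev, z = tm x y} ⊔
    Submodule.span Zq {z | ∃ x ∈ Uev, ∃ y ∈ fil1 p, z = tm x y}

/-- The filtration of the zeroth tensor power `ℤ[q, q⁻¹]`, inside `ℚ⟦h⟧`. -/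
def fil0 (p : ℕ) : Submodule Zq Rh := if p = 0 then 1 else ⊥

section FilteredCompletion

variable {M : Type*} [AddCommGroup M] [Module Rh M]
variable {N : Type*} [AddCommGroup N] [Module Rh N]

/-- `h`-adic convergence of a sequence. -/
def HTendsto (w : ℕ → M) (x : M) : Prop := ∀ k, ∃ n₀, ∀ n ≥ n₀, w n - x ∈ hPow M k

/-- The `p`-th step of the filtration of the completion in `M` of the filtered module
`L 0 ⊇ L 1 ⊇ ⋯`. An element of the inverse limit of the quotients `L 0 / L n` is represented by a
sequence `w` in `L 0` with `w (n + 1) ≡ w n` modulo `L n`; it lies in the `p`-th step if its image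
in `L 0 / L p` vanishes; and its image in `M` is the `h`-adic limit of `w`. -/
def complFil (L : ℕ → Submodule Zq M) (p : ℕ) : Submodule Zq M where
  carrier := {x | ∃ w : ℕ → M, (∀ n, w n ∈ L 0) ∧ (∀ n, w (n + 1) - w n ∈ L n) ∧ w p ∈ L p ∧
    HTendsto w x}
  add_mem' := by
    rintro x y ⟨w, h1, h2, h3, h4⟩ ⟨w', h1', h2', h3', h4'⟩
    refine ⟨w + w', fun n => add_mem (h1 n) (h1' n), fun n => ?_, add_mem h3 h3', fun k => ?_⟩
    · simpa [add_sub_add_comm] using add_mem (h2 n) (h2' n)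
    · obtain ⟨n₀, hn⟩ := h4 k
      obtain ⟨n₁, hn'⟩ := h4' k
      refine ⟨max n₀ n₁, fun n hnn => ?_⟩
      simpa [add_sub_add_comm] using
        add_mem (hn n (le_of_max_le_left hnn)) (hn' n (le_of_max_le_right hnn))
  zero_mem' := ⟨0, by simp, by simp, by simp, fun k => ⟨0, by simp⟩⟩
  smul_mem' := by
    rintro c x ⟨w, h1, h2, h3, h4⟩
    refine ⟨c • w, fun n => Submodule.smul_mem _ _ (h1 n), fun n => ?_,
      Submodule.smul_mem _ _ h3, fun k => ?_⟩
    · simpa [smul_sub] using Submodule.smul_mem _ c (h2 n)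
    · obtain ⟨n₀, hn⟩ := h4 k
      refine ⟨n₀, fun n hnn => ?_⟩
      have := Submodule.smul_mem _ (c : Rh) (hn n hnn)
      rw [smul_sub] at this
      exact this

/-- The completion in `M` of a filtered module `L 0 ⊇ L 1 ⊇ ⋯`: the image in `M` of the inverse
limit of the quotients `L 0 / L n`. -/
def Compl (L : ℕ → Submodule Zq M) : Type _ := {x : M // x ∈ complFil L 0}

/-- The topology of the completion, generated by the cosets of the subgroups `complFil L p`
(which form a basis, as `L` is decreasing); it is the quotient of the inverse limit topology. -/
instance (L : ℕ → Submodule Zq M) : TopologicalSpace (Compl L) :=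
  TopologicalSpace.generateFrom
    {V | ∃ (x : Compl L) (p : ℕ), V = {y | y.1 - x.1 ∈ complFil L p}}

/-- A linear map restricts to a continuous map between the completions of filtered modules. -/
def RestrictsContinuously (f : M →ₗ[Rh] N) (L : ℕ → Submodule Zq M) (L' : ℕ → Submodule Zq N) :
    Prop :=
  ∃ hf : ∀ x ∈ complFil L 0, f x ∈ complFil L' 0,
    Continuous (X := Compl L) (Y := Compl L') fun x => ⟨f x.1, hf x.1 x.2⟩

end FilteredCompletion

end QuantumSl2

end

/-!
On vectors of weight `m` the Cartan factor `exp (h/4 H ⊗ H)` of `R` acts through powers of `K` and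
`v`, so each braided structure map is an `h`-adically convergent series whose `n`-th term is built
from `Fⁿ` and `Eⁿ`. Its coefficient is a power of `v` times `(v - v⁻¹)ⁿ / [n]_q!`: exactly the
scalars that turn `Eⁿ` into `eⁿ` and `Fⁿ` into a divided power. Divided powers of `F` act on the
integral form, and `eⁿ` pushes the `n`-th term deeper into the filtration, so the series also
converges in the completion and depends continuously on its argument. The remaining point is a
parity check, since only even powers of `v` and `K` are integral.

One of the two inverse laws for the braiding, and likewise for the braided antipode, comes from
`∑ (-1)^i q^(j(j-1)/2) / ([i]_q! [j]_q!) = 0`, the sum over `i + j = n > 0`. The other then follows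
because the composite is the identity modulo `h`, hence injective. For the antipode, the two
series are first rearranged around the Drinfeld element with its Cartan part removed, which
then cancels against its inverse.
-/

noncomputable section

namespace QuantumSl2

open Uh
open Filter (Tendsto atTop)
open Finset.HasAntidiagonal (antidiagonal mem_antidiagonal)

/-! ### Convergent sums in `h`-adically complete modules -/

section Sums

variable {M : Type*} [AddCommGroup M] [Module Rh M]
variable {N : Type*} [AddCommGroup N] [Module Rh N]

theorem mem_hPow_of_le {k l : ℕ} (h : k ≤ l) {x : M} (hx : x ∈ hPow M l) : x ∈ hPow M k :=
  Submodule.pow_smul_top_le hId M h hx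

theorem X_pow_smul_mem_hPow (k : ℕ) (x : M) : (PowerSeries.X : Rh) ^ k • x ∈ hPow M k :=
  mem_hPow_iff.2 ⟨x, rfl⟩

theorem X_pow_smul_mem_hPow_add {k l : ℕ} {x : M} (hx : x ∈ hPow M l) :
    (PowerSeries.X : Rh) ^ k • x ∈ hPow M (k + l) := by
  obtain ⟨y, rfl⟩ := mem_hPow_iff.1 hx
  exact mem_hPow_iff.2 ⟨y, by rw [smul_smul, pow_add]⟩

/-- The `h`-adically convergent sum `x = ∑ hⁿ aₙ`. The powers of `h` are not part of the terms, so
that convergence in a complete module imposes no condition on `a`. -/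
def HasHSum (a : ℕ → M) (x : M) : Prop :=
  ∀ k, x - ∑ n ∈ Finset.range k, (PowerSeries.X : Rh) ^ n • a n ∈ hPow M k

theorem HasHSum.unique [IsHausdorff hId M] {a : ℕ → M} {x y : M} (hx : HasHSum a x)
    (hy : HasHSum a y) : x = y :=
  eq_of_sub_mem_hPow fun k => by simpa using Submodule.sub_mem _ (hx k) (hy k)

theorem HasHSum.congr {a b : ℕ → M} {x : M} (hx : HasHSum a x) (h : ∀ n, a n = b n) :
    HasHSum b x := (funext h : a = b) ▸ hx

theorem HasHSum.map {a : ℕ → M} {x : M} (hx : HasHSum a x) (f : M →ₗ[Rh] N) :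
    HasHSum (fun n => f (a n)) (f x) := fun k => by
  simpa using map_mem_hPow f (hx k)

theorem HasHSum.sub {a b : ℕ → M} {x y : M} (hx : HasHSum a x) (hy : HasHSum b y) :
    HasHSum (fun n => a n - b n) (x - y) := fun k => by
  have hxy := Submodule.sub_mem _ (hx k) (hy k)
  simp only [smul_sub, Finset.sum_sub_distrib]
  rwa [sub_sub_sub_comm] at hxy

theorem hasHSum_zero : HasHSum (fun _ => (0 : M)) 0 := fun k => by simp

theorem hasHSum_single {a : ℕ → M} (h : ∀ n, a (n + 1) = 0) : HasHSum a (a 0) := fun k => by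
  rcases k with _ | k
  · exact mem_hPow_zero _
  · rw [Finset.sum_range_succ', Finset.sum_eq_zero fun i _ => by rw [h, smul_zero]]
    simp

theorem HasHSum.shift {a : ℕ → M} {x : M} (hx : HasHSum a x) (h0 : a 0 = 0) :
    HasHSum (fun n => (PowerSeries.X : Rh) • a (n + 1)) x := fun k => by
  have hk := mem_hPow_of_le (Nat.le_succ k) (hx (k + 1))
  rw [Finset.sum_range_succ', h0, smul_zero, add_zero] at hk
  simpa only [smul_smul, ← pow_succ] using hk

theorem hasHSum_hSum {B : Type*} [Ring B] [Algebra Rh B] [IsAdicComplete hId B]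
    (a : PowerSeries B) : HasHSum (fun n => PowerSeries.coeff n a) (hSum a) := hSum_spec a

theorem sum_X_pow_smul_antidiagonal (s : ℕ → ℕ → M) (k : ℕ) :
    ∑ n ∈ Finset.range k, (PowerSeries.X : Rh) ^ n • ∑ p ∈ antidiagonal n, s p.1 p.2 =
      ∑ i ∈ Finset.range k, (PowerSeries.X : Rh) ^ i •
        ∑ j ∈ Finset.range (k - i), (PowerSeries.X : Rh) ^ j • s i j := by
  simp only [Finset.smul_sum, smul_smul, ← pow_add]
  rw [← Finset.sum_range_diag_flip k fun i j => (PowerSeries.X : Rh) ^ (i + j) • s i j]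
  refine Finset.sum_congr rfl fun n _ => ?_
  rw [Finset.Nat.sum_antidiagonal_eq_sum_range_succ fun i j => (PowerSeries.X : Rh) ^ n • s i j]
  refine Finset.sum_congr rfl fun i hi => ?_
  rw [Nat.add_sub_cancel' (Nat.lt_succ_iff.1 (Finset.mem_range.1 hi))]

theorem hasHSum_antidiagonal {s : ℕ → ℕ → M} {t : ℕ → M} (hs : ∀ i, HasHSum (s i) (t i)) {z : M} :
    HasHSum (fun n => ∑ p ∈ antidiagonal n, s p.1 p.2) z ↔ HasHSum t z := by
  refine forall_congr' fun k => ?_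
  have partial_sums_congr : ∑ i ∈ Finset.range k, (PowerSeries.X : Rh) ^ i • t i -
      ∑ n ∈ Finset.range k, (PowerSeries.X : Rh) ^ n • ∑ p ∈ antidiagonal n, s p.1 p.2 ∈
        hPow M k := by
    rw [sum_X_pow_smul_antidiagonal, ← Finset.sum_sub_distrib]
    refine Submodule.sum_mem _ fun i hi => ?_
    have tail_mem := X_pow_smul_mem_hPow_add (k := i) (hs i (k - i))
    rwa [smul_sub, Nat.add_sub_cancel' (Finset.mem_range.1 hi).le] at tail_mem
  rw [← Submodule.sub_mem_iff_left _ partial_sums_congr, sub_sub_sub_cancel_right]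

theorem map_hExp_eq {B C : Type*} [Ring B] [Algebra Rh B] [IsAdicComplete hId B] [Ring C]
    [Algebra Rh C] [IsAdicComplete hId C] [IsHausdorff hId N] (f : B →ₗ[Rh] N) (g : C →ₗ[Rh] N)
    {x : B} {y : C} (h : ∀ n, f (x ^ n) = g (y ^ n)) : f (hExp x) = g (hExp y) := by
  refine ((hasHSum_hSum (expS x)).map f).unique (((hasHSum_hSum (expS y)).map g).congr fun n => ?_)
  simp [expS, h]

theorem injective_of_sub_mem_hPow [IsHausdorff hId M] (f : M →ₗ[Rh] M)
    (hf : ∀ x, f x - x ∈ hPow M 1) : Function.Injective f := by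
  rw [injective_iff_map_eq_zero]
  intro x hx
  refine eq_of_sub_mem_hPow fun k => ?_
  rw [sub_zero]
  induction k with
  | zero => exact mem_hPow_zero _
  | succ k ih =>
    obtain ⟨y, rfl⟩ := mem_hPow_iff.1 ih
    have hy := X_pow_smul_mem_hPow_add (k := k) (hf y)
    rwa [smul_sub, ← map_smul, hx, zero_sub, Submodule.neg_mem_iff] at hy

end Sums

/-! ### Completions of filtered modules -/

section FilteredCompletion

variable {M : Type*} [AddCommGroup M] [Module Rh M]
variable {N : Type*} [AddCommGroup N] [Module Rh N]

theorem HTendsto.map {w : ℕ → M} {x : M} (h : HTendsto w x) (f : M →ₗ[Rh] N) :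
    HTendsto (fun n => f (w n)) (f x) := fun k => by
  obtain ⟨n₀, hn⟩ := h k
  exact ⟨n₀, fun n hnn => by simpa using map_mem_hPow f (hn n hnn)⟩

theorem HasHSum.hTendsto {a : ℕ → M} {x : M} (h : HasHSum a x) :
    HTendsto (fun k => ∑ n ∈ Finset.range k, (PowerSeries.X : Rh) ^ n • a n) x := fun k =>
  ⟨k, fun n hn => by simpa using Submodule.neg_mem _ (mem_hPow_of_le hn (h n))⟩

variable {L : ℕ → Submodule Zq M} {L' : ℕ → Submodule Zq N}

theorem le_complFil (hL : Antitone L) (p : ℕ) : L p ≤ complFil L p :=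
  fun x hx => ⟨fun _ => x, fun _ => hL (Nat.zero_le p) hx, fun n => by simp, hx,
    fun k => ⟨0, fun n _ => by simp⟩⟩

theorem exists_seq_of_mem_complFil {p : ℕ} {x : M} (hx : x ∈ complFil L p) :
    ∃ w : ℕ → M, (∀ n, w n ∈ L 0) ∧ (∀ n, w (n + 1) - w n ∈ L n) ∧ (∀ n ≤ p, w n = 0) ∧
      HTendsto w x := by
  obtain ⟨w, w_mem, w_succ, w_p, w_lim⟩ := hx
  refine ⟨fun n => if n ≤ p then 0 else w n, fun n => ?_, fun n => ?_, fun n hn => if_pos hn,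
    fun k => ?_⟩
  · dsimp only
    split_ifs
    exacts [zero_mem _, w_mem n]
  · dsimp only
    rcases lt_trichotomy n p with h | rfl | h
    · rw [if_pos h.le, if_pos (Nat.succ_le_of_lt h), sub_zero]
      exact zero_mem _
    · rw [if_pos le_rfl, if_neg (by omega), sub_zero]
      simpa using add_mem (w_succ n) w_p
    · rw [if_neg (by omega), if_neg (by omega)]
      exact w_succ n
  · obtain ⟨n₀, hn⟩ := w_lim k
    refine ⟨max n₀ (p + 1), fun n hnn => ?_⟩
    dsimp only
    rw [if_neg (by have := le_of_max_le_right hnn; omega)]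
    exact hn n (le_of_max_le_left hnn)

theorem complFil_antitone (L : ℕ → Submodule Zq M) : Antitone (complFil L) := by
  intro p p' hp x hx
  obtain ⟨w, w_mem, w_succ, w_zero, w_lim⟩ := exists_seq_of_mem_complFil hx
  exact ⟨w, w_mem, w_succ, by rw [w_zero p hp]; exact zero_mem _, w_lim⟩

theorem HTendsto.sub_mem_hPow (hL : ∀ n, ∀ x ∈ L n, x ∈ hPow M n) {w : ℕ → M}
    (w_succ : ∀ n, w (n + 1) - w n ∈ L n) {x : M} (h : HTendsto w x) (m : ℕ) :
    w m - x ∈ hPow M m := by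
  have w_add (l : ℕ) : w (m + l) - w m ∈ hPow M m := by
    induction l with
    | zero => simp
    | succ l ih =>
      have hl := add_mem (mem_hPow_of_le (Nat.le_add_right m l) (hL _ _ (w_succ (m + l)))) ih
      rwa [sub_add_sub_cancel] at hl
  obtain ⟨n₀, hn⟩ := h m
  simpa using sub_mem (hn (m + n₀) (Nat.le_add_left _ _)) (w_add n₀)

theorem mem_complFil_of_hTendsto (hL : ∀ n, ∀ x ∈ L n, x ∈ hPow M n) {φ : ℕ → ℕ}
    (hφ : Tendsto φ atTop atTop) {p : ℕ} {z : ℕ → M}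
    (hz : ∀ k, z k ∈ complFil L (max p (φ k))) {y : M}
    (hy : HTendsto (fun k => ∑ n ∈ Finset.range k, z n) y) : y ∈ complFil L p := by
  choose u u_mem u_succ u_zero u_lim using fun k => exists_seq_of_mem_complFil (hz k)
  obtain ⟨c, c_mono, hc⟩ : ∃ c : ℕ → ℕ, StrictMono c ∧ ∀ m, ∀ k ≥ c m, m ≤ φ k :=
    Filter.extraction_forall_of_eventually fun m =>
      Filter.eventually_forall_ge_atTop.2 (hφ.eventually_ge_atTop m)
  -- A diagonal sequence: the `k`-th summand is represented by a sequence vanishing up to `φ k`,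
  -- so that only the summands with `k < c m` contribute to the `m`-th term.
  refine ⟨fun m => ∑ k ∈ Finset.range (c m), u k m, fun n => sum_mem fun k _ => u_mem k n,
    fun n => ?_, ?_, fun k => ?_⟩
  · have extend_range : ∑ k ∈ Finset.range (c n), u k n = ∑ k ∈ Finset.range (c (n + 1)), u k n :=
      Finset.sum_subset (Finset.range_subset_range.2 (c_mono n.lt_succ_self).le) fun i _ hi =>
        u_zero i n (le_max_of_le_right (hc n i (by simpa using hi)))
    dsimp only
    rw [extend_range, ← Finset.sum_sub_distrib]
    exact sum_mem fun k _ => u_succ k n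
  · dsimp only
    rw [Finset.sum_eq_zero fun k _ => u_zero k p (le_max_left _ _)]
    exact zero_mem _
  · obtain ⟨n₀, hn⟩ := hy k
    refine ⟨max n₀ k, fun n hnn => ?_⟩
    have sum_z := hn (c n) ((le_of_max_le_left hnn).trans c_mono.le_apply)
    have sum_u_sub : ∑ i ∈ Finset.range (c n), u i n - ∑ i ∈ Finset.range (c n), z i ∈
        hPow M k := by
      rw [← Finset.sum_sub_distrib]
      exact sum_mem fun i _ =>
        mem_hPow_of_le (le_of_max_le_right hnn) ((u_lim i).sub_mem_hPow hL (u_succ i) n)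
    have hadd := add_mem sum_u_sub sum_z
    rwa [sub_add_sub_cancel] at hadd

theorem mem_complFil_of_hasHSum (hL : Antitone L) (hL' : ∀ n, ∀ x ∈ L n, x ∈ hPow M n)
    {φ : ℕ → ℕ} (hφ : Tendsto φ atTop atTop) {p : ℕ} {a : ℕ → M} {y : M} (hy : HasHSum a y)
    (ha : ∀ k, (PowerSeries.X : Rh) ^ k • a k ∈ L (max p (φ k))) : y ∈ complFil L p :=
  mem_complFil_of_hTendsto hL' hφ (fun k => le_complFil hL _ (ha k)) hy.hTendsto

theorem map_mem_complFil {f : M →ₗ[Rh] N} (hL' : ∀ n, ∀ x ∈ L' n, x ∈ hPow N n) {φ : ℕ → ℕ}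
    (hφ : Tendsto φ atTop atTop) (hf : ∀ n, ∀ x ∈ L n, f x ∈ complFil L' (φ n)) {p m : ℕ}
    (hm : ∀ k ≥ m, p ≤ φ k) {x : M} (hx : x ∈ complFil L m) : f x ∈ complFil L' p := by
  obtain ⟨w, -, w_succ, w_zero, w_lim⟩ := exists_seq_of_mem_complFil hx
  refine mem_complFil_of_hTendsto hL' hφ (z := fun k => f (w (k + 1) - w k)) (fun k => ?_) ?_
  · rcases lt_or_ge k m with h | h
    · rw [w_zero k h.le, w_zero (k + 1) h, sub_zero, map_zero]
      exact zero_mem _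
    · rw [max_eq_right (hm k h)]
      exact hf k _ (w_succ k)
  · have telescope (k : ℕ) : ∑ n ∈ Finset.range k, f (w (n + 1) - w n) = f (w k) := by
      rw [← map_sum, Finset.sum_range_sub, w_zero 0 (Nat.zero_le _), sub_zero]
    simpa only [telescope] using w_lim.map f

theorem RestrictsContinuously.of_map_mem {f : M →ₗ[Rh] N}
    (hL' : ∀ n, ∀ x ∈ L' n, x ∈ hPow N n) {φ : ℕ → ℕ} (hφ : Tendsto φ atTop atTop)
    (hf : ∀ n, ∀ x ∈ L n, f x ∈ complFil L' (φ n)) : RestrictsContinuously f L L' := by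
  refine ⟨fun x hx => map_mem_complFil hL' hφ hf (fun _ _ => Nat.zero_le _) hx,
    continuous_generateFrom_iff.2 ?_⟩
  rintro V ⟨x, p, rfl⟩
  obtain ⟨m, hm⟩ := Filter.eventually_atTop.1 (hφ.eventually_ge_atTop p)
  rw [isOpen_iff_forall_mem_open]
  intro y (hy : f y.1 - x.1 ∈ complFil L' p)
  refine ⟨{z | z.1 - y.1 ∈ complFil L m}, fun z hz => ?_,
    TopologicalSpace.isOpen_generateFrom_of_mem ⟨y, m, rfl⟩, by simp⟩
  have hzy : f z.1 - f y.1 ∈ complFil L' p := by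
    simpa using map_mem_complFil hL' hφ hf hm hz
  change f z.1 - x.1 ∈ complFil L' p
  simpa using add_mem hzy hy

end FilteredCompletion

/-! ### Weights -/

/-- The element `x` of `U_h` has weight `m`, normalised so that `E` has weight `1`:
`[H, x] = 2 m x`. -/
def IsWt (m : ℤ) (x : Uh) : Prop := H * x = x * H + cst (2 * m) • x

/-- The integral power `K ^ a = exp (a h H / 2)`. -/
def Kz (a : ℤ) : Uh := hExp (cst ((a : ℚ) / 2) • H)

theorem Kz_add (a b : ℤ) : Kz (a + b) = Kz a * Kz b := by
  rw [Kz, Kz, Kz, ← hExp_add (((Commute.refl H).smul_left _).smul_right _), ← add_smul, ← map_add]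
  push_cast
  rw [add_div]

theorem Kz_zero : Kz 0 = 1 := by
  rw [Kz]
  simp [hExp_zero]

theorem Kz_one : Kz 1 = K := by
  rw [Kz, K]
  simp

theorem Kz_neg (a : ℤ) : Kz (-a) = hExp (-(cst ((a : ℚ) / 2) • H)) := by
  rw [Kz, Int.cast_neg, neg_div, cst, map_neg, neg_smul]

theorem Kz_neg_one : Kz (-1) = Kinv := by rw [Kz_neg, Kinv, Int.cast_one]

theorem Kz_mul_neg (a : ℤ) : Kz a * Kz (-a) = 1 := by
  rw [← Kz_add, add_neg_cancel, Kz_zero]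

theorem Kz_neg_mul (a : ℤ) : Kz (-a) * Kz a = 1 := by
  rw [← Kz_add, neg_add_cancel, Kz_zero]

theorem K_pow (n : ℕ) : K ^ n = Kz n := by
  induction n with
  | zero => simp [Kz_zero]
  | succ n ih => rw [pow_succ, ih, ← Kz_one, ← Kz_add]; simp

theorem Kinv_pow (n : ℕ) : Kinv ^ n = Kz (-n) := by
  induction n with
  | zero => simp [Kz_zero]
  | succ n ih =>
    rw [pow_succ, ih, ← Kz_neg_one, ← Kz_add]
    congr 1
    push_cast
    ring

theorem IsWt.Kz_mul {m : ℤ} {x : Uh} (hx : IsWt m x) (a : ℤ) :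
    Kz a * x = vPow (2 * a * m) • (x * Kz a) := by
  refine hExp_shift (2 * a * m) ?_
  rw [smul_mul_assoc, hx, mul_add, mul_smul_comm, smul_add, smul_smul, ← map_mul,
    ← Algebra.commutes, ← Algebra.smul_def]
  congr 3
  push_cast
  ring

theorem IsWt.Kz_mul_assoc {m : ℤ} {x : Uh} (hx : IsWt m x) (a : ℤ) (y : Uh) :
    Kz a * (x * y) = vPow (2 * a * m) • (x * (Kz a * y)) := by
  rw [← mul_assoc, hx.Kz_mul, smul_mul_assoc, mul_assoc x]

theorem Kz_mul_Kz_assoc (a b : ℤ) (y : Uh) : Kz a * (Kz b * y) = Kz (a + b) * y := by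
  rw [Kz_add, mul_assoc]

theorem vPow_mul_neg (a : ℤ) : vPow a * vPow (-a) = 1 := by
  rw [← vPow_add, add_neg_cancel, vPow_zero]

theorem vPow_smul_smul {M : Type*} [AddCommGroup M] [Module Rh M] (a b : ℤ) (x : M) :
    vPow a • vPow b • x = vPow (a + b) • x := by rw [smul_smul, vPow_add]

theorem IsWt.mul_Kz {m : ℤ} {x : Uh} (hx : IsWt m x) (a : ℤ) :
    x * Kz a = vPow (-(2 * a * m)) • (Kz a * x) := by
  rw [hx.Kz_mul, vPow_smul_smul, neg_add_cancel, vPow_zero, one_smul]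

theorem IsWt.mul {m n : ℤ} {x y : Uh} (hx : IsWt m x) (hy : IsWt n y) : IsWt (m + n) (x * y) := by
  rw [IsWt, ← mul_assoc, hx, add_mul, mul_assoc, hy, mul_add, mul_smul_comm, ← mul_assoc,
    smul_mul_assoc, add_assoc, ← add_smul, ← map_add]
  congr 3
  push_cast
  ring

theorem IsWt.add {m : ℤ} {x y : Uh} (hx : IsWt m x) (hy : IsWt m y) : IsWt m (x + y) := by
  rw [IsWt, mul_add, hx, hy, add_mul, smul_add]
  abel

theorem IsWt.smul {m : ℤ} {x : Uh} (hx : IsWt m x) (c : Rh) : IsWt m (c • x) := by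
  rw [IsWt, mul_smul_comm, hx, smul_add, smul_mul_assoc, smul_comm c]

theorem IsWt.neg {m : ℤ} {x : Uh} (hx : IsWt m x) : IsWt m (-x) := by
  simpa using hx.smul (-1)

theorem IsWt.sub {m : ℤ} {x y : Uh} (hx : IsWt m x) (hy : IsWt m y) : IsWt m (x - y) := by
  rw [sub_eq_add_neg]
  exact hx.add hy.neg

theorem isWt_zero (m : ℤ) : IsWt m 0 := by simp [IsWt]

theorem isWt_one : IsWt 0 1 := by simp [IsWt]

theorem isWt_H : IsWt 0 H := by simp [IsWt]

theorem isWt_E : IsWt 1 E := by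
  rw [IsWt, H_mul_E, add_comm, Int.cast_one, mul_one, cst, map_ofNat]

theorem isWt_F : IsWt (-1) F := by
  rw [IsWt, H_mul_F, add_comm, Int.cast_neg, Int.cast_one, mul_neg, mul_one, cst, map_neg,
    map_ofNat]

theorem isWt_Kz (a : ℤ) : IsWt 0 (Kz a) := by
  have Kz_mul_H : Kz a * H = H * Kz a := hExp_mul_comm (by rw [smul_mul_assoc, mul_smul_comm])
  simp [IsWt, Kz_mul_H]

theorem isWt_K : IsWt 0 K := Kz_one ▸ isWt_Kz 1

theorem IsWt.pow {m : ℤ} {x : Uh} (hx : IsWt m x) (n : ℕ) : IsWt (n * m) (x ^ n) := by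
  induction n with
  | zero => simpa using isWt_one
  | succ n ih =>
    rw [pow_succ]
    convert ih.mul hx using 1
    push_cast
    ring

theorem IsWt.congr {m n : ℤ} {x : Uh} (hx : IsWt m x) (h : m = n) : IsWt n x := h ▸ hx

theorem isWt_E_pow (n : ℕ) : IsWt n (E ^ n) := (isWt_E.pow n).congr (mul_one _)

theorem isWt_F_pow (n : ℕ) : IsWt (-n) (F ^ n) := (isWt_F.pow n).congr (by ring)

theorem IsWt.of_hasHSum {m : ℤ} {a : ℕ → Uh} {x : Uh} (h : HasHSum a x) (ha : ∀ n, IsWt m (a n)) :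
    IsWt m x := by
  have defect := (h.map (LinearMap.mulLeft Rh H)).sub
    (h.map (LinearMap.mulRight Rh H + cst (2 * m) • LinearMap.id))
  refine sub_eq_zero.1 (defect.unique (hasHSum_zero.congr fun n => ?_))
  exact (sub_eq_zero.2 (ha n)).symm

theorem Kz_mul_E_pow (a : ℤ) (n : ℕ) : Kz a * E ^ n = vPow (2 * a * n) • (E ^ n * Kz a) :=
  (isWt_E_pow n).Kz_mul a

theorem Kz_mul_F_pow (a : ℤ) (n : ℕ) : Kz a * F ^ n = vPow (2 * a * -n) • (F ^ n * Kz a) :=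
  (isWt_F_pow n).Kz_mul a

theorem Kz_mul_F (a : ℤ) : Kz a * F = vPow (2 * a * -1) • (F * Kz a) := isWt_F.Kz_mul a

theorem Kz_mul_E (a : ℤ) : Kz a * E = vPow (2 * a * 1) • (E * Kz a) := isWt_E.Kz_mul a

/-- The tensor `x ⊗ y` in the completed tensor square as a bilinear map of `(x, y)`. -/
def tmL : Uh →ₗ[Rh] Uh →ₗ[Rh] Uh2 :=
  (TensorProduct.mk Rh Uh Uh).compr₂ toUh2.toLinearMap

section Density

variable {N : Type*} [AddCommGroup N] [Module Rh N] [IsHausdorff hId N]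

theorem uh2_ext_tm {f g : Uh2 →ₗ[Rh] N} (h : ∀ a b, f (tm a b) = g (tm a b)) : f = g := by
  refine hcomp_ext (M := Uh ⊗[Rh] Uh) fun z => ?_
  have comp_eq : f ∘ₗ toUh2.toLinearMap = g ∘ₗ toUh2.toLinearMap := TensorProduct.ext' h
  exact LinearMap.congr_fun comp_eq z

theorem lift_gen_mem_span_isWt (a : FreeAlgebra Rh Gen) :
    FreeAlgebra.lift Rh gen a ∈ Submodule.span Rh {x | ∃ m, IsWt m x} := by
  induction a using FreeAlgebra.induction with
  | grade0 r =>
    rw [AlgHom.commutes, Algebra.algebraMap_eq_smul_one]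
    exact Submodule.smul_mem _ _ (Submodule.subset_span ⟨0, isWt_one⟩)
  | grade1 g =>
    rw [FreeAlgebra.lift_ι_apply]
    refine Submodule.subset_span ?_
    cases g
    exacts [⟨0, isWt_H⟩, ⟨1, isWt_E⟩, ⟨-1, isWt_F⟩]
  | mul a b ha hb =>
    have hab := Submodule.mul_mem_mul ha hb
    rw [Submodule.span_mul_span] at hab
    rw [map_mul]
    refine Submodule.span_mono ?_ hab
    rintro _ ⟨x, ⟨m, hx⟩, y, ⟨n, hy⟩, rfl⟩
    exact ⟨_, hx.mul hy⟩
  | add a b ha hb =>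
    rw [map_add]
    exact Submodule.add_mem _ ha hb

theorem freeToUh_hof (a : FreeAlgebra Rh Gen) :
    freeToUh (hof (M := FreeAlgebra Rh Gen) a) = FreeAlgebra.lift Rh gen a := by
  have comp_eq : freeToUh.comp (hofAlg (A := FreeAlgebra Rh Gen)) = FreeAlgebra.lift Rh gen :=
    FreeAlgebra.hom_ext (funext fun g => by
      rw [Function.comp_apply, Function.comp_apply, FreeAlgebra.lift_ι_apply]
      rfl)
  exact AlgHom.congr_fun comp_eq a

theorem uh_ext_wt {f g : Uh →ₗ[Rh] N} (h : ∀ m x, IsWt m x → f x = g x) : f = g := by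
  have eqOn_span : Set.EqOn f g (Submodule.span Rh {x | ∃ m, IsWt m x}) :=
    LinearMap.eqOn_span fun x ⟨m, hx⟩ => h m x hx
  have comp_eq : f ∘ₗ freeToUh.toLinearMap = g ∘ₗ freeToUh.toLinearMap :=
    hcomp_ext (M := FreeAlgebra Rh Gen) fun a => by
      have ha := eqOn_span (lift_gen_mem_span_isWt a)
      rwa [← freeToUh_hof] at ha
  refine hcomp_ext (M := RingQuot UhRel) fun z => ?_
  obtain ⟨z, rfl⟩ := RingQuot.mkAlgHom_surjective Rh UhRel z
  exact LinearMap.congr_fun comp_eq z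

theorem uh2_ext_wt {f g : Uh2 →ₗ[Rh] N}
    (h : ∀ m n x y, IsWt m x → IsWt n y → f (tm x y) = g (tm x y)) : f = g := by
  have agree_right (m : ℤ) (x : Uh) (hx : IsWt m x) : tmL.compr₂ f x = tmL.compr₂ g x :=
    uh_ext_wt fun n y hy => h m n x y hx hy
  refine uh2_ext_tm fun a b => ?_
  have agree_left : (tmL.compr₂ f).flip b = (tmL.compr₂ g).flip b :=
    uh_ext_wt fun m x hx => LinearMap.congr_fun (agree_right m x hx) b
  exact LinearMap.congr_fun agree_left a

end Density

/-! ### The adjoint action and the antipode -/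

/-- The map `a ⊗ b ↦ a y S(b)`, through which `x ▷ y` is computed from `Δ(x)`. -/
def adBase (y : Uh) : Uh ⊗[Rh] Uh →ₗ[Rh] Uh :=
  LinearMap.mul' Rh Uh ∘ₗ TensorProduct.map (LinearMap.mulRight Rh y) antipode

theorem ad_apply (x y : Uh) : ad x y = ext2 (adBase y) (comul x) := rfl

@[simp]
theorem ext2_tm {N : Type*} [AddCommGroup N] [Module Rh N] [IsAdicComplete hId N]
    (f : Uh ⊗[Rh] Uh →ₗ[Rh] N) (a b : Uh) : ext2 f (tm a b) = f (a ⊗ₜ b) :=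
  hExtend_hof (M := Uh ⊗[Rh] Uh) f _

theorem adBase_tmul (y a b : Uh) : adBase y (a ⊗ₜ b) = a * y * antipode b := rfl

theorem ext2_adBase_mul (z z' : Uh2) (y : Uh) :
    ext2 (adBase y) (z * z') = ext2 (adBase (ext2 (adBase y) z')) z := by
  have tm_mul_left (a b : Uh) : ext2 (adBase y) ∘ₗ LinearMap.mulLeft Rh (tm a b) =
      LinearMap.mulLeft Rh a ∘ₗ LinearMap.mulRight Rh (antipode b) ∘ₗ ext2 (adBase y) :=
    uh2_ext_tm fun c d => by simp [tm_mul, adBase_tmul, antipode_mul, mul_assoc]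
  have mul_right : ext2 (adBase y) ∘ₗ LinearMap.mulRight Rh z' =
      ext2 (adBase (ext2 (adBase y) z')) :=
    uh2_ext_tm fun a b => by
      simpa [adBase_tmul, mul_assoc] using LinearMap.congr_fun (tm_mul_left a b) z'
  exact LinearMap.congr_fun mul_right z

theorem ad_mul (a b y : Uh) : ad (a * b) y = ad a (ad b y) := by
  rw [ad_apply, map_mul, ext2_adBase_mul, ← ad_apply, ← ad_apply]

theorem antipode_one : antipode 1 = 1 := by simp [antipode]

theorem antipodeInv_one : antipodeInv 1 = 1 := by simp [antipodeInv]

theorem ad_one (y : Uh) : ad 1 y = y := by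
  have comul_one : comul 1 = tm 1 1 := map_one comul
  rw [ad_apply, comul_one, ext2_tm, adBase_tmul, antipode_one, one_mul, mul_one]

theorem comul_H : comul H = tm H 1 + tm 1 H := uhLift_gen comulGen satRel_comulGen .H

theorem comul_E : comul E = tm E 1 + tm K E := uhLift_gen comulGen satRel_comulGen .E

theorem comul_F : comul F = tm F Kinv + tm 1 F := uhLift_gen comulGen satRel_comulGen .F

theorem ad_H (y : Uh) : ad H y = H * y - y * H := by
  rw [ad_apply, comul_H, map_add, ext2_tm, ext2_tm, adBase_tmul, adBase_tmul, antipode_one,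
    antipode_H]
  noncomm_ring

theorem ad_E (y : Uh) : ad E y = E * y - K * y * Kinv * E := by
  rw [ad_apply, comul_E, map_add, ext2_tm, ext2_tm, adBase_tmul, adBase_tmul, antipode_one,
    antipode_E]
  noncomm_ring

theorem ad_F (y : Uh) : ad F y = (F * y - y * F) * K := by
  rw [ad_apply, comul_F, map_add, ext2_tm, ext2_tm, adBase_tmul, adBase_tmul, antipode_Kinv,
    antipode_F]
  noncomm_ring

theorem IsWt.ad_H {m : ℤ} {y : Uh} (hy : IsWt m y) : ad H y = cst (2 * m) • y := by
  rw [QuantumSl2.ad_H, hy, add_sub_cancel_left]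

theorem IsWt.ad_H_pow {m : ℤ} {y : Uh} (hy : IsWt m y) (n : ℕ) :
    ad (H ^ n) y = cst (2 * m) ^ n • y := by
  induction n with
  | zero => simp [ad_one]
  | succ n ih => rw [pow_succ, ad_mul, hy.ad_H, map_smul, ih, smul_smul, pow_succ']

theorem IsWt.conj_K {m : ℤ} {y : Uh} (hy : IsWt m y) : K * y * Kinv = vPow (2 * m) • y := by
  rw [← Kz_one, hy.Kz_mul, smul_mul_assoc, mul_one, Kz_one, mul_assoc y, K_mul_Kinv, mul_one]

theorem IsWt.ad_E {m : ℤ} {y : Uh} (hy : IsWt m y) : ad E y = E * y - vPow (2 * m) • (y * E) := by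
  rw [QuantumSl2.ad_E, hy.conj_K, smul_mul_assoc]

theorem IsWt.isWt_ad_E {m : ℤ} {y : Uh} (hy : IsWt m y) : IsWt (m + 1) (ad E y) := by
  rw [hy.ad_E]
  exact ((isWt_E.mul hy).congr (add_comm _ _)).sub ((hy.mul isWt_E).smul _)

theorem IsWt.isWt_ad_F {m : ℤ} {y : Uh} (hy : IsWt m y) : IsWt (m - 1) (ad F y) := by
  rw [QuantumSl2.ad_F]
  exact ((((isWt_F.mul hy).congr (by ring)).sub (hy.mul isWt_F)).mul isWt_K).congr (by ring)

theorem IsWt.isWt_ad_E_pow {m : ℤ} {y : Uh} (hy : IsWt m y) (n : ℕ) :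
    IsWt (m + n) (ad (E ^ n) y) := by
  induction n with
  | zero => simpa [ad_one] using hy
  | succ n ih =>
    rw [pow_succ', ad_mul]
    exact ih.isWt_ad_E.congr (by push_cast; ring)

theorem IsWt.isWt_ad_F_pow {m : ℤ} {y : Uh} (hy : IsWt m y) (n : ℕ) :
    IsWt (m - n) (ad (F ^ n) y) := by
  induction n with
  | zero => simpa [ad_one] using hy
  | succ n ih =>
    rw [pow_succ', ad_mul]
    exact ih.isWt_ad_F.congr (by push_cast; ring)

theorem hExp_cst_Rh (a : ℤ) : hExp (cst ((a : ℚ) / 2)) = vPow a := by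
  simpa using hExp_cst (B := Rh) a

theorem IsWt.ad_Kz {m : ℤ} {y : Uh} (hy : IsWt m y) (a : ℤ) :
    ad (Kz a) y = vPow (2 * a * m) • y := by
  rw [← hExp_cst_Rh, Kz]
  refine map_hExp_eq (ad.flip y) (LinearMap.toSpanSingleton Rh Uh y) fun n => ?_
  rw [LinearMap.flip_apply, LinearMap.toSpanSingleton_apply, smul_pow, map_smul,
    LinearMap.smul_apply, hy.ad_H_pow, smul_smul, ← mul_pow, ← map_mul]
  congr 3
  push_cast
  ring

theorem antipode_Kz (a : ℤ) : antipode (Kz a) = Kz (-a) := by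
  rw [Kz, antipode_hExp, map_smul, antipode_H, smul_neg, Kz_neg]

theorem antipodeInv_Kz (a : ℤ) : antipodeInv (Kz a) = Kz (-a) := by
  rw [Kz, antipodeInv_hExp, map_smul, antipodeInv_H, smul_neg, Kz_neg]

theorem antipode_pow (x : Uh) (n : ℕ) : antipode (x ^ n) = antipode x ^ n := by
  simp [antipode]

theorem IsWt.antipode {m : ℤ} {x : Uh} (hx : IsWt m x) : IsWt m (antipode x) := by
  have antipode_eq := congrArg QuantumSl2.antipode hx
  rw [antipode_mul, map_add, antipode_mul, antipode_H, map_smul, mul_neg, neg_mul] at antipode_eq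
  rw [IsWt, ← neg_neg (H * _), ← sub_eq_iff_eq_add.2 antipode_eq]
  abel

theorem IsWt.antipodeInv {m : ℤ} {x : Uh} (hx : IsWt m x) : IsWt m (antipodeInv x) := by
  have antipodeInv_eq := congrArg QuantumSl2.antipodeInv hx
  rw [antipodeInv_mul, map_add, antipodeInv_mul, antipodeInv_H, map_smul, mul_neg,
    neg_mul] at antipodeInv_eq
  rw [IsWt, ← neg_neg (H * _), ← sub_eq_iff_eq_add.2 antipodeInv_eq]
  abel

theorem ext2_Dmat_mul {N : Type*} [AddCommGroup N] [Module Rh N] [IsAdicComplete hId N]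
    (f : Uh ⊗[Rh] Uh →ₗ[Rh] N) {a : Uh} {w : ℤ}
    (h : ∀ n b, f ((H ^ n * a) ⊗ₜ b) = cst (2 * w) ^ n • f (a ⊗ₜ b)) (b : Uh) :
    ext2 f (Dmat * tm a b) = f (a ⊗ₜ (Kz w * b)) := by
  refine map_hExp_eq (ext2 f ∘ₗ LinearMap.mulRight Rh (tm a b))
    (f ∘ₗ TensorProduct.mk Rh Uh Uh a ∘ₗ LinearMap.mulRight Rh b) fun n => ?_
  have tm_H_pow : tm H H ^ n = tm (H ^ n) (H ^ n) := by
    rw [tm, ← map_pow, Algebra.TensorProduct.tmul_pow, tm]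
  simp only [LinearMap.comp_apply, LinearMap.mulRight_apply, smul_pow, tm_H_pow, tm_mul,
    map_smul, ext2_tm, h, smul_smul, TensorProduct.mk_apply, ← mul_pow, ← map_mul]
  congr 3
  ring

/-- The inverse `1 / [n]_q!` of the quantum factorial, which is invertible in `ℚ⟦h⟧` because its
constant term is `n!`. -/
def qfInv (n : ℕ) : Rh := (qFactQ n)⁻¹

theorem constantCoeff_vPow (a : ℤ) : PowerSeries.constantCoeff (vPow a) = 1 := by
  rw [← PowerSeries.coeff_zero_eq_constantCoeff_apply, vPow, PowerSeries.coeff_rescale]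
  simp

theorem constantCoeff_qIntQ (n : ℕ) : PowerSeries.constantCoeff (qIntQ n) = n := by
  simp [qIntQ, constantCoeff_vPow]

theorem constantCoeff_qInt (n : ℕ) : PowerSeries.constantCoeff (qInt n) = n := by
  simp [qInt, constantCoeff_vPow]

theorem qFactQ_mul_qfInv (n : ℕ) : qFactQ n * qfInv n = 1 := by
  refine PowerSeries.mul_inv_cancel _ ?_
  rw [qFactQ, map_prod, Finset.prod_ne_zero_iff]
  intro i _
  rw [constantCoeff_qIntQ]
  exact Nat.cast_ne_zero.2 (Nat.succ_ne_zero i)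

theorem qFact_mul_inv (n : ℕ) : qFact n * (qFact n)⁻¹ = 1 := by
  refine PowerSeries.mul_inv_cancel _ ?_
  rw [qFact, map_prod, Finset.prod_ne_zero_iff]
  intro i _
  rw [constantCoeff_qInt]
  exact Nat.cast_ne_zero.2 (Nat.succ_ne_zero i)

theorem qfInv_zero : qfInv 0 = 1 := by
  simpa [qFactQ] using qFactQ_mul_qfInv 0

theorem isUnit_qIntQ_succ (n : ℕ) : IsUnit (qIntQ (n + 1)) := by
  rw [PowerSeries.isUnit_iff_constantCoeff, constantCoeff_qIntQ, isUnit_iff_ne_zero]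
  exact Nat.cast_ne_zero.2 (Nat.succ_ne_zero n)

theorem qIntQ_mul_qfInv (n : ℕ) : qIntQ (n + 1) * qfInv (n + 1) = qfInv n := by
  have inv_n := qFactQ_mul_qfInv n
  have inv_succ := qFactQ_mul_qfInv (n + 1)
  rw [qFactQ, Finset.prod_range_succ, ← qFactQ] at inv_succ
  linear_combination (-(qIntQ (n + 1) * qfInv (n + 1))) * inv_n + qfInv n * inv_succ

theorem qIntQ_add (i j : ℕ) : qIntQ (i + j) = qIntQ j + vPow (2 * j) * qIntQ i := by
  rw [qIntQ, add_comm i j, Finset.sum_range_add, qIntQ, qIntQ, Finset.mul_sum]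
  congr 1
  refine Finset.sum_congr rfl fun k _ => ?_
  rw [← vPow_add]
  congr 1
  push_cast
  ring

theorem qIntQ_eq (n : ℕ) : qIntQ n = vPow (n - 1) * qInt n := by
  rw [qInt, ← Finset.sum_range_reflect, qIntQ, Finset.mul_sum]
  refine Finset.sum_congr rfl fun j hj => ?_
  rw [← vPow_add]
  congr 1
  have := Finset.mem_range.1 hj
  omega

theorem qFactQ_eq (n : ℕ) : qFactQ n = vPow (n * (n - 1) / 2) * qFact n := by
  induction n with
  | zero => simp [qFactQ, qFact, vPow_zero]
  | succ n ih =>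
    rw [qFactQ, Finset.prod_range_succ, ← qFactQ, qFact, Finset.prod_range_succ, ← qFact, ih,
      qIntQ_eq]
    have triangular_succ : ((n + 1 : ℕ) : ℤ) * ((n + 1 : ℕ) - 1) / 2 =
        n * (n - 1) / 2 + ((n + 1 : ℕ) - 1) := by
      rw [show ((n + 1 : ℕ) : ℤ) * ((n + 1 : ℕ) - 1) = n * (n - 1) + n * 2 by push_cast; ring,
        Int.add_mul_ediv_right _ _ two_ne_zero]
      push_cast
      ring
    rw [triangular_succ, vPow_add]
    ring

/-- The coefficient of `hⁿ Fⁿ ⊗ Eⁿ` in the universal `R`-matrix, rewritten in terms of `[n]_q!` by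
`[n]_q! = v^(n(n-1)/2) [n]!`. -/
def rCoeff (n : ℕ) : Rh := vPow (n * (n - 1)) * sh ^ n * qfInv n

theorem rCoeff_eq (n : ℕ) :
    vPow (n * (n - 1) / 2) * sh ^ n * (qFact n)⁻¹ = rCoeff n := by
  have inv_qFactQ := qFactQ_mul_qfInv n
  have vPow_split : vPow (n * (n - 1)) = vPow (n * (n - 1) / 2) * vPow (n * (n - 1) / 2) := by
    rw [← vPow_add]
    congr 1
    obtain ⟨k, hk⟩ := Int.even_mul_pred_self (n : ℤ)
    rw [hk]
    omega
  rw [qFactQ_eq] at inv_qFactQ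
  rw [rCoeff, vPow_split]
  linear_combination
    (vPow (n * (n - 1) / 2) * sh ^ n * vPow (n * (n - 1) / 2) * qfInv n) * qFact_mul_inv n -
    (vPow (n * (n - 1) / 2) * sh ^ n * (qFact n)⁻¹) * inv_qFactQ

theorem rCoeff_zero : rCoeff 0 = 1 := by simp [rCoeff, vPow_zero, qfInv_zero]

-- The recursion is `[n + 1]_q = [j]_q + q^j [i]_q` for `i + j = n + 1`.
theorem qIntQ_smul_sum_antidiagonal {M : Type*} [AddCommGroup M] [Module Rh M] (T : ℕ → ℕ → M)
    (n : ℕ) :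
    qIntQ (n + 1) • ∑ p ∈ antidiagonal (n + 1), (qfInv p.1 * qfInv p.2) • T p.1 p.2 =
      ∑ p ∈ antidiagonal n, (qfInv p.1 * qfInv p.2) •
        (T p.1 (p.2 + 1) + vPow (2 * p.2) • T (p.1 + 1) p.2) := by
  have qIntQ_zero : qIntQ 0 = 0 := by simp [qIntQ]
  have split : qIntQ (n + 1) •
      ∑ p ∈ antidiagonal (n + 1), (qfInv p.1 * qfInv p.2) • T p.1 p.2 =
      ∑ p ∈ antidiagonal (n + 1), (qIntQ p.2 * (qfInv p.1 * qfInv p.2)) • T p.1 p.2 +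
      ∑ p ∈ antidiagonal (n + 1),
        (vPow (2 * p.2) * qIntQ p.1 * (qfInv p.1 * qfInv p.2)) • T p.1 p.2 := by
    rw [Finset.smul_sum, ← Finset.sum_add_distrib]
    refine Finset.sum_congr rfl fun p hp => ?_
    rw [← mem_antidiagonal.1 hp, qIntQ_add, smul_smul, ← add_smul, add_mul]
  rw [split, Finset.Nat.sum_antidiagonal_succ', Finset.Nat.sum_antidiagonal_succ]
  simp only [qIntQ_zero, zero_mul, mul_zero, zero_smul, zero_add]
  rw [← Finset.sum_add_distrib]
  refine Finset.sum_congr rfl fun p _ => ?_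
  rw [smul_add, smul_smul]
  congr 2
  · rw [← qIntQ_mul_qfInv p.2]
    ring
  · rw [← qIntQ_mul_qfInv p.1]
    ring

theorem qIntQ_mul_sum_neg_one_pow_qfInv (n : ℕ) : qIntQ (n + 1) * ∑ p ∈ antidiagonal (n + 1),
      (qfInv p.1 * qfInv p.2) * ((-1) ^ p.1 * vPow (p.2 * (p.2 - 1))) =
    (vPow (2 * n) - 1) * ∑ p ∈ antidiagonal n,
      (qfInv p.1 * qfInv p.2) * ((-1) ^ p.1 * vPow (p.2 * (p.2 - 1))) := by
  rw [← Finset.Nat.sum_antidiagonal_swap, ← Finset.Nat.sum_antidiagonal_swap (n := n)]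
  simp only [Prod.fst_swap, Prod.snd_swap, mul_comm (qfInv (Prod.snd _))]
  refine (qIntQ_smul_sum_antidiagonal (fun i j => (-1) ^ j * vPow (i * (i - 1))) n).trans ?_
  rw [Finset.mul_sum]
  refine Finset.sum_congr rfl fun p hp => ?_
  have vPow_shift : vPow (2 * p.2) * vPow ((p.1 + 1 : ℕ) * ((p.1 + 1 : ℕ) - 1)) =
      vPow (2 * n) * vPow (p.1 * (p.1 - 1)) := by
    rw [← vPow_add, ← vPow_add, ← mem_antidiagonal.1 hp]
    congr 1
    push_cast
    ring
  simp only [smul_eq_mul]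
  linear_combination (qfInv p.1 * qfInv p.2) * (-1) ^ p.2 * vPow_shift

theorem sum_neg_one_pow_qfInv (n : ℕ) : ∑ p ∈ antidiagonal (n + 1),
    (qfInv p.1 * qfInv p.2) * ((-1) ^ p.1 * vPow (p.2 * (p.2 - 1))) = 0 := by
  refine (isUnit_qIntQ_succ n).mul_right_eq_zero.1 ?_
  rw [qIntQ_mul_sum_neg_one_pow_qfInv]
  cases n with
  | zero => simp [vPow_zero]
  | succ n => rw [sum_neg_one_pow_qfInv n, mul_zero]

theorem hasHSum_sum_neg_one_pow_qfInv {M : Type*} [AddCommGroup M] [Module Rh M] (y : ℕ → M) :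
    HasHSum (fun n => ∑ p ∈ antidiagonal n,
      ((qfInv p.1 * qfInv p.2) * ((-1) ^ p.1 * vPow (p.2 * (p.2 - 1)))) • y n) (y 0) := by
  have vanish (n : ℕ) : ∑ p ∈ antidiagonal (n + 1),
      ((qfInv p.1 * qfInv p.2) * ((-1) ^ p.1 * vPow (p.2 * (p.2 - 1)))) • y (n + 1) = 0 := by
    rw [← Finset.sum_smul, sum_neg_one_pow_qfInv, zero_smul]
  simpa [qfInv_zero, vPow_zero] using hasHSum_single (a := fun n => ∑ p ∈ antidiagonal n,
    ((qfInv p.1 * qfInv p.2) * ((-1) ^ p.1 * vPow (p.2 * (p.2 - 1)))) • y n) vanish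

/-! ### The universal `R`-matrix -/

theorem hasHSum_Rmat {N : Type*} [AddCommGroup N] [Module Rh N] [IsAdicComplete hId N]
    (f : Uh ⊗[Rh] Uh →ₗ[Rh] N) :
    HasHSum (fun n => rCoeff n • ext2 f (Dmat * tm (F ^ n) (E ^ n))) (ext2 f Rmat) := by
  refine ((hasHSum_hSum _).map (ext2 f ∘ₗ LinearMap.mulLeft Rh Dmat)).congr fun n => ?_
  simp only [PowerSeries.coeff_mk, rCoeff_eq, map_smul, LinearMap.comp_apply,
    LinearMap.mulLeft_apply]

theorem hasHSum_Rmat_of_wt {N : Type*} [AddCommGroup N] [Module Rh N] [IsAdicComplete hId N]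
    (f : Uh ⊗[Rh] Uh →ₗ[Rh] N) (w : ℕ → ℤ)
    (h : ∀ k n b, f ((H ^ n * F ^ k) ⊗ₜ b) = cst (2 * w k) ^ n • f ((F ^ k) ⊗ₜ b)) :
    HasHSum (fun n => rCoeff n • f ((F ^ n) ⊗ₜ (Kz (w n) * E ^ n))) (ext2 f Rmat) :=
  (hasHSum_Rmat f).congr fun n => by rw [ext2_Dmat_mul f (h n)]

theorem IsWt.ad_H_pow_mul {m : ℤ} {x : Uh} (hx : IsWt m x) (n k : ℕ) :
    ad (H ^ n * F ^ k) x = cst (2 * (m - k : ℤ)) ^ n • ad (F ^ k) x := by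
  rw [ad_mul, (hx.isWt_ad_F_pow k).ad_H_pow]

theorem swapMap₂_tmul (f g : Uh →ₗ[Rh] Uh) (a b : Uh) :
    swapMap₂ f g (a ⊗ₜ b) = tm (g b) (f a) := rfl

theorem braiding_tm (x y : Uh) :
    braiding (tm x y) = ext2 (swapMap₂ (ad.flip x) (ad.flip y)) Rmat := ext2_tm _ _ _

theorem hasHSum_braiding {m m' : ℤ} {x y : Uh} (hx : IsWt m x) (hy : IsWt m' y) :
    HasHSum (fun n => (rCoeff n * vPow (2 * (m - n) * (m' + n))) •
      tm (ad (E ^ n) y) (ad (F ^ n) x)) (braiding (tm x y)) := by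
  rw [braiding_tm]
  refine (hasHSum_Rmat_of_wt _ (fun k => m - k) fun k n b => ?_).congr fun n => ?_
  · rw [swapMap₂_tmul, swapMap₂_tmul, LinearMap.flip_apply ad, LinearMap.flip_apply ad _ x,
      hx.ad_H_pow_mul, tm_smul_right, LinearMap.flip_apply ad]
  · rw [swapMap₂_tmul, LinearMap.flip_apply, LinearMap.flip_apply, ad_mul,
      (hy.isWt_ad_E_pow n).ad_Kz, tm_smul_left, smul_smul]

theorem FK_pow (n : ℕ) : (F * K) ^ n = vPow (-(n * (n - 1))) • (F ^ n * Kz n) := by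
  induction n with
  | zero => simp [vPow_zero, Kz_zero]
  | succ n ih =>
    rw [pow_succ, ih, smul_mul_assoc, mul_assoc, isWt_F.Kz_mul_assoc, ← Kz_one, ← Kz_add,
      mul_smul_comm, vPow_smul_smul, ← mul_assoc, ← pow_succ]
    congr 2
    push_cast
    ring

theorem antipode_F_pow (n : ℕ) :
    antipode (F ^ n) = ((-1) ^ n * vPow (-(n * (n - 1)))) • (F ^ n * Kz n) := by
  rw [antipode_pow, antipode_F, neg_pow, FK_pow, mul_smul, mul_smul_comm, smul_comm]
  congr 1
  rw [Algebra.smul_def, map_pow, map_neg, map_one]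

theorem IsWt.ad_antipode_F_pow {m : ℤ} {y : Uh} (hy : IsWt m y) (n : ℕ) :
    ad (QuantumSl2.antipode (F ^ n)) y =
      ((-1) ^ n * vPow (2 * n * m - n * (n - 1))) • ad (F ^ n) y := by
  rw [antipode_F_pow, map_smul, LinearMap.smul_apply, ad_mul, hy.ad_Kz, map_smul, smul_smul,
    mul_assoc, ← vPow_add]
  congr 3
  ring

theorem braidingInv_tm (x y : Uh) : braidingInv (tm x y) = ext2 (toUh2.toLinearMap ∘ₗ
    TensorProduct.map (ad.flip y ∘ₗ antipode) (ad.flip x)) Rmat := ext2_tm _ _ _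

theorem hasHSum_braidingInv {m m' : ℤ} {x y : Uh} (hx : IsWt m x) (hy : IsWt m' y) :
    HasHSum (fun n => (rCoeff n * ((-1) ^ n * vPow (-(2 * m' * m) - n * (n - 1)))) •
      tm (ad (F ^ n) y) (ad (E ^ n) x)) (braidingInv (tm x y)) := by
  have tmul (a b : Uh) : (toUh2.toLinearMap ∘ₗ TensorProduct.map (ad.flip y ∘ₗ antipode)
      (ad.flip x)) (a ⊗ₜ b) = tm (ad (antipode a) y) (ad b x) := rfl
  rw [braidingInv_tm]
  refine (hasHSum_Rmat_of_wt _ (fun _ => -m') fun k n b => ?_).congr fun n => ?_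
  · rw [tmul, tmul, antipode_mul, ad_mul, ← tm_smul_left, ← map_smul, antipode_pow H, antipode_H,
      ← neg_one_smul Rh H, smul_pow, map_smul ad, LinearMap.smul_apply, hy.ad_H_pow, smul_smul,
      ← mul_pow, Int.cast_neg, mul_neg, neg_one_mul, ← map_neg]
  · rw [tmul, ad_mul, (hx.isWt_ad_E_pow n).ad_Kz, tm_smul_right, hy.ad_antipode_F_pow, tm_smul_left,
      smul_smul, smul_smul]
    congr 1
    rw [mul_assoc, mul_left_comm (vPow _), ← vPow_add]
    congr 3
    ring

/-- The map `x ⊗ y ↦ ∑ x S(β) ⊗ (α ▷ y)`, where `R = ∑ α ⊗ β`, whose composite with `Δ` is the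
braided comultiplication. -/
def bComulAux : Uh2 →ₗ[Rh] Uh2 :=
  ext2 (TensorProduct.lift ((swapMap₂.compl₁₂ ad.flip
    (LinearMap.lcomp Rh Uh antipode ∘ₗ LinearMap.mul Rh Uh)).flip.compr₂ (sum2 Rmat)))

theorem bComul_apply (x : Uh) : bComul x = bComulAux (comul x) := rfl

theorem hasHSum_bComulAux {m : ℤ} (x : Uh) {y : Uh} (hy : IsWt m y) :
    HasHSum (fun n => rCoeff n • tm (x * antipode (E ^ n) * Kz (n - m)) (ad (F ^ n) y))
      (bComulAux (tm x y)) := by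
  have bComulAux_tm : bComulAux (tm x y) =
      ext2 (swapMap₂ (ad.flip y) (LinearMap.mulLeft Rh x ∘ₗ antipode)) Rmat := ext2_tm _ _ _
  rw [bComulAux_tm]
  refine (hasHSum_Rmat_of_wt _ (fun k => m - k) fun k n b => ?_).congr fun n => ?_
  · rw [swapMap₂_tmul, swapMap₂_tmul, LinearMap.flip_apply, hy.ad_H_pow_mul, tm_smul_right,
      LinearMap.flip_apply ad]
  · rw [swapMap₂_tmul, LinearMap.flip_apply, LinearMap.comp_apply, LinearMap.mulLeft_apply,
      antipode_mul, antipode_Kz, neg_sub, mul_assoc]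

theorem hasHSum_bAntipode {m : ℤ} {x : Uh} (hx : IsWt m x) :
    HasHSum (fun n => rCoeff n • (Kz (m - n) * E ^ n * antipode (ad (F ^ n) x)))
      (bAntipode x) := by
  set f := LinearMap.mul' Rh Uh ∘ₗ TensorProduct.map LinearMap.id (antipode ∘ₗ ad.flip x) ∘ₗ
    (TensorProduct.comm Rh Uh Uh).toLinearMap
  have f_tmul (a b : Uh) : f (a ⊗ₜ b) = b * antipode (ad a x) := rfl
  have bAntipode_eq : bAntipode x = ext2 f Rmat := rfl
  rw [bAntipode_eq]
  refine (hasHSum_Rmat_of_wt _ (fun k => m - k) fun k n b => ?_).congr fun n => by rw [f_tmul]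
  rw [f_tmul, f_tmul, hx.ad_H_pow_mul, map_smul, mul_smul_comm]

theorem hasHSum_bAntipodeInv {m : ℤ} {x : Uh} (hx : IsWt m x) :
    HasHSum (fun n => rCoeff n • (antipodeInv (ad (F ^ n) x) * (Kz (m - n) * E ^ n)))
      (bAntipodeInv x) := by
  set f := LinearMap.mul' Rh Uh ∘ₗ TensorProduct.map (antipodeInv ∘ₗ ad.flip x) LinearMap.id
  have f_tmul (a b : Uh) : f (a ⊗ₜ b) = antipodeInv (ad a x) * b := rfl
  have bAntipodeInv_eq : bAntipodeInv x = ext2 f Rmat := rfl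
  rw [bAntipodeInv_eq]
  refine (hasHSum_Rmat_of_wt _ (fun k => m - k) fun k n b => ?_).congr fun n => by rw [f_tmul]
  rw [f_tmul, f_tmul, hx.ad_H_pow_mul, map_smul, smul_mul_assoc]

theorem ad_F_mul_Kz (i j : ℕ) (x : Uh) : ad F (F ^ i * x * F ^ j * Kz (i + j)) =
    F ^ (i + 1) * x * F ^ j * Kz ((i + 1 : ℕ) + j) -
      vPow (-2 * (i + j)) • (F ^ i * x * F ^ (j + 1) * Kz (i + (j + 1 : ℕ))) := by
  have Kz_left : Kz ((i + 1 : ℕ) + j) = Kz (i + j + 1) := by push_cast; rw [add_right_comm]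
  have Kz_right : Kz (i + (j + 1 : ℕ)) = Kz (i + j + 1) := by push_cast; rw [add_assoc]
  rw [ad_F, sub_mul, ← Kz_one, Kz_left, Kz_right, pow_succ' F i, pow_succ F j]
  simp only [mul_assoc, ← Kz_add, isWt_F.Kz_mul_assoc, mul_smul_comm]
  congr 3
  ring

theorem ad_F_pow (n : ℕ) (x : Uh) : qfInv n • ad (F ^ n) x = ∑ p ∈ antidiagonal n,
    (qfInv p.1 * qfInv p.2) • ((-1) ^ p.2 * vPow (-(p.2 * (p.2 - 1)) - 2 * p.1 * p.2)) •
      (F ^ p.1 * x * F ^ p.2 * Kz (p.1 + p.2)) := by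
  induction n with
  | zero => simp [qfInv_zero, ad_one, vPow_zero, Kz_zero]
  | succ n ih =>
    refine (isUnit_qIntQ_succ n).smul_left_cancel.1 ?_
    rw [smul_smul, qIntQ_mul_qfInv, pow_succ', ad_mul, ← map_smul, ih,
      qIntQ_smul_sum_antidiagonal (fun i j => ((-1) ^ j * vPow (-(j * (j - 1)) - 2 * i * j) : Rh) •
      (F ^ i * x * F ^ j * Kz (i + j))), map_sum]
    refine Finset.sum_congr rfl fun ⟨i, j⟩ _ => ?_
    have vPow_right : vPow (-((j + 1 : ℕ) * ((j + 1 : ℕ) - 1)) - 2 * i * (j + 1 : ℕ)) =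
        vPow (-(j * (j - 1)) - 2 * i * j) * vPow (-2 * (i + j)) := by
      rw [← vPow_add]
      congr 1
      push_cast
      ring
    have vPow_left : vPow (2 * j) * vPow (-(j * (j - 1)) - 2 * (i + 1 : ℕ) * j) =
        vPow (-(j * (j - 1)) - 2 * i * j) := by
      rw [← vPow_add]
      congr 1
      push_cast
      ring
    rw [map_smul, map_smul, ad_F_mul_Kz, smul_smul (vPow (2 * j)), mul_left_comm (vPow (2 * j)),
      vPow_left, vPow_right, pow_succ (-1 : Rh), smul_sub, smul_smul _ (vPow _), sub_eq_neg_add,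
      ← neg_smul]
    congr 3
    ring

/-! ### The Drinfeld element -/

theorem rCoeff_smul {M : Type*} [AddCommGroup M] [Module Rh M] (n : ℕ) (x : M) :
    rCoeff n • x = vPow (n * (n - 1)) • sh ^ n • qfInv n • x := by
  rw [rCoeff, mul_smul, mul_smul]

theorem pow_mul_pow_mul_assoc {M : Type*} [Monoid M] (x y : M) (i j : ℕ) :
    x ^ i * (x ^ j * y) = x ^ (i + j) * y := by
  rw [pow_add, mul_assoc]

theorem antipode_E_pow (n : ℕ) :
    antipode (E ^ n) = ((-1) ^ n * vPow (-(n * (n + 1)))) • (E ^ n * Kz (-n)) := by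
  induction n with
  | zero => simp [vPow_zero, Kz_zero, antipode_one]
  | succ n ih =>
    have vPow_succ : vPow (-((n + 1 : ℕ) * ((n + 1 : ℕ) + 1))) =
        vPow (-(n * (n + 1))) * vPow (2 * -1 * (n + 1 : ℕ)) := by
      rw [← vPow_add]
      congr 1
      push_cast
      ring
    have Kz_succ : Kz (-(n + 1 : ℕ)) = Kz (-1) * Kz (-n) := by
      rw [← Kz_add]
      congr 1
      push_cast
      ring
    rw [pow_succ E, antipode_mul, antipode_E, ih, ← Kz_neg_one, vPow_succ, Kz_succ, mul_smul_comm,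
      neg_mul, mul_assoc (Kz _) E, ← mul_assoc E, ← pow_succ', ← pow_succ,
      (isWt_E_pow _).Kz_mul_assoc, smul_neg, smul_smul, ← neg_smul]
    congr 1
    ring

/-- The coefficient of `hⁿ Eⁿ Kⁿ Fⁿ` in `drinfeldElt`. -/
def drinfeldCoeff (n : ℕ) : Rh := (-1) ^ n * vPow (n * (n - 1)) * rCoeff n

/-- The coefficient of `hⁿ Eⁿ K⁻ⁿ Fⁿ` in `drinfeldEltInv`. -/
def drinfeldInvCoeff (n : ℕ) : Rh := vPow (2 * n - 2 * n * n) * rCoeff n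

/-- The element `γ⁻¹ u` of `U_h`, where `u = ∑ S(β) α` is the Drinfeld element and
`γ = exp (- h H² / 4)` collects the contribution of the Cartan part of `R`. -/
def drinfeldElt : Uh := hSum (PowerSeries.mk fun n => drinfeldCoeff n • (E ^ n * Kz n * F ^ n))

/-- The inverse of `drinfeldElt`. -/
def drinfeldEltInv : Uh :=
  hSum (PowerSeries.mk fun n => drinfeldInvCoeff n • (E ^ n * Kz (-n) * F ^ n))

theorem hasHSum_drinfeldElt :
    HasHSum (fun n => drinfeldCoeff n • (E ^ n * Kz n * F ^ n)) drinfeldElt :=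
  (hasHSum_hSum _).congr fun _ => PowerSeries.coeff_mk _ _

theorem hasHSum_drinfeldEltInv :
    HasHSum (fun n => drinfeldInvCoeff n • (E ^ n * Kz (-n) * F ^ n)) drinfeldEltInv :=
  (hasHSum_hSum _).congr fun _ => PowerSeries.coeff_mk _ _

theorem isWt_drinfeldElt : IsWt 0 drinfeldElt := IsWt.of_hasHSum hasHSum_drinfeldElt fun n =>
  ((((isWt_E_pow n).mul (isWt_Kz n)).mul (isWt_F_pow n)).smul _).congr (by ring)

theorem Kz_mul_drinfeldElt_mul (a : ℤ) (x : Uh) :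
    Kz a * (drinfeldElt * x) = drinfeldElt * (Kz a * x) := by
  rw [isWt_drinfeldElt.Kz_mul_assoc, mul_zero, vPow_zero, one_smul]

theorem drinfeldCoeff_smul {M : Type*} [AddCommGroup M] [Module Rh M] (n : ℕ) (x : M) :
    drinfeldCoeff n • x = vPow (2 * n * (n - 1)) • sh ^ n • qfInv n • (-1 : Rh) ^ n • x := by
  rw [show (2 * n * (n - 1) : ℤ) = n * (n - 1) + n * (n - 1) by ring, vPow_add, drinfeldCoeff,
    rCoeff]
  simp only [smul_smul]
  congr 1
  ring

theorem drinfeldInvCoeff_smul {M : Type*} [AddCommGroup M] [Module Rh M] (n : ℕ) (x : M) :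
    drinfeldInvCoeff n • x = vPow (n - n * n) • sh ^ n • qfInv n • x := by
  rw [drinfeldInvCoeff, mul_smul, rCoeff_smul, vPow_smul_smul]
  congr 2
  ring

theorem qIntQ_succ (n : ℕ) : qIntQ (n + 1) = 1 + vPow 2 * qIntQ n := by
  rw [qIntQ_add n 1]
  simp [qIntQ, vPow_zero]

theorem qIntQ_succ_mul_vPow_neg (n : ℕ) :
    qIntQ (n + 1) * vPow (-(2 * n)) = qIntQ n * vPow (-(2 * n)) + 1 := by
  rw [qIntQ, Finset.sum_range_succ, ← qIntQ, add_mul, vPow_mul_neg]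

theorem X_mul_sh_smul_E_mul_F_sub :
    (PowerSeries.X * sh : Rh) • (E * F - F * E) = Kz 1 - Kz (-1) := by
  rw [E_mul_F, add_sub_cancel_right, X_mul_sh, smul_qBr, Kz_one, Kz_neg_one, K, Kinv]

theorem X_mul_sh_smul_E_mul_F_pow_sub (n : ℕ) :
    (PowerSeries.X * sh : Rh) • (E * F ^ (n + 1) - F ^ (n + 1) * E) =
      qIntQ (n + 1) • (F ^ n * (vPow (-(2 * n)) • Kz 1 - Kz (-1))) := by
  induction n with
  | zero => simpa [qIntQ, vPow_zero] using X_mul_sh_smul_E_mul_F_sub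
  | succ n ih =>
    have leibniz : E * F ^ (n + 1 + 1) - F ^ (n + 1 + 1) * E =
        (E * F ^ (n + 1) - F ^ (n + 1) * E) * F + F ^ (n + 1) * (E * F - F * E) := by
      rw [pow_succ F (n + 1)]
      noncomm_ring
    have vPow_succ : vPow (-(2 * n)) * vPow (2 * 1 * -1) = vPow (-(2 * (n + 1 : ℕ))) := by
      rw [← vPow_add]
      congr 1
      push_cast
      ring
    rw [leibniz, smul_add, ← smul_mul_assoc, ih, ← mul_smul_comm _ (F ^ (n + 1)),
      X_mul_sh_smul_E_mul_F_sub, smul_mul_assoc, mul_assoc, sub_mul, smul_mul_assoc, Kz_mul_F,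
      Kz_mul_F, smul_smul, vPow_succ, show (2 * -1 * -1 : ℤ) = 2 by rfl, mul_sub, mul_sub, mul_sub,
      mul_smul_comm, mul_smul_comm, mul_smul_comm, ← mul_assoc, ← mul_assoc, ← pow_succ, smul_sub,
      smul_sub, smul_smul, smul_smul, smul_smul, qIntQ_succ_mul_vPow_neg, qIntQ_succ (n + 1),
      add_smul, add_smul, one_smul, one_smul, mul_comm (vPow 2)]
    abel

theorem drinfeldCoeff_succ_mul_qIntQ (n : ℕ) :
    drinfeldCoeff (n + 1) * qIntQ (n + 1) = -(vPow (4 * n) * drinfeldCoeff n * sh) := by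
  have vPow_succ : vPow ((n + 1 : ℕ) * ((n + 1 : ℕ) - 1)) * vPow ((n + 1 : ℕ) * ((n + 1 : ℕ) - 1)) =
      vPow (4 * n) * (vPow (n * (n - 1)) * vPow (n * (n - 1))) := by
    simp only [← vPow_add]
    congr 1
    push_cast
    ring
  rw [drinfeldCoeff, drinfeldCoeff, rCoeff, rCoeff, ← qIntQ_mul_qfInv n]
  linear_combination (-1) ^ (n + 1) * sh ^ (n + 1) * (qIntQ (n + 1) * qfInv (n + 1)) * vPow_succ

theorem X_smul_drinfeldCoeff_succ_smul (n : ℕ) :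
    (PowerSeries.X : Rh) • drinfeldCoeff (n + 1) •
        (E ^ (n + 1) * (Kz (n + 1 : ℕ) * (E * F ^ (n + 1) - F ^ (n + 1) * E))) =
      drinfeldCoeff n • (vPow (2 * n) • (E ^ (n + 1) * (Kz n * F ^ n)) -
        vPow (4 * n) • (E ^ (n + 1) * (Kz (n + 2) * F ^ n))) := by
  have move_Kz : F ^ n * (vPow (-(2 * n)) • Kz 1 - Kz (-1)) =
      Kz 1 * F ^ n - vPow (-(2 * n)) • (Kz (-1) * F ^ n) := by
    rw [mul_sub, mul_smul_comm, (isWt_F_pow n).mul_Kz, (isWt_F_pow n).mul_Kz, vPow_smul_smul,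
      show (-(2 * n) + -(2 * 1 * -n) : ℤ) = 0 by ring, vPow_zero, one_smul]
    congr 3
    ring
  refine (isUnit_qIntQ_succ n).smul_left_cancel.1 ?_
  calc _ = -(vPow (4 * n) * drinfeldCoeff n) • (E ^ (n + 1) * (Kz (n + 1 : ℕ) *
        ((PowerSeries.X * sh : Rh) • (E * F ^ (n + 1) - F ^ (n + 1) * E)))) := by
        rw [mul_smul_comm, mul_smul_comm, smul_smul, smul_smul, smul_smul]
        congr 1
        linear_combination PowerSeries.X * drinfeldCoeff_succ_mul_qIntQ n
    _ = qIntQ (n + 1) • -(vPow (4 * n) * drinfeldCoeff n) • (E ^ (n + 1) * (Kz (n + 1 : ℕ) *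
          (Kz 1 * F ^ n - vPow (-(2 * n)) • (Kz (-1) * F ^ n)))) := by
        rw [X_mul_sh_smul_E_mul_F_pow_sub, move_Kz, mul_smul_comm, mul_smul_comm, smul_comm]
    _ = _ := by
        rw [mul_sub (Kz _), mul_sub (E ^ _), mul_smul_comm, mul_smul_comm, Kz_mul_Kz_assoc,
          Kz_mul_Kz_assoc, show ((n + 1 : ℕ) + -1 : ℤ) = n by push_cast; ring,
          show ((n + 1 : ℕ) + 1 : ℤ) = n + 2 by push_cast; ring,
          show vPow (2 * n) = vPow (4 * n) * vPow (-(2 * n)) by rw [← vPow_add]; congr 1; ring]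
        rw [mul_comm (vPow (4 * n)), neg_smul, mul_smul, ← smul_neg, ← smul_neg, neg_sub, smul_sub,
          smul_smul (vPow (4 * n))]

theorem drinfeldElt_mul_E : drinfeldElt * E = E * (Kz 2 * drinfeldElt) := by
  -- The difference of the two sides is `∑ hⁿ (h • s (n + 1) - s n)`, which telescopes.
  let s (n : ℕ) : Uh := drinfeldCoeff n • (E ^ n * (Kz n * (E * F ^ n - F ^ n * E)))
  obtain ⟨a, ha⟩ : ∃ a, HasHSum s a :=
    ⟨_, (hasHSum_hSum (PowerSeries.mk s)).congr fun _ => PowerSeries.coeff_mk _ _⟩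
  have mul_E (n : ℕ) : drinfeldCoeff n • (E ^ n * Kz n * F ^ n) * E =
      drinfeldCoeff n • vPow (2 * n) • (E ^ (n + 1) * (Kz n * F ^ n)) - s n := by
    rw [smul_mul_assoc, ← smul_sub, mul_sub, mul_sub, ← mul_assoc (Kz n) E, Kz_mul_E,
      smul_mul_assoc, mul_smul_comm, mul_assoc E, ← mul_assoc _ E, ← pow_succ, mul_one]
    simp only [mul_assoc, sub_sub_cancel]
  have E_mul (n : ℕ) : E * (Kz 2 * drinfeldCoeff n • (E ^ n * Kz n * F ^ n)) =
      drinfeldCoeff n • vPow (4 * n) • (E ^ (n + 1) * (Kz (n + 2) * F ^ n)) := by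
    simp only [mul_assoc, (isWt_E_pow _).Kz_mul_assoc, mul_smul_comm, Kz_mul_Kz_assoc]
    rw [← mul_assoc E, ← pow_succ', add_comm 2 (n : ℤ), show (2 * (2 * n) : ℤ) = 4 * n by ring]
  have difference := (hasHSum_drinfeldElt.map (LinearMap.mulRight Rh E)).sub
    (hasHSum_drinfeldElt.map (LinearMap.mulLeft Rh E ∘ₗ LinearMap.mulLeft Rh (Kz 2)))
  refine sub_eq_zero.1 (difference.unique ?_)
  rw [← sub_self a]
  refine ((ha.shift (by simp [s])).sub ha).congr fun n => ?_
  simp only [LinearMap.mulRight_apply, LinearMap.mulLeft_apply, LinearMap.comp_apply, mul_E, E_mul,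
    s, X_smul_drinfeldCoeff_succ_smul]
  rw [smul_sub, sub_right_comm]

theorem drinfeldElt_mul_E_pow_mul (n : ℕ) (x : Uh) :
    drinfeldElt * (E ^ n * x) =
      vPow (2 * n * (n - 1)) • (E ^ n * (Kz (2 * n) * (drinfeldElt * x))) := by
  induction n generalizing x with
  | zero => simp [vPow_zero, Kz_zero]
  | succ n ih =>
    rw [pow_succ, mul_assoc, ih, ← mul_assoc drinfeldElt, drinfeldElt_mul_E]
    simp only [mul_assoc, isWt_E.Kz_mul_assoc, mul_smul_comm, Kz_mul_Kz_assoc, vPow_smul_smul]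
    congr 1
    · congr 1
      push_cast
      ring

/-! ### Invertibility of the braiding and of the braided antipode -/

theorem HasHSum.eq_of_smul_qfInv {M : Type*} [AddCommGroup M] [Module Rh M] [IsHausdorff hId M]
    {s : ℕ → ℕ → M} {t y : ℕ → M} {z : M} (hs : ∀ i, HasHSum (s i) (t i)) (hz : HasHSum t z)
    (h : ∀ i j, s i j = ((qfInv i * qfInv j) * ((-1) ^ i * vPow (j * (j - 1)))) • y (i + j)) :
    z = y 0 :=
  ((hasHSum_antidiagonal hs).2 hz).unique <| (hasHSum_sum_neg_one_pow_qfInv y).congr fun _ =>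
    Finset.sum_congr rfl fun _ hp => by rw [h, mem_antidiagonal.1 hp]

theorem braidingInv_summand (m m' : ℤ) (x y : Uh) (n k : ℕ) :
    (rCoeff n * ((-1) ^ n * vPow (-(2 * m' * m) - n * (n - 1)))) •
      (rCoeff k * vPow (2 * (m' - n - k) * (m + n + k))) •
        tm (ad (E ^ k) (ad (E ^ n) x)) (ad (F ^ k) (ad (F ^ n) y)) =
    (qfInv n * qfInv k * ((-1) ^ n * vPow (k * (k - 1)))) •
      (sh ^ (n + k) * vPow (-(2 * m' * m) + 2 * (m' - (n + k : ℕ)) * (m + (n + k : ℕ)))) •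
        tm (ad (E ^ (n + k)) x) (ad (F ^ (n + k)) y) := by
  have vPow_collect : vPow (-(2 * m' * m) - n * (n - 1)) * (vPow (2 * (m' - n - k) * (m + n + k)) *
      (vPow (n * (n - 1)) * vPow (k * (k - 1)))) = vPow (k * (k - 1)) *
        vPow (-(2 * m' * m) + 2 * (m' - (n + k : ℕ)) * (m + (n + k : ℕ))) := by
    simp only [← vPow_add]
    congr 1
    push_cast
    ring
  rw [← ad_mul, ← ad_mul, ← pow_add, ← pow_add, add_comm k n, smul_smul, smul_smul]
  congr 1
  rw [rCoeff, rCoeff]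
  linear_combination (-1) ^ n * sh ^ n * sh ^ k * qfInv n * qfInv k * vPow_collect

theorem braiding_comp_braidingInv : braiding ∘ₗ braidingInv = LinearMap.id :=
  uh2_ext_wt fun m m' x y hx hy => by
    rw [LinearMap.comp_apply, LinearMap.id_apply]
    have cancel := HasHSum.eq_of_smul_qfInv (y := fun n =>
      (sh ^ n * vPow (-(2 * m' * m) + 2 * (m' - n) * (m + n))) • tm (ad (E ^ n) x) (ad (F ^ n) y))
      (fun n => ?_) ((hasHSum_braidingInv hx hy).map braiding) (braidingInv_summand m m' x y)
    · rw [cancel]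
      have vPow_exponent : -(2 * m' * m) + 2 * m' * m = 0 := by ring
      simp [vPow_zero, ad_one, vPow_exponent]
    · rw [map_smul]
      exact (hasHSum_braiding (hy.isWt_ad_F_pow n) (hx.isWt_ad_E_pow n)).map
        (LinearMap.lsmul Rh Uh2 (rCoeff n * ((-1) ^ n * vPow (-(2 * m' * m) - n * (n - 1)))))

theorem neg_one_pow_mul_neg_one_pow_add {R : Type*} [Monoid R] [HasDistribNeg R] (j i : ℕ) :
    (-1 : R) ^ j * (-1) ^ (j + i) = (-1) ^ i := by
  rw [← pow_add, ← add_assoc, pow_add, (Even.add_self j).neg_one_pow, one_mul]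

theorem antipode_bAntipodeInv_summand {m : ℤ} {z : Uh} (hz : IsWt m z) (j i : ℕ) :
    (vPow ((j + i : ℕ) * ((j + i : ℕ) - 1)) * sh ^ (j + i)) •
      (antipode (E ^ (j + i)) * Kz (-(m - (j + i : ℕ))) * (qfInv i * qfInv j) •
        ((-1 : Rh) ^ j * vPow (-(j * (j - 1)) - 2 * i * j)) • (F ^ i * z * F ^ j * Kz (i + j))) =
    vPow (-(2 * j * j)) • rCoeff j • drinfeldCoeff i •
      (Kz (j - m) * (E ^ j * (E ^ i * Kz i * F ^ i * (z * F ^ j)))) := by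
  rw [antipode_E_pow]
  simp only [mul_assoc, mul_smul, smul_mul_assoc, mul_smul_comm, ← Kz_add,
    (isWt_E_pow _).Kz_mul_assoc, (isWt_F_pow _).Kz_mul_assoc, hz.Kz_mul_assoc, Kz_mul_F_pow,
    pow_mul_pow_mul_assoc, rCoeff_smul, drinfeldCoeff_smul, vPow_smul_smul,
    smul_comm (sh ^ _) (vPow _), smul_comm (qfInv _) (vPow _), smul_comm ((-1 : Rh) ^ _) (vPow _),
    smul_comm (qfInv _) (sh ^ _)]
  have Kz_exponent : -((j + i : ℕ) : ℤ) + -(m - (j + i : ℕ)) + (i + j) = j - m + i := by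
    push_cast
    ring
  rw [Kz_exponent, smul_comm (qfInv i), smul_smul ((-1) ^ _), neg_one_pow_mul_neg_one_pow_add,
    smul_smul (sh ^ j), ← pow_add]
  congr 2
  push_cast
  ring

theorem hasHSum_antipode_bAntipodeInv {m : ℤ} {z : Uh} (hz : IsWt m z) :
    HasHSum (fun n => vPow (-(2 * n * n)) • rCoeff n •
      (Kz (n - m) * (E ^ n * (drinfeldElt * (z * F ^ n))))) (antipode (bAntipodeInv z)) := by
  refine (hasHSum_antidiagonal (s := fun j i => vPow (-(2 * j * j)) • rCoeff j • drinfeldCoeff i •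
    (Kz (j - m) * (E ^ j * (E ^ i * Kz i * F ^ i * (z * F ^ j))))) fun j => ?_).1 ?_
  · refine (hasHSum_drinfeldElt.map (vPow (-(2 * j * j)) • rCoeff j •
      (LinearMap.mulLeft Rh (Kz (j - m)) ∘ₗ LinearMap.mulLeft Rh (E ^ j) ∘ₗ
        LinearMap.mulRight Rh (z * F ^ j)))).congr fun i => ?_
    simp only [LinearMap.smul_apply, LinearMap.comp_apply, LinearMap.mulLeft_apply,
      LinearMap.mulRight_apply, smul_mul_assoc, mul_smul_comm]
  · refine ((hasHSum_bAntipodeInv hz).map antipode).congr fun n => ?_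
    rw [map_smul, antipode_mul, antipode_mul, antipode_Kz, antipode_antipodeInv, rCoeff, mul_smul,
      ← mul_smul_comm, ad_F_pow, ← Finset.Nat.sum_antidiagonal_swap, Finset.mul_sum,
      Finset.smul_sum]
    refine Finset.sum_congr rfl fun ⟨j, i⟩ hp => ?_
    rw [← mem_antidiagonal.1 hp]
    exact antipode_bAntipodeInv_summand hz j i

theorem bAntipodeInv_one : bAntipodeInv 1 = 1 := by
  have ad_F_pow_succ_one (n : ℕ) : ad (F ^ (n + 1)) 1 = 0 := by
    rw [pow_succ, ad_mul, ad_F, mul_one, one_mul, sub_self, zero_mul, map_zero]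
  have leading_term := hasHSum_single (a := fun n : ℕ =>
    rCoeff n • (antipodeInv (ad (F ^ n) 1) * (Kz (0 - n) * E ^ n))) fun n => by
      rw [ad_F_pow_succ_one, map_zero, zero_mul, smul_zero]
  refine (hasHSum_bAntipodeInv isWt_one).unique ?_
  simpa [rCoeff_zero, ad_one, antipodeInv_one, Kz_zero] using leading_term

-- The expansion of `1 = S (bAntipodeInv 1)` is term by term that of `drinfeldElt * drinfeldEltInv`.
theorem drinfeldElt_mul_drinfeldEltInv : drinfeldElt * drinfeldEltInv = 1 := by
  have expansion_one := hasHSum_antipode_bAntipodeInv isWt_one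
  rw [bAntipodeInv_one, antipode_one] at expansion_one
  refine (hasHSum_drinfeldEltInv.map (LinearMap.mulLeft Rh drinfeldElt)).unique
    (expansion_one.congr fun n => ?_)
  rw [LinearMap.mulLeft_apply, mul_smul_comm, mul_assoc (E ^ n), drinfeldElt_mul_E_pow_mul, one_mul,
    ← Kz_mul_drinfeldElt_mul, Kz_mul_Kz_assoc, Kz_mul_drinfeldElt_mul, drinfeldInvCoeff, mul_smul,
    smul_comm (rCoeff n) (vPow _), vPow_smul_smul, sub_zero, (isWt_E_pow n).Kz_mul_assoc,
    smul_comm (rCoeff n) (vPow _), vPow_smul_smul, show (2 * n + -n : ℤ) = n by ring,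
    Kz_mul_drinfeldElt_mul]
  congr 2
  ring

theorem bAntipode_summand {m : ℤ} {x : Uh} (hx : IsWt m x) (i j : ℕ) :
    (vPow ((i + j : ℕ) * ((i + j : ℕ) - 1)) * sh ^ (i + j)) •
      (Kz (m - (i + j : ℕ)) * E ^ (i + j) * antipode ((qfInv i * qfInv j) •
        ((-1 : Rh) ^ j * vPow (-(j * (j - 1)) - 2 * i * j)) • (F ^ i * x * F ^ j * Kz (i + j)))) =
    vPow (-(2 * i * i)) • rCoeff i • drinfeldInvCoeff j • (Kz m * (E ^ i * (Kz (-(2 * i)) *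
      (E ^ j * Kz (-j) * F ^ j * (antipode x * antipode (F ^ i)))))) := by
  rw [map_smul, map_smul, antipode_mul, antipode_mul, antipode_mul, antipode_Kz, antipode_F_pow j]
  simp only [mul_assoc, mul_smul, smul_mul_assoc, mul_smul_comm, Kz_mul_Kz_assoc,
    (isWt_E_pow _).Kz_mul_assoc, (isWt_F_pow _).Kz_mul_assoc, hx.antipode.Kz_mul_assoc,
    pow_mul_pow_mul_assoc, rCoeff_smul, drinfeldInvCoeff_smul, vPow_smul_smul,
    smul_comm (sh ^ _) (vPow _), smul_comm (qfInv _) (vPow _), smul_comm ((-1 : Rh) ^ _) (vPow _),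
    smul_comm (qfInv _) (sh ^ _)]
  have Kz_exponent : m - (i + j : ℕ) + (-(i + j) + j) = m + (-(2 * i) + -j) := by
    push_cast
    ring
  rw [Kz_exponent, smul_smul ((-1) ^ _), ← mul_pow, neg_one_mul, neg_neg, one_pow, one_smul,
    smul_smul (sh ^ i), ← pow_add]
  congr 2
  push_cast
  ring

theorem hasHSum_bAntipode_drinfeldEltInv {m : ℤ} {x : Uh} (hx : IsWt m x) :
    HasHSum (fun n => vPow (-(2 * n * n)) • rCoeff n • (Kz m * (E ^ n * (Kz (-(2 * n)) *
      (drinfeldEltInv * (antipode x * antipode (F ^ n))))))) (bAntipode x) := by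
  refine (hasHSum_antidiagonal (s := fun i j => vPow (-(2 * i * i)) • rCoeff i •
    drinfeldInvCoeff j • (Kz m * (E ^ i * (Kz (-(2 * i)) *
      (E ^ j * Kz (-j) * F ^ j * (antipode x * antipode (F ^ i))))))) fun i => ?_).1 ?_
  · refine (hasHSum_drinfeldEltInv.map (vPow (-(2 * i * i)) • rCoeff i •
      (LinearMap.mulLeft Rh (Kz m) ∘ₗ LinearMap.mulLeft Rh (E ^ i) ∘ₗ
        LinearMap.mulLeft Rh (Kz (-(2 * i))) ∘ₗ
          LinearMap.mulRight Rh (antipode x * antipode (F ^ i))))).congr fun j => ?_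
    simp only [LinearMap.smul_apply, LinearMap.comp_apply, LinearMap.mulLeft_apply,
      LinearMap.mulRight_apply, smul_mul_assoc, mul_smul_comm]
  · refine (hasHSum_bAntipode hx).congr fun n => ?_
    rw [rCoeff, mul_smul, ← mul_smul_comm, ← map_smul, ad_F_pow, map_sum, Finset.mul_sum,
      Finset.smul_sum]
    refine Finset.sum_congr rfl fun ⟨i, j⟩ hp => ?_
    rw [← mem_antidiagonal.1 hp]
    exact bAntipode_summand hx i j

theorem IsWt.bAntipode {m : ℤ} {x : Uh} (hx : IsWt m x) : IsWt m (bAntipode x) :=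
  IsWt.of_hasHSum (hasHSum_bAntipode hx) fun n =>
    ((((isWt_Kz _).mul (isWt_E_pow n)).mul (hx.isWt_ad_F_pow n).antipode).smul _).congr (by ring)

theorem drinfeldElt_mul_drinfeldEltInv_conj (m : ℤ) (i : ℕ) (y : Uh) :
    drinfeldElt * (Kz m * (E ^ i * (Kz (-(2 * i)) * (drinfeldEltInv * y)))) =
      vPow (2 * i * (i - 1)) • (Kz m * (E ^ i * y)) := by
  rw [← Kz_mul_drinfeldElt_mul, drinfeldElt_mul_E_pow_mul, ← Kz_mul_drinfeldElt_mul,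
    Kz_mul_Kz_assoc, add_neg_cancel, Kz_zero, one_mul, ← mul_assoc drinfeldElt,
    drinfeldElt_mul_drinfeldEltInv, one_mul, mul_smul_comm]

theorem antipode_bAntipodeInv_bAntipode_summand {m : ℤ} {x : Uh} (hx : IsWt m x) (j i : ℕ) :
    vPow (-(2 * j * j)) • rCoeff j • vPow (-(2 * i * i)) • rCoeff i •
      (Kz (j - m) * (E ^ j * (drinfeldElt * (Kz m * (E ^ i * (Kz (-(2 * i)) *
        (drinfeldEltInv * (antipode x * antipode (F ^ i))))) * F ^ j)))) =
    (qfInv j * qfInv i * ((-1) ^ j * vPow (i * (i - 1)))) •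
      ((-1) ^ (j + i) * sh ^ (j + i) * vPow (-((j + i : ℕ) * ((j + i : ℕ) + 1)))) •
        (E ^ (j + i) * antipode x * F ^ (j + i) * Kz (j + i : ℕ)) := by
  rw [mul_assoc (Kz m), mul_assoc (E ^ i), mul_assoc (Kz _), mul_assoc drinfeldEltInv,
    drinfeldElt_mul_drinfeldEltInv_conj, antipode_F_pow]
  simp only [mul_assoc, mul_smul, smul_mul_assoc, mul_smul_comm, ← Kz_add,
    (isWt_E_pow _).Kz_mul_assoc, (isWt_F_pow _).Kz_mul_assoc, hx.antipode.Kz_mul_assoc,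
    pow_mul_pow_mul_assoc, Kz_mul_F_pow, rCoeff_smul, vPow_smul_smul,
    smul_comm (sh ^ _) (vPow _), smul_comm (qfInv _) (vPow _), smul_comm ((-1 : Rh) ^ _) (vPow _),
    smul_comm (qfInv _) (sh ^ _), smul_comm ((-1 : Rh) ^ _) (sh ^ _)]
  have Kz_exponent : j - m + (m + i) = (j + i : ℕ) := by
    push_cast
    ring
  rw [smul_smul ((-1) ^ _), neg_one_pow_mul_neg_one_pow_add, Kz_exponent, add_comm i j,
    smul_smul (sh ^ j), ← pow_add]
  congr 2
  push_cast
  ring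

theorem antipode_bAntipodeInv_bAntipode {m : ℤ} {x : Uh} (hx : IsWt m x) :
    antipode (bAntipodeInv (bAntipode x)) = antipode x := by
  have cancel := HasHSum.eq_of_smul_qfInv
    (y := fun n => ((-1) ^ n * sh ^ n * vPow (-(n * (n + 1)))) •
      (E ^ n * antipode x * F ^ n * Kz n)) (fun j => ?_)
    (hasHSum_antipode_bAntipodeInv hx.bAntipode) (antipode_bAntipodeInv_bAntipode_summand hx)
  · rw [cancel]
    simp [vPow_zero, Kz_zero]
  · refine ((hasHSum_bAntipode_drinfeldEltInv hx).map (vPow (-(2 * j * j)) • rCoeff j •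
      (LinearMap.mulLeft Rh (Kz (j - m)) ∘ₗ LinearMap.mulLeft Rh (E ^ j) ∘ₗ
        LinearMap.mulLeft Rh drinfeldElt ∘ₗ LinearMap.mulRight Rh (F ^ j)))).congr fun i => ?_
    simp only [LinearMap.smul_apply, LinearMap.comp_apply, LinearMap.mulLeft_apply,
      LinearMap.mulRight_apply, smul_mul_assoc, mul_smul_comm]

theorem bAntipodeInv_comp_bAntipode : bAntipodeInv ∘ₗ bAntipode = LinearMap.id :=
  uh_ext_wt fun m x hx => by
    have antipodeInv_eq := congrArg antipodeInv (antipode_bAntipodeInv_bAntipode hx)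
    rwa [antipodeInv_antipode, antipodeInv_antipode] at antipodeInv_eq

/-! ### The structure maps modulo `h` -/

theorem Dmat_sub_one_mem : Dmat - 1 ∈ hPow Uh2 1 := by
  have coeff_zero : PowerSeries.coeff 0 (expS (cst (1 / 4) • tm H H)) = 1 := by simp [expS]
  have D_sub_partialSum := hSum_spec (expS (cst (1 / 4) • tm H H)) 1
  rwa [Finset.sum_range_one, pow_zero, one_smul, coeff_zero] at D_sub_partialSum

theorem ext2_Rmat_sub_mem {N : Type*} [AddCommGroup N] [Module Rh N] [IsAdicComplete hId N]
    (f : Uh ⊗[Rh] Uh →ₗ[Rh] N) : ext2 f Rmat - f (1 ⊗ₜ 1) ∈ hPow N 1 := by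
  have tm_one : tm 1 1 = (1 : Uh2) := map_one toUh2
  have R_sub_D := hasHSum_Rmat f 1
  have D_sub_one := map_mem_hPow (ext2 f) Dmat_sub_one_mem
  simp only [Finset.sum_range_one, pow_zero, one_smul, rCoeff_zero, tm_one, mul_one] at R_sub_D
  rw [map_sub, ← tm_one, ext2_tm] at D_sub_one
  simpa using add_mem R_sub_D D_sub_one

theorem antipode_bAntipodeInv_sub_mem (x : Uh) : antipode (bAntipodeInv x) - x ∈ hPow Uh 1 := by
  have value_sub_mem := map_mem_hPow antipode (ext2_Rmat_sub_mem (LinearMap.mul' Rh Uh ∘ₗ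
    TensorProduct.map (antipodeInv ∘ₗ ad.flip x) LinearMap.id))
  rw [LinearMap.comp_apply (LinearMap.mul' Rh Uh), TensorProduct.map_tmul, LinearMap.mul'_apply,
    LinearMap.id_apply, mul_one, LinearMap.comp_apply antipodeInv, LinearMap.flip_apply, ad_one,
    map_sub, antipode_antipodeInv] at value_sub_mem
  exact value_sub_mem

theorem bAntipode_comp_bAntipodeInv : bAntipode ∘ₗ bAntipodeInv = LinearMap.id := by
  have injective : Function.Injective (antipode ∘ₗ bAntipodeInv) :=
    injective_of_sub_mem_hPow _ antipode_bAntipodeInv_sub_mem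
  ext x
  exact injective (congrArg antipode
    (LinearMap.congr_fun bAntipodeInv_comp_bAntipode (bAntipodeInv x)))

theorem braiding_sub_mem (x y : Uh) : braiding (tm x y) - tm y x ∈ hPow Uh2 1 := by
  have value_sub_mem := ext2_Rmat_sub_mem (swapMap₂ (ad.flip x) (ad.flip y))
  rw [swapMap₂_tmul, LinearMap.flip_apply, LinearMap.flip_apply, ad_one, ad_one] at value_sub_mem
  rwa [braiding_tm]

theorem braidingInv_sub_mem (x y : Uh) : braidingInv (tm x y) - tm y x ∈ hPow Uh2 1 := by
  have value_sub_mem := ext2_Rmat_sub_mem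
    (toUh2.toLinearMap ∘ₗ TensorProduct.map (ad.flip y ∘ₗ antipode) (ad.flip x))
  have value_one : (toUh2.toLinearMap ∘ₗ TensorProduct.map (ad.flip y ∘ₗ antipode) (ad.flip x))
      (1 ⊗ₜ 1) = tm (ad (antipode 1) y) (ad 1 x) := rfl
  rw [value_one, antipode_one, ad_one, ad_one] at value_sub_mem
  rwa [braidingInv_tm]

theorem braidingInv_braiding_sub_mem (z : Uh2) : braidingInv (braiding z) - z ∈ hPow Uh2 1 := by
  have toUh2_sub_mem (a : Uh ⊗[Rh] Uh) :
      braidingInv (braiding (toUh2 a)) - toUh2 a ∈ hPow Uh2 1 := by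
    induction a using TensorProduct.induction_on with
    | zero => simp
    | tmul x y =>
      have sum_mem :=
        add_mem (map_mem_hPow braidingInv (braiding_sub_mem x y)) (braidingInv_sub_mem y x)
      rwa [map_sub, sub_add_sub_cancel] at sum_mem
    | add a b ha hb =>
      rw [map_add, map_add, map_add, add_sub_add_comm]
      exact add_mem ha hb
  obtain ⟨a, ha⟩ : ∃ a, z - toUh2 a ∈ hPow Uh2 1 := exists_hof_sub_mem (M := Uh ⊗[Rh] Uh) z 1
  have combination_mem :=
    sub_mem (add_mem (map_mem_hPow (braidingInv ∘ₗ braiding) ha) (toUh2_sub_mem a)) ha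
  rw [map_sub, LinearMap.comp_apply, LinearMap.comp_apply] at combination_mem
  convert combination_mem using 1
  abel

theorem braidingInv_comp_braiding : braidingInv ∘ₗ braiding = LinearMap.id := by
  have injective : Function.Injective (braidingInv ∘ₗ braiding) :=
    injective_of_sub_mem_hPow _ braidingInv_braiding_sub_mem
  ext z
  exact injective (congrArg braidingInv
    (LinearMap.congr_fun braiding_comp_braidingInv (braiding z)))

/-! ### The even integral form and its filtration -/

theorem mem_of_even {A : Type*} [Monoid A] {S : Submonoid A} {f : ℤ → A} (f_zero : f 0 = 1)
    (f_add : ∀ a b, f (a + b) = f a * f b) (f_two : f 2 ∈ S) (f_neg_two : f (-2) ∈ S) {a : ℤ}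
    (ha : Even a) : f a ∈ S := by
  obtain ⟨b, rfl⟩ := ha
  rw [← two_mul]
  induction b using Int.induction_on with
  | zero => simp only [mul_zero, f_zero, one_mem]
  | succ n ih =>
    rw [mul_add_one, f_add]
    exact mul_mem ih f_two
  | pred n ih =>
    rw [mul_sub_one, sub_eq_add_neg, f_add]
    exact mul_mem ih f_neg_two

theorem vPow_mem_Zq {a : ℤ} (ha : Even a) : vPow a ∈ Zq :=
  mem_of_even (S := Zq.toSubmonoid) vPow_zero vPow_add (Subring.subset_closure (by simp))
    (Subring.subset_closure (by simp)) ha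

section Scalars

variable {M : Type*} [AddCommGroup M] [Module Rh M]

theorem Zq_smul_mem (S : Submodule Zq M) {c : Rh} (hc : c ∈ Zq) {x : M} (hx : x ∈ S) :
    c • x ∈ S := S.smul_mem ⟨c, hc⟩ hx

theorem vPow_smul_mem (S : Submodule Zq M) {a : ℤ} (ha : Even a) {x : M} (hx : x ∈ S) :
    vPow a • x ∈ S := Zq_smul_mem S (vPow_mem_Zq ha) hx

theorem neg_one_pow_smul_mem (S : Submodule Zq M) (n : ℕ) {x : M} (hx : x ∈ S) :
    (-1 : Rh) ^ n • x ∈ S := Zq_smul_mem S (pow_mem (neg_mem (one_mem _)) n) hx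

variable {N : Type*} [AddCommGroup N] [Module Rh N]

theorem map_span_mem {S : Submodule Zq N} {f : M →ₗ[Rh] N} {T : Set M} (h : ∀ x ∈ T, f x ∈ S)
    {x : M} (hx : x ∈ Submodule.span Zq T) : f x ∈ S :=
  (Submodule.span_le (p := S.comap (f.restrictScalars Zq))).2 h hx

end Scalars

theorem e_pow (n : ℕ) : e ^ n = (PowerSeries.X * sh : Rh) ^ n • E ^ n := by
  rw [e, ← X_mul_sh, smul_pow]

theorem isWt_e : IsWt 1 e := isWt_E.smul _

theorem isWt_e_pow (n : ℕ) : IsWt n (e ^ n) := (isWt_e.pow n).congr (mul_one _)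

theorem Fdiv_eq (n : ℕ) : Fdiv n = qfInv n • (F ^ n * Kz n) := by rw [Fdiv, K_pow, qfInv]

theorem isWt_Fdiv (n : ℕ) : IsWt (-n) (Fdiv n) := by
  rw [Fdiv_eq]
  exact (((isWt_F_pow n).mul (isWt_Kz n)).smul _).congr (add_zero _)

theorem e_mem_Uev : e ∈ Uev := Algebra.subset_adjoin (by simp)

theorem Fdiv_mem_Uev (n : ℕ) : Fdiv n ∈ Uev := by
  rcases n.eq_zero_or_pos with rfl | hn
  · simp [Fdiv_eq, qfInv_zero, Kz_zero, one_mem]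
  · exact Algebra.subset_adjoin (Or.inr ⟨n, hn, rfl⟩)

theorem Kz_mem_Uev {a : ℤ} (ha : Even a) : Kz a ∈ Uev :=
  mem_of_even (S := Uev.toSubsemiring.toSubmonoid) Kz_zero Kz_add
    (Algebra.subset_adjoin (by simp [K_pow])) (Algebra.subset_adjoin (by simp [Kinv_pow])) ha

theorem mul_e_pow_mul_mem_fil1 {a b : Uh} (ha : a ∈ Uev) (hb : b ∈ Uev) (p : ℕ) :
    a * e ^ p * b ∈ fil1 p := Submodule.subset_span ⟨a, ha, b, hb, rfl⟩

theorem e_pow_mem_fil1 (p : ℕ) : e ^ p ∈ fil1 p := by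
  simpa using mul_e_pow_mul_mem_fil1 (one_mem _) (one_mem _) p

theorem fil1_antitone : Antitone fil1 := fun p q h => Submodule.span_le.2 <| by
  rintro _ ⟨a, ha, b, hb, rfl⟩
  have hmem := mul_e_pow_mul_mem_fil1 ha (mul_mem (pow_mem e_mem_Uev (q - p)) hb) p
  rwa [← mul_assoc, mul_assoc a, ← pow_add, Nat.add_sub_cancel' h] at hmem

theorem mem_fil1_zero {x : Uh} : x ∈ fil1 0 ↔ x ∈ Uev := by
  have fil1_zero_le : fil1 0 ≤ Subalgebra.toSubmodule Uev := Submodule.span_le.2 <| by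
    rintro _ ⟨a, ha, b, hb, rfl⟩
    rw [pow_zero, mul_one]
    exact Uev.mul_mem ha hb
  refine ⟨fun hx => fil1_zero_le hx, fun hx => ?_⟩
  simpa using mul_e_pow_mul_mem_fil1 hx (one_mem _) 0

theorem fil1_le_Uev {p : ℕ} {x : Uh} (hx : x ∈ fil1 p) : x ∈ Uev :=
  mem_fil1_zero.1 (fil1_antitone (Nat.zero_le p) hx)

theorem mul_mem_fil1_left {p : ℕ} {a x : Uh} (ha : a ∈ Uev) (hx : x ∈ fil1 p) :
    a * x ∈ fil1 p := by
  refine map_span_mem (f := LinearMap.mulLeft Rh a) ?_ hx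
  rintro _ ⟨b, hb, c, hc, rfl⟩
  rw [LinearMap.mulLeft_apply, ← mul_assoc, ← mul_assoc]
  exact mul_e_pow_mul_mem_fil1 (mul_mem ha hb) hc p

theorem mul_mem_fil1_right {p : ℕ} {a x : Uh} (ha : a ∈ Uev) (hx : x ∈ fil1 p) :
    x * a ∈ fil1 p := by
  refine map_span_mem (f := LinearMap.mulRight Rh a) ?_ hx
  rintro _ ⟨b, hb, c, hc, rfl⟩
  rw [LinearMap.mulRight_apply, mul_assoc (b * e ^ p)]
  exact mul_e_pow_mul_mem_fil1 hb (mul_mem hc ha) p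

theorem mul_mem_fil1 {p q : ℕ} {x y : Uh} (hx : x ∈ fil1 p) (hy : y ∈ fil1 q) :
    x * y ∈ fil1 (max p q) := by
  rcases le_total p q with h | h
  · rw [max_eq_right h]
    exact mul_mem_fil1_left (fil1_le_Uev hx) hy
  · rw [max_eq_left h]
    exact mul_mem_fil1_right (fil1_le_Uev hy) hx

theorem mem_hPow_of_mem_fil1 (p : ℕ) (x : Uh) (hx : x ∈ fil1 p) : x ∈ hPow Uh p := by
  refine (Submodule.span_le (p := (hPow Uh p).restrictScalars Zq)).2 ?_ hx
  rintro _ ⟨a, -, b, -, rfl⟩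
  have e_pow_mem : e ^ p ∈ hPow Uh p := by
    rw [e_pow, mul_pow, mul_smul]
    exact X_pow_smul_mem_hPow _ _
  exact map_mem_hPow (LinearMap.mulRight Rh b ∘ₗ LinearMap.mulLeft Rh a) e_pow_mem

theorem tm_mem_fil2 {p q : ℕ} {x y : Uh} (hx : x ∈ fil1 p) (hy : y ∈ fil1 q) :
    tm x y ∈ fil2 (max p q) := by
  rcases le_total p q with h | h
  · rw [max_eq_right h]
    exact Submodule.mem_sup_right (Submodule.subset_span ⟨x, fil1_le_Uev hx, y, hy, rfl⟩)
  · rw [max_eq_left h]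
    exact Submodule.mem_sup_left (Submodule.subset_span ⟨x, hx, y, fil1_le_Uev hy, rfl⟩)

theorem fil2_le {p : ℕ} {S : Submodule Zq Uh2} (left : ∀ x ∈ fil1 p, ∀ y ∈ Uev, tm x y ∈ S)
    (right : ∀ x ∈ Uev, ∀ y ∈ fil1 p, tm x y ∈ S) : fil2 p ≤ S := by
  refine sup_le (Submodule.span_le.2 ?_) (Submodule.span_le.2 ?_)
  · rintro _ ⟨x, hx, y, hy, rfl⟩
    exact left x hx y hy
  · rintro _ ⟨x, hx, y, hy, rfl⟩
    exact right x hx y hy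

theorem fil2_antitone : Antitone fil2 := fun p q h => by
  refine fil2_le (fun x hx y hy => ?_) fun x hx y hy => ?_
  · simpa using tm_mem_fil2 (fil1_antitone h hx) (mem_fil1_zero.2 hy)
  · simpa using tm_mem_fil2 (mem_fil1_zero.2 hx) (fil1_antitone h hy)

theorem mem_hPow_of_mem_fil2 (p : ℕ) (z : Uh2) (hz : z ∈ fil2 p) : z ∈ hPow Uh2 p :=
  fil2_le (S := (hPow Uh2 p).restrictScalars Zq)
    (fun x hx y _ => map_mem_hPow (tmL.flip y) (mem_hPow_of_mem_fil1 p x hx))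
    (fun x _ y hy => map_mem_hPow (tmL x) (mem_hPow_of_mem_fil1 p y hy)) hz

/-! ### Weight vectors in the even integral form -/

/-- The weight vectors `x` in the `p`-th step of the filtration for which `K ^ m S(x)` and
`S⁻¹(x) K ^ m` are also in the `p`-th step, where `m` is the weight of `x`. The antipode itself does
not preserve the even integral form: `S(e) = -K⁻¹ e` involves an odd power of `K`. -/
def filWt (m : ℤ) (p : ℕ) : Submodule Zq Uh where
  carrier := {x | IsWt m x ∧ x ∈ fil1 p ∧ Kz m * antipode x ∈ fil1 p ∧
    antipodeInv x * Kz m ∈ fil1 p}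
  add_mem' := by
    rintro x y ⟨wt_x, mem_x, antipode_x, antipodeInv_x⟩ ⟨wt_y, mem_y, antipode_y, antipodeInv_y⟩
    refine ⟨wt_x.add wt_y, add_mem mem_x mem_y, ?_, ?_⟩
    · rw [map_add, mul_add]
      exact add_mem antipode_x antipode_y
    · rw [map_add, add_mul]
      exact add_mem antipodeInv_x antipodeInv_y
  zero_mem' := ⟨isWt_zero m, zero_mem _, by simp, by simp⟩
  smul_mem' := by
    rintro ⟨c, hc⟩ x ⟨wt_x, mem_x, antipode_x, antipodeInv_x⟩
    change IsWt m (c • x) ∧ c • x ∈ fil1 p ∧ Kz m * antipode (c • x) ∈ fil1 p ∧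
      antipodeInv (c • x) * Kz m ∈ fil1 p
    rw [map_smul, map_smul, mul_smul_comm, smul_mul_assoc]
    exact ⟨wt_x.smul c, Zq_smul_mem _ hc mem_x, Zq_smul_mem _ hc antipode_x,
      Zq_smul_mem _ hc antipodeInv_x⟩

theorem filWt_antitone (m : ℤ) : Antitone (filWt m) :=
  fun _ _ h _ hx => ⟨hx.1, fil1_antitone h hx.2.1, fil1_antitone h hx.2.2.1,
    fil1_antitone h hx.2.2.2⟩

theorem even_two_mul_mul (a b : ℤ) : Even (2 * a * b) := by
  rw [mul_assoc]
  exact even_two_mul _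

theorem mul_mem_filWt {m n : ℤ} {p q : ℕ} {x y : Uh} (hx : x ∈ filWt m p) (hy : y ∈ filWt n q) :
    x * y ∈ filWt (m + n) (max p q) := by
  obtain ⟨wt_x, mem_x, antipode_x, antipodeInv_x⟩ := hx
  obtain ⟨wt_y, mem_y, antipode_y, antipodeInv_y⟩ := hy
  refine ⟨wt_x.mul wt_y, mul_mem_fil1 mem_x mem_y, ?_, ?_⟩
  · rw [antipode_mul, add_comm, Kz_add, mul_assoc, wt_y.antipode.Kz_mul_assoc, mul_smul_comm,
      ← mul_assoc, max_comm]
    exact vPow_smul_mem _ (even_two_mul_mul _ _) (mul_mem_fil1 antipode_y antipode_x)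
  · rw [antipodeInv_mul, add_comm, Kz_add, mul_assoc, ← mul_assoc (antipodeInv x),
      wt_x.antipodeInv.mul_Kz, smul_mul_assoc, mul_smul_comm, mul_assoc (Kz n),
      ← mul_assoc (antipodeInv y), max_comm]
    exact vPow_smul_mem _ (even_two_mul_mul _ _).neg (mul_mem_fil1 antipodeInv_y antipodeInv_x)

theorem Kz_mem_filWt {a : ℤ} (ha : Even a) : Kz a ∈ filWt 0 0 := by
  refine ⟨isWt_Kz a, mem_fil1_zero.2 (Kz_mem_Uev ha), ?_, ?_⟩
  · rw [Kz_zero, one_mul, antipode_Kz]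
    exact mem_fil1_zero.2 (Kz_mem_Uev ha.neg)
  · rw [Kz_zero, mul_one, antipodeInv_Kz]
    exact mem_fil1_zero.2 (Kz_mem_Uev ha.neg)

theorem antipodeInv_of_antipode {x : Uh} {n : ℕ} {a b : ℤ}
    (h : antipode x = ((-1) ^ n * vPow a) • (x * Kz b)) :
    antipodeInv x = ((-1) ^ n * vPow (-a)) • (Kz b * x) := by
  have x_eq := congrArg antipodeInv h
  rw [antipodeInv_antipode, map_smul, antipodeInv_mul, antipodeInv_Kz] at x_eq
  have scalar_inv : ((-1) ^ n * vPow (-a)) * ((-1) ^ n * vPow a) = (1 : Rh) := by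
    rw [mul_mul_mul_comm, ← mul_pow, neg_one_mul, neg_neg, one_pow, one_mul, mul_comm,
      vPow_mul_neg]
  nth_rewrite 2 [x_eq]
  rw [mul_smul_comm, smul_smul, scalar_inv, one_smul, ← mul_assoc, Kz_mul_neg, one_mul]

theorem Kz_mul_antipode_e_pow (p : ℕ) :
    Kz p * antipode (e ^ p) = (-1 : Rh) ^ p • vPow (p * (p - 1)) • e ^ p := by
  rw [e_pow, map_smul, antipode_E_pow, mul_smul_comm, mul_smul_comm, ← mul_assoc, Kz_mul_E_pow,
    smul_mul_assoc, mul_assoc (E ^ p), Kz_mul_neg, mul_one, mul_smul, vPow_smul_smul,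
    smul_comm ((PowerSeries.X * sh) ^ p), smul_comm ((PowerSeries.X * sh) ^ p)]
  congr 3
  ring

theorem antipodeInv_e_pow_mul_Kz (p : ℕ) :
    antipodeInv (e ^ p) * Kz p = (-1 : Rh) ^ p • vPow (-(p * (p - 1))) • e ^ p := by
  rw [e_pow, map_smul, antipodeInv_of_antipode (antipode_E_pow p), smul_mul_assoc, smul_mul_assoc,
    Kz_mul_E_pow, smul_mul_assoc, mul_assoc (E ^ p), Kz_neg_mul, mul_one, mul_smul, vPow_smul_smul,
    smul_comm ((PowerSeries.X * sh) ^ p), smul_comm ((PowerSeries.X * sh) ^ p)]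
  congr 3
  ring

theorem e_pow_mem_filWt (p : ℕ) : e ^ p ∈ filWt p p := by
  refine ⟨isWt_e_pow p, e_pow_mem_fil1 p, ?_, ?_⟩
  · rw [Kz_mul_antipode_e_pow]
    exact neg_one_pow_smul_mem _ _ (vPow_smul_mem _ (Int.even_mul_pred_self _) (e_pow_mem_fil1 p))
  · rw [antipodeInv_e_pow_mul_Kz]
    exact neg_one_pow_smul_mem _ _
      (vPow_smul_mem _ (Int.even_mul_pred_self _).neg (e_pow_mem_fil1 p))

theorem Kz_mul_antipode_Fdiv (n : ℕ) : Kz (-n) * antipode (Fdiv n) =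
    (-1 : Rh) ^ n • vPow (-(n * (n - 1))) • (Kz (-(2 * n)) * Fdiv n) := by
  rw [Fdiv_eq, map_smul, antipode_mul, antipode_Kz, antipode_F_pow, mul_smul_comm, mul_smul_comm,
    mul_smul_comm, Kz_mul_Kz_assoc, smul_comm (qfInv n), mul_smul, mul_smul_comm, ← neg_add,
    ← two_mul]

theorem antipodeInv_Fdiv_mul_Kz (n : ℕ) : antipodeInv (Fdiv n) * Kz (-n) =
    (-1 : Rh) ^ n • vPow (n * (n - 1)) • (Fdiv n * Kz (-(2 * n))) := by
  rw [Fdiv_eq, map_smul, antipodeInv_mul, antipodeInv_Kz,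
    antipodeInv_of_antipode (antipode_F_pow n), neg_neg, smul_mul_assoc, mul_smul_comm,
    smul_mul_assoc, ← mul_assoc (Kz (-n)), Kz_neg_mul, one_mul, smul_comm (qfInv n), mul_smul,
    smul_mul_assoc, mul_assoc (F ^ n), ← Kz_add, two_mul, neg_add, add_neg_cancel_left]

theorem Fdiv_mem_filWt (n : ℕ) : Fdiv n ∈ filWt (-n) 0 := by
  have Kz_mem : Kz (-(2 * n)) ∈ Uev := Kz_mem_Uev (even_two_mul _).neg
  refine ⟨isWt_Fdiv n, mem_fil1_zero.2 (Fdiv_mem_Uev n), ?_, ?_⟩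
  · rw [Kz_mul_antipode_Fdiv]
    exact neg_one_pow_smul_mem _ _ (vPow_smul_mem _ (Int.even_mul_pred_self _).neg
      (mem_fil1_zero.2 (mul_mem Kz_mem (Fdiv_mem_Uev n))))
  · rw [antipodeInv_Fdiv_mul_Kz]
    exact neg_one_pow_smul_mem _ _ (vPow_smul_mem _ (Int.even_mul_pred_self _)
      (mem_fil1_zero.2 (mul_mem (Fdiv_mem_Uev n) Kz_mem)))

theorem Uev_le_span_filWt :
    Subalgebra.toSubmodule Uev ≤ Submodule.span Zq {x | ∃ m, x ∈ filWt m 0} := by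
  rw [Uev, Algebra.adjoin_eq_span]
  refine Submodule.span_mono fun x hx => ?_
  induction hx using Submonoid.closure_induction with
  | mem x hx =>
    rcases hx with (rfl | rfl | rfl) | ⟨n, _, rfl⟩
    · rw [K_pow]
      exact ⟨0, Kz_mem_filWt (by simp)⟩
    · rw [Kinv_pow]
      exact ⟨0, Kz_mem_filWt (by simp)⟩
    · exact ⟨1, by simpa using filWt_antitone _ (Nat.zero_le _) (e_pow_mem_filWt 1)⟩
    · exact ⟨_, Fdiv_mem_filWt n⟩
  | one => exact ⟨0, Kz_zero ▸ Kz_mem_filWt Even.zero⟩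
  | mul x y _ _ hx hy =>
    obtain ⟨m, hx⟩ := hx
    obtain ⟨n, hy⟩ := hy
    exact ⟨m + n, by simpa only [max_self] using mul_mem_filWt hx hy⟩

theorem fil1_le_span_filWt (p : ℕ) : fil1 p ≤ Submodule.span Zq {x | ∃ m, x ∈ filWt m p} := by
  refine Submodule.span_le.2 ?_
  rintro _ ⟨a, ha, b, hb, rfl⟩
  have mem_mul_span := Submodule.mul_mem_mul (Submodule.mul_mem_mul (Uev_le_span_filWt ha)
    (Submodule.mem_span_singleton_self (R := Zq) (e ^ p))) (Uev_le_span_filWt hb)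
  rw [Submodule.span_mul_span, Submodule.span_mul_span] at mem_mul_span
  refine Submodule.span_mono ?_ mem_mul_span
  rintro _ ⟨_, ⟨x, ⟨m, hx⟩, _, rfl, rfl⟩, y, ⟨n, hy⟩, rfl⟩
  exact ⟨_, by simpa using mul_mem_filWt (mul_mem_filWt hx (e_pow_mem_filWt p)) hy⟩

section WeightVectors

variable {N : Type*} [AddCommGroup N] [Module Rh N] {S : Submodule Zq N} {p : ℕ}

theorem map_fil1_mem {f : Uh →ₗ[Rh] N} (h : ∀ m, ∀ x ∈ filWt m p, f x ∈ S) {x : Uh}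
    (hx : x ∈ fil1 p) : f x ∈ S :=
  map_span_mem (T := {x | ∃ m, x ∈ filWt m p}) (fun x ⟨m, hx⟩ => h m x hx)
    (fil1_le_span_filWt p hx)

theorem map_fil2_mem {f : Uh2 →ₗ[Rh] N}
    (h : ∀ m n a b, p ≤ max a b → ∀ x ∈ filWt m a, ∀ y ∈ filWt n b, f (tm x y) ∈ S) {z : Uh2}
    (hz : z ∈ fil2 p) : f z ∈ S := by
  have map_tm_mem (a b : ℕ) (hab : p ≤ max a b) (x : Uh) (hx : x ∈ fil1 a) (y : Uh)
      (hy : y ∈ fil1 b) : f (tm x y) ∈ S :=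
    map_fil1_mem (f := f ∘ₗ tmL.flip y) (fun m x hx =>
      map_fil1_mem (f := f ∘ₗ tmL x) (fun n y hy => h m n a b hab x hx y hy) hy) hx
  exact fil2_le (S := S.comap (f.restrictScalars Zq))
    (fun x hx y hy => map_tm_mem p 0 (le_max_left _ _) x hx y (mem_fil1_zero.2 hy))
    (fun x hx y hy => map_tm_mem 0 p (le_max_right _ _) x (mem_fil1_zero.2 hx) y hy) hz

end WeightVectors

/-! ### Integrality of the adjoint action, the braiding and the braided antipode -/

theorem ad_e_pow (n : ℕ) (y : Uh) :
    ad (e ^ n) y = (PowerSeries.X * sh : Rh) ^ n • ad (E ^ n) y := by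
  rw [e_pow, map_smul, LinearMap.smul_apply]

theorem IsWt.ad_e {m : ℤ} {y : Uh} (hy : IsWt m y) :
    ad e y = e * y - vPow (2 * m) • (y * e) := by
  rw [e, map_smul, LinearMap.smul_apply, hy.ad_E, smul_sub, smul_mul_assoc, mul_smul_comm,
    smul_comm (vPow (2 * m))]

theorem ad_e_pow_mem_span {m : ℤ} {y : Uh} (hy : IsWt m y) (n : ℕ) :
    ad (e ^ n) y ∈ Submodule.span Zq {z | ∃ i j, i + j = n ∧ z = e ^ i * y * e ^ j} := by
  induction n with
  | zero =>
    rw [pow_zero, ad_one]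
    exact Submodule.subset_span ⟨0, 0, rfl, by simp⟩
  | succ n ih =>
    rw [pow_succ', ad_mul]
    refine map_span_mem ?_ ih
    rintro _ ⟨i, j, rfl, rfl⟩
    rw [(((isWt_e_pow i).mul hy).mul (isWt_e_pow j)).ad_e]
    refine sub_mem (Submodule.subset_span ⟨i + 1, j, by ring, ?_⟩)
      (vPow_smul_mem _ (even_two_mul _) (Submodule.subset_span ⟨i, j + 1, by ring, ?_⟩))
    · simp only [pow_succ', mul_assoc]
    · simp only [pow_succ, mul_assoc]

theorem ad_e_pow_mem_fil1 {m : ℤ} {p : ℕ} {y : Uh} (hy : y ∈ filWt m p) (n : ℕ) :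
    ad (e ^ n) y ∈ fil1 (max p (n / 2)) := by
  refine Submodule.span_le.2 ?_ (ad_e_pow_mem_span hy.1 n)
  rintro _ ⟨i, j, rfl, rfl⟩
  refine fil1_antitone ?_ (mul_mem_fil1 (mul_mem_fil1 (e_pow_mem_fil1 i) hy.2.1) (e_pow_mem_fil1 j))
  omega

theorem Fdiv_mul_mul_Fdiv {m : ℤ} {x : Uh} (hx : IsWt m x) (i j : ℕ) :
    Fdiv i * x * Fdiv j = vPow (2 * i * (m - j)) • (qfInv i * qfInv j) •
      (F ^ i * x * F ^ j * Kz (i + j)) := by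
  rw [Fdiv_eq, Fdiv_eq]
  simp only [smul_mul_assoc, mul_smul_comm, mul_assoc, hx.Kz_mul_assoc,
    (isWt_F_pow j).Kz_mul_assoc, ← Kz_add, vPow_smul_smul, smul_comm (qfInv _) (vPow _), mul_smul]
  rw [smul_comm (qfInv j) (qfInv i)]
  congr 2
  ring

theorem qfInv_smul_ad_F_pow_mem_filWt {m : ℤ} {p : ℕ} {x : Uh} (hx : x ∈ filWt m p) (n : ℕ) :
    qfInv n • ad (F ^ n) x ∈ filWt (m - n) p := by
  rw [ad_F_pow]
  refine sum_mem fun ⟨i, j⟩ hij => ?_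
  obtain rfl := mem_antidiagonal.1 hij
  have summand_eq : (qfInv i * qfInv j) • ((-1 : Rh) ^ j * vPow (-(j * (j - 1)) - 2 * i * j)) •
      (F ^ i * x * F ^ j * Kz (i + j)) = (-1 : Rh) ^ j • vPow (-(j * (j - 1)) - 2 * i * m) •
        (Fdiv i * x * Fdiv j) := by
    rw [Fdiv_mul_mul_Fdiv hx.1, vPow_smul_smul, smul_comm, mul_smul]
    congr 3
    ring
  have wt_eq : m - (i + j : ℕ) = -i + m + -j := by
    push_cast
    ring
  dsimp only
  rw [summand_eq, wt_eq]
  refine neg_one_pow_smul_mem _ _ (vPow_smul_mem _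
    ((Int.even_mul_pred_self _).neg.sub (even_two_mul_mul _ _)) ?_)
  simpa using mul_mem_filWt (mul_mem_filWt (Fdiv_mem_filWt i) hx) (Fdiv_mem_filWt j)

-- `hⁿ` times the `n`-th coefficient of `R` provides the scalars of both `eⁿ` and `F̃⁽ⁿ⁾`.
theorem X_pow_smul_rCoeff_smul {M : Type*} [AddCommGroup M] [Module Rh M] (n : ℕ) (z : M) :
    (PowerSeries.X : Rh) ^ n • rCoeff n • z =
      vPow (n * (n - 1)) • qfInv n • (PowerSeries.X * sh : Rh) ^ n • z := by
  rw [rCoeff]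
  simp only [smul_smul]
  congr 1
  ring

theorem tendsto_half_atTop : Tendsto (fun n : ℕ => n / 2) atTop atTop :=
  Nat.tendsto_div_const_atTop two_ne_zero

theorem braiding_tm_mem {m n : ℤ} {a b : ℕ} {x y : Uh} (hx : x ∈ filWt m a) (hy : y ∈ filWt n b) :
    braiding (tm x y) ∈ complFil fil2 (max a b) := by
  refine mem_complFil_of_hasHSum fil2_antitone mem_hPow_of_mem_fil2 tendsto_half_atTop
    (hasHSum_braiding hx.1 hy.1) fun k => ?_
  rw [mul_smul, X_pow_smul_rCoeff_smul, smul_comm _ (vPow (2 * _ * _)),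
    smul_comm (qfInv k) (vPow (2 * _ * _)), ← tm_smul_left, ← ad_e_pow, ← tm_smul_right]
  refine vPow_smul_mem _ (Int.even_mul_pred_self _) (vPow_smul_mem _ (even_two_mul_mul _ _) ?_)
  refine fil2_antitone ?_
    (tm_mem_fil2 (ad_e_pow_mem_fil1 hy k) (qfInv_smul_ad_F_pow_mem_filWt hx k).2.1)
  omega

theorem braidingInv_tm_mem {m n : ℤ} {a b : ℕ} {x y : Uh} (hx : x ∈ filWt m a)
    (hy : y ∈ filWt n b) : braidingInv (tm x y) ∈ complFil fil2 (max a b) := by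
  refine mem_complFil_of_hasHSum fil2_antitone mem_hPow_of_mem_fil2 tendsto_half_atTop
    (hasHSum_braidingInv hx.1 hy.1) fun k => ?_
  rw [mul_smul, X_pow_smul_rCoeff_smul, smul_comm _ ((-1) ^ k * _ : Rh),
    smul_comm (qfInv k) ((-1) ^ k * _ : Rh), ← tm_smul_right, ← ad_e_pow, ← tm_smul_left, mul_smul]
  refine vPow_smul_mem _ (Int.even_mul_pred_self _) (neg_one_pow_smul_mem _ _ (vPow_smul_mem _
    ((even_two_mul_mul _ _).neg.sub (Int.even_mul_pred_self _)) ?_))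
  refine fil2_antitone ?_
    (tm_mem_fil2 (qfInv_smul_ad_F_pow_mem_filWt hy k).2.1 (ad_e_pow_mem_fil1 hx k))
  omega

theorem braiding_mem {p : ℕ} {z : Uh2} (hz : z ∈ fil2 p) : braiding z ∈ complFil fil2 p :=
  map_fil2_mem (fun _ _ _ _ hab _ hx _ hy => complFil_antitone _ hab (braiding_tm_mem hx hy)) hz

theorem braidingInv_mem {p : ℕ} {z : Uh2} (hz : z ∈ fil2 p) : braidingInv z ∈ complFil fil2 p :=
  map_fil2_mem (fun _ _ _ _ hab _ hx _ hy => complFil_antitone _ hab (braidingInv_tm_mem hx hy)) hz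

theorem bAntipode_mem {p : ℕ} {x : Uh} (hx : x ∈ fil1 p) : bAntipode x ∈ complFil fil1 p := by
  refine map_fil1_mem (fun m x hx => ?_) hx
  refine mem_complFil_of_hasHSum fil1_antitone mem_hPow_of_mem_fil1 Filter.tendsto_id
    (hasHSum_bAntipode hx.1) fun k => ?_
  have summand_eq : qfInv k • (PowerSeries.X * sh : Rh) ^ k •
      (Kz (m - k) * E ^ k * antipode (ad (F ^ k) x)) = vPow (2 * (m - k) * k) •
        (e ^ k * (Kz (m - k) * antipode (qfInv k • ad (F ^ k) x))) := by
    rw [Kz_mul_E_pow, e_pow, map_smul]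
    simp only [mul_smul_comm, smul_mul_assoc, mul_assoc, smul_comm _ (vPow _)]
  rw [X_pow_smul_rCoeff_smul, summand_eq, id, max_comm]
  exact vPow_smul_mem _ (Int.even_mul_pred_self _) (vPow_smul_mem _ (even_two_mul_mul _ _)
    (mul_mem_fil1 (e_pow_mem_fil1 k) (qfInv_smul_ad_F_pow_mem_filWt hx k).2.2.1))

theorem bAntipodeInv_mem {p : ℕ} {x : Uh} (hx : x ∈ fil1 p) :
    bAntipodeInv x ∈ complFil fil1 p := by
  refine map_fil1_mem (fun m x hx => ?_) hx
  refine mem_complFil_of_hasHSum fil1_antitone mem_hPow_of_mem_fil1 Filter.tendsto_id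
    (hasHSum_bAntipodeInv hx.1) fun k => ?_
  have summand_eq : qfInv k • (PowerSeries.X * sh : Rh) ^ k • (antipodeInv (ad (F ^ k) x) *
      (Kz (m - k) * E ^ k)) = antipodeInv (qfInv k • ad (F ^ k) x) * Kz (m - k) * e ^ k := by
    rw [e_pow, map_smul]
    simp only [mul_smul_comm, smul_mul_assoc, mul_assoc, smul_comm (qfInv k)]
  rw [X_pow_smul_rCoeff_smul, summand_eq]
  exact vPow_smul_mem _ (Int.even_mul_pred_self _)
    (mul_mem_fil1 (qfInv_smul_ad_F_pow_mem_filWt hx k).2.2.2 (e_pow_mem_fil1 k))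

/-! ### Integrality of the braided comultiplication -/

/-- The span of the `x ⊗ y` with `y` an integral weight vector of weight `m` and `x K⁻ᵐ` integral,
one of the two in the `p`-th step of the filtration. The ordinary comultiplication takes values in
this twisted form of `fil2 p` only, because of the odd power of `K` in `Δ(e) = e ⊗ 1 + K ⊗ e`. -/
def twistedFil (p : ℕ) : Submodule Zq Uh2 :=
  Submodule.span Zq {z | ∃ (m n : ℤ) (a b : ℕ) (x y : Uh), p ≤ max a b ∧ IsWt n x ∧
    x * Kz (-m) ∈ fil1 a ∧ y ∈ filWt m b ∧ z = tm x y}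

theorem mul_mem_twistedFil {p q : ℕ} {z w : Uh2} (hz : z ∈ twistedFil p)
    (hw : w ∈ twistedFil q) : z * w ∈ twistedFil (max p q) := by
  have mem_mul_span := Submodule.mul_mem_mul hz hw
  rw [twistedFil, twistedFil, Submodule.span_mul_span] at mem_mul_span
  refine Submodule.span_mono ?_ mem_mul_span
  rintro _ ⟨_, ⟨m, n, a, b, x, y, hab, wt_x, hx, hy, rfl⟩, _,
    ⟨m', n', a', b', x', y', hab', wt_x', hx', hy', rfl⟩, rfl⟩
  refine ⟨m + m', n + n', max a a', max b b', x * x', y * y', by omega, wt_x.mul wt_x', ?_,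
    mul_mem_filWt hy hy', tm_mul _ _ _ _⟩
  rw [neg_add, Kz_add, mul_assoc, ← mul_assoc x', wt_x'.mul_Kz, smul_mul_assoc, mul_smul_comm,
    mul_assoc (Kz (-m)), ← mul_assoc x]
  exact vPow_smul_mem _ (even_two_mul_mul _ _).neg (mul_mem_fil1 hx hx')

theorem comul_Kz (a : ℤ) : comul (Kz a) = tm (Kz a) (Kz a) := by
  rw [Kz, map_hExp, map_smul, comul_H, ← inl_apply, ← inr_apply, smul_add,
    hExp_add (((commute_inl_inr H H).smul_left _).smul_right _), ← map_smul, ← map_smul, ← map_hExp,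
    ← map_hExp, ← tm_eq]

theorem comul_Kz_mem {a : ℤ} (ha : Even a) : comul (Kz a) ∈ twistedFil 0 := by
  rw [comul_Kz]
  refine Submodule.subset_span
    ⟨0, 0, 0, 0, _, _, Nat.zero_le _, isWt_Kz a, ?_, Kz_mem_filWt ha, rfl⟩
  rw [neg_zero, Kz_zero, mul_one]
  exact mem_fil1_zero.2 (Kz_mem_Uev ha)

theorem comul_e : comul e = tm e 1 + tm (Kz 1) e := by
  rw [e, map_smul, comul_E, smul_add, ← tm_smul_left, ← tm_smul_right, Kz_one]

theorem comul_e_pow_mem_span (p : ℕ) : comul (e ^ p) ∈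
    Submodule.span Zq {z | ∃ i j : ℕ, i + j = p ∧ z = tm (e ^ i * Kz j) (e ^ j)} := by
  induction p with
  | zero =>
    refine Submodule.subset_span ⟨0, 0, rfl, ?_⟩
    rw [pow_zero, map_one, Nat.cast_zero, Kz_zero, mul_one]
    exact (map_one toUh2).symm
  | succ p ih =>
    rw [pow_succ', map_mul]
    refine map_span_mem (f := LinearMap.mulLeft Rh (comul e)) ?_ ih
    rintro _ ⟨i, j, hij, rfl⟩
    rw [LinearMap.mulLeft_apply, comul_e, add_mul, tm_mul, tm_mul, one_mul, ← mul_assoc,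
      ← pow_succ', ← pow_succ', (isWt_e_pow i).Kz_mul_assoc, tm_smul_left, ← Kz_add]
    refine add_mem (Submodule.subset_span ⟨i + 1, j, by omega, rfl⟩)
      (vPow_smul_mem _ (even_two_mul_mul _ _) (Submodule.subset_span ⟨i, j + 1, by omega, ?_⟩))
    rw [add_comm 1 (j : ℤ), Nat.cast_succ]

theorem comul_e_pow_mem (p : ℕ) : comul (e ^ p) ∈ twistedFil (p / 2) := by
  refine Submodule.span_le.2 ?_ (comul_e_pow_mem_span p)
  rintro _ ⟨i, j, hij, rfl⟩
  refine Submodule.subset_span ⟨j, i, i, j, _, _, by omega,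
    ((isWt_e_pow i).mul (isWt_Kz j)).congr (add_zero _), ?_, e_pow_mem_filWt j, rfl⟩
  rw [mul_assoc, Kz_mul_neg, mul_one]
  exact e_pow_mem_fil1 i

theorem comul_F_mul_tm_mul_comul_Kz_one (i j : ℕ) :
    comul F * tm (F ^ i * Kz (i + j)) (F ^ j * Kz j) * comul (Kz 1) =
      tm (F ^ i * Kz (i + (j + 1 : ℕ))) (F ^ (j + 1) * Kz (j + 1 : ℕ)) +
        vPow (2 * j) • tm (F ^ (i + 1) * Kz ((i + 1 : ℕ) + j)) (F ^ j * Kz j) := by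
  have left_summand : tm F Kinv * tm (F ^ i * Kz (i + j)) (F ^ j * Kz j) * tm (Kz 1) (Kz 1) =
      vPow (2 * j) • tm (F ^ (i + 1) * Kz ((i + 1 : ℕ) + j)) (F ^ j * Kz j) := by
    rw [tm_mul, tm_mul, ← Kz_neg_one, (isWt_F_pow j).Kz_mul_assoc, smul_mul_assoc,
      tm_smul_right, pow_succ']
    simp only [mul_assoc, ← Kz_add]
    push_cast
    rw [add_right_comm (i : ℤ) 1, neg_mul_neg, one_mul, neg_add_cancel_comm]
  have right_summand : tm 1 F * tm (F ^ i * Kz (i + j)) (F ^ j * Kz j) * tm (Kz 1) (Kz 1) =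
      tm (F ^ i * Kz (i + (j + 1 : ℕ))) (F ^ (j + 1) * Kz (j + 1 : ℕ)) := by
    rw [tm_mul, tm_mul, one_mul, pow_succ' F j]
    simp only [mul_assoc, ← Kz_add]
    push_cast
    rw [add_assoc]
  rw [comul_F, comul_Kz, add_mul, add_mul, left_summand, right_summand, add_comm]

theorem comul_Fdiv (n : ℕ) : comul (Fdiv n) = ∑ p ∈ antidiagonal n,
    (qfInv p.1 * qfInv p.2) • tm (F ^ p.1 * Kz (p.1 + p.2)) (F ^ p.2 * Kz p.2) := by
  rw [Fdiv_eq, map_smul]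
  induction n with
  | zero =>
    simp only [qfInv_zero, pow_zero, Nat.cast_zero, Kz_zero, mul_one, map_one,
      Finset.Nat.antidiagonal_zero, Finset.sum_singleton, one_smul, add_zero]
    exact (map_one toUh2).symm
  | succ n ih =>
    refine (isUnit_qIntQ_succ n).smul_left_cancel.1 ?_
    have F_pow_succ_mul_Kz : F ^ (n + 1) * Kz (n + 1 : ℕ) = F * (F ^ n * Kz n) * Kz 1 := by
      rw [pow_succ', mul_assoc, mul_assoc, mul_assoc, ← Kz_add, Nat.cast_succ]
    rw [smul_smul, qIntQ_mul_qfInv, F_pow_succ_mul_Kz, map_mul, map_mul, ← smul_mul_assoc,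
      ← mul_smul_comm, ih,
      qIntQ_smul_sum_antidiagonal (fun i j => tm (F ^ i * Kz (i + j)) (F ^ j * Kz j)),
      Finset.mul_sum, Finset.sum_mul]
    refine Finset.sum_congr rfl fun p _ => ?_
    rw [mul_smul_comm, smul_mul_assoc, comul_F_mul_tm_mul_comul_Kz_one]

theorem comul_Fdiv_mem (n : ℕ) : comul (Fdiv n) ∈ twistedFil 0 := by
  rw [comul_Fdiv]
  refine sum_mem fun ⟨i, j⟩ _ => ?_
  refine Submodule.subset_span ⟨-j, -i, 0, 0, Fdiv i * Kz j, Fdiv j, Nat.zero_le _,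
    ((isWt_Fdiv i).mul (isWt_Kz j)).congr (add_zero _), ?_, Fdiv_mem_filWt j, ?_⟩
  · rw [neg_neg, mul_assoc, ← Kz_add]
    exact mem_fil1_zero.2 (mul_mem (Fdiv_mem_Uev i) (Kz_mem_Uev ⟨_, rfl⟩))
  · rw [Fdiv_eq, Fdiv_eq, smul_mul_assoc, tm_smul_left, tm_smul_right, smul_smul, mul_assoc,
      ← Kz_add]

theorem comul_mem_of_mem_Uev {x : Uh} (hx : x ∈ Uev) : comul x ∈ twistedFil 0 := by
  induction hx using Algebra.adjoin_induction with
  | mem x hx =>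
    rcases hx with (rfl | rfl | rfl) | ⟨n, _, rfl⟩
    · rw [K_pow]
      exact comul_Kz_mem (by simp)
    · rw [Kinv_pow]
      exact comul_Kz_mem (by simp)
    · simpa only [pow_one] using comul_e_pow_mem 1
    · exact comul_Fdiv_mem n
  | algebraMap c =>
    have comul_one_mem : comul 1 ∈ twistedFil 0 := Kz_zero ▸ comul_Kz_mem Even.zero
    rw [Algebra.algebraMap_eq_smul_one]
    exact (map_smul comul (c : Rh) 1).symm ▸ Submodule.smul_mem _ c comul_one_mem
  | add x y _ _ hx hy =>
    rw [map_add]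
    exact add_mem hx hy
  | mul x y _ _ hx hy => simpa only [max_self, ← map_mul] using mul_mem_twistedFil hx hy

theorem comul_mem_of_mem_fil1 {p : ℕ} {x : Uh} (hx : x ∈ fil1 p) :
    comul x ∈ twistedFil (p / 2) := by
  refine map_span_mem (f := comul.toLinearMap) ?_ hx
  rintro _ ⟨a, ha, b, hb, rfl⟩
  simpa only [Nat.zero_max, Nat.max_zero, ← map_mul, AlgHom.toLinearMap_apply] using
    mul_mem_twistedFil (mul_mem_twistedFil (comul_mem_of_mem_Uev ha) (comul_e_pow_mem p))
      (comul_mem_of_mem_Uev hb)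

theorem bComul_mem {p : ℕ} {x : Uh} (hx : x ∈ fil1 p) : bComul x ∈ complFil fil2 (p / 2) := by
  rw [bComul_apply]
  refine map_span_mem ?_ (comul_mem_of_mem_fil1 hx)
  rintro _ ⟨m, n, a, b, x, y, hab, -, hx, hy, rfl⟩
  refine mem_complFil_of_hasHSum fil2_antitone mem_hPow_of_mem_fil2 Filter.tendsto_id
    (hasHSum_bComulAux x hy.1) fun k => ?_
  have left_factor_eq : (PowerSeries.X * sh : Rh) ^ k • (x * antipode (E ^ k) * Kz (k - m)) =
      (-1 : Rh) ^ k • vPow (-(k * (k + 1))) • vPow (-(2 * -m * k)) • (x * Kz (-m) * e ^ k) := by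
    rw [antipode_E_pow, e_pow]
    simp only [mul_smul_comm, smul_mul_assoc, mul_assoc, ← Kz_add, mul_smul]
    rw [show (-k + (k - m) : ℤ) = -m by ring, (isWt_E_pow k).mul_Kz, mul_smul_comm]
    simp only [smul_smul, mul_assoc (2 : ℤ) (-m)]
    congr 1
    ring
  rw [X_pow_smul_rCoeff_smul, ← tm_smul_left, left_factor_eq, ← tm_smul_right]
  simp only [tm_smul_left]
  refine vPow_smul_mem _ (Int.even_mul_pred_self _) (neg_one_pow_smul_mem _ _ (vPow_smul_mem _
    (Int.even_mul_succ_self _).neg (vPow_smul_mem _ (even_two_mul_mul _ _).neg ?_)))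
  refine fil2_antitone ?_ (tm_mem_fil2 (mul_mem_fil1 hx (e_pow_mem_fil1 k))
    (qfInv_smul_ad_F_pow_mem_filWt hy k).2.1)
  dsimp only [id]
  omega

/-! ### Integrality of the multiplication, unit and counit -/

theorem mult_mem {p : ℕ} {z : Uh2} (hz : z ∈ fil2 p) : mult z ∈ fil1 p := by
  refine map_fil2_mem (fun m n a b hab x hx y hy => ?_) hz
  rw [show mult (tm x y) = x * y from ext2_tm _ _ _]
  exact fil1_antitone hab (mul_mem_fil1 hx.2.1 hy.2.1)

theorem mem_fil0_zero {c : Rh} : c ∈ fil0 0 ↔ c ∈ Zq := by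
  rw [fil0, if_pos rfl, Submodule.mem_one]
  exact ⟨fun ⟨y, hy⟩ => hy ▸ y.2, fun h => ⟨⟨c, h⟩, rfl⟩⟩

theorem fil0_succ (p : ℕ) : fil0 (p + 1) = ⊥ := if_neg (Nat.succ_ne_zero p)

theorem fil0_antitone : Antitone fil0 := fun p q h => by
  rcases q with _ | q
  · rw [Nat.le_zero.1 h]
  · rw [fil0_succ]
    exact bot_le

theorem mem_hPow_of_mem_fil0 (p : ℕ) (x : Rh) (hx : x ∈ fil0 p) : x ∈ hPow Rh p := by
  rcases p with _ | p
  · exact mem_hPow_zero x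
  · rw [fil0_succ, Submodule.mem_bot] at hx
    rw [hx]
    exact zero_mem _

theorem unit_mem {p : ℕ} {c : Rh} (hc : c ∈ fil0 p) : unit c ∈ fil1 p := by
  rcases p with _ | p
  · rw [mem_fil0_zero] at hc
    rw [show unit c = c • 1 from Algebra.algebraMap_eq_smul_one c]
    exact Zq_smul_mem _ hc (mem_fil1_zero.2 (one_mem _))
  · rw [fil0_succ, Submodule.mem_bot] at hc
    rw [hc, map_zero]
    exact zero_mem _

theorem counit_gen (g : Gen) : counit (gen g) = 0 := uhLift_gen _ satRel_counit g

theorem counit_Kz (a : ℤ) : counit (Kz a) = 1 := by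
  rw [Kz, map_hExp, map_smul, show counit H = 0 from counit_gen .H, smul_zero, hExp_zero]

theorem counit_e : counit e = 0 := by
  rw [e, map_smul, show counit E = 0 from counit_gen .E, smul_zero]

theorem counit_Fdiv {n : ℕ} (hn : n ≠ 0) : counit (Fdiv n) = 0 := by
  rw [Fdiv_eq, map_smul, map_mul, map_pow, show counit F = 0 from counit_gen .F, zero_pow hn,
    zero_mul, smul_zero]

theorem counit_mem_of_mem_Uev {x : Uh} (hx : x ∈ Uev) : counit x ∈ Zq := by
  induction hx using Algebra.adjoin_induction with
  | mem x hx =>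
    rcases hx with (rfl | rfl | rfl) | ⟨n, hn, rfl⟩
    · rw [K_pow, counit_Kz]
      exact one_mem _
    · rw [Kinv_pow, counit_Kz]
      exact one_mem _
    · rw [counit_e]
      exact zero_mem _
    · rw [counit_Fdiv (Nat.one_le_iff_ne_zero.1 hn)]
      exact zero_mem _
  | algebraMap c =>
    rw [show counit (algebraMap Zq Uh c) = c from counit.commutes (c : Rh)]
    exact c.2
  | add x y _ _ hx hy =>
    rw [map_add]
    exact add_mem hx hy
  | mul x y _ _ hx hy =>
    rw [map_mul]
    exact mul_mem hx hy

theorem counit_mem {p : ℕ} {x : Uh} (hx : x ∈ fil1 p) : counit x ∈ fil0 p := by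
  rcases p with _ | p
  · exact mem_fil0_zero.2 (counit_mem_of_mem_Uev (fil1_le_Uev hx))
  · refine map_span_mem (f := counit.toLinearMap) ?_ hx
    rintro _ ⟨a, -, b, -, rfl⟩
    have counit_eq_zero : counit (a * e ^ (p + 1) * b) = 0 := by
      rw [map_mul, map_mul, map_pow, counit_e, zero_pow (Nat.succ_ne_zero p), mul_zero, zero_mul]
    rw [AlgHom.toLinearMap_apply, counit_eq_zero]
    exact zero_mem _

theorem braiding_restrictsContinuously : RestrictsContinuously braiding fil2 fil2 :=
  .of_map_mem mem_hPow_of_mem_fil2 Filter.tendsto_id fun _ _ => braiding_mem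

theorem braidingInv_restrictsContinuously : RestrictsContinuously braidingInv fil2 fil2 :=
  .of_map_mem mem_hPow_of_mem_fil2 Filter.tendsto_id fun _ _ => braidingInv_mem

theorem mult_restrictsContinuously : RestrictsContinuously mult fil2 fil1 :=
  .of_map_mem mem_hPow_of_mem_fil1 Filter.tendsto_id fun _ _ hz =>
    le_complFil fil1_antitone _ (mult_mem hz)

theorem unit_restrictsContinuously : RestrictsContinuously unit fil0 fil1 :=
  .of_map_mem mem_hPow_of_mem_fil1 Filter.tendsto_id fun _ _ hc =>
    le_complFil fil1_antitone _ (unit_mem hc)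

theorem bComul_restrictsContinuously : RestrictsContinuously bComul fil1 fil2 :=
  .of_map_mem mem_hPow_of_mem_fil2 tendsto_half_atTop fun _ _ => bComul_mem

theorem counit_restrictsContinuously : RestrictsContinuously counit.toLinearMap fil1 fil0 :=
  .of_map_mem mem_hPow_of_mem_fil0 Filter.tendsto_id fun _ _ hx =>
    le_complFil fil0_antitone _ (counit_mem hx)

theorem bAntipode_restrictsContinuously : RestrictsContinuously bAntipode fil1 fil1 :=
  .of_map_mem mem_hPow_of_mem_fil1 Filter.tendsto_id fun _ _ => bAntipode_mem

theorem bAntipodeInv_restrictsContinuously : RestrictsContinuously bAntipodeInv fil1 fil1 :=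
  .of_map_mem mem_hPow_of_mem_fil1 Filter.tendsto_id fun _ _ => bAntipodeInv_mem

end QuantumSl2

end

theorem mainTheorem6 :
    -- each structure map preserves the completed tensor powers and is continuous there
    (QuantumSl2.RestrictsContinuously QuantumSl2.braiding QuantumSl2.fil2 QuantumSl2.fil2 ∧
      QuantumSl2.RestrictsContinuously QuantumSl2.braidingInv QuantumSl2.fil2 QuantumSl2.fil2 ∧
      QuantumSl2.RestrictsContinuously QuantumSl2.mult QuantumSl2.fil2 QuantumSl2.fil1 ∧
      QuantumSl2.RestrictsContinuously QuantumSl2.unit QuantumSl2.fil0 QuantumSl2.fil1 ∧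
      QuantumSl2.RestrictsContinuously QuantumSl2.bComul QuantumSl2.fil1 QuantumSl2.fil2 ∧
      QuantumSl2.RestrictsContinuously QuantumSl2.counit.toLinearMap
        QuantumSl2.fil1 QuantumSl2.fil0 ∧
      QuantumSl2.RestrictsContinuously QuantumSl2.bAntipode QuantumSl2.fil1 QuantumSl2.fil1 ∧
      QuantumSl2.RestrictsContinuously QuantumSl2.bAntipodeInv QuantumSl2.fil1 QuantumSl2.fil1) ∧
    -- the braiding and the braided antipode are invertible, with the stated inverses
    (QuantumSl2.braidingInv ∘ₗ QuantumSl2.braiding = LinearMap.id ∧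
      QuantumSl2.braiding ∘ₗ QuantumSl2.braidingInv = LinearMap.id) ∧
    (QuantumSl2.bAntipodeInv ∘ₗ QuantumSl2.bAntipode = LinearMap.id ∧
      QuantumSl2.bAntipode ∘ₗ QuantumSl2.bAntipodeInv = LinearMap.id) := by
  open QuantumSl2 in
  exact ⟨⟨braiding_restrictsContinuously, braidingInv_restrictsContinuously,
    mult_restrictsContinuously, unit_restrictsContinuously, bComul_restrictsContinuously,
    counit_restrictsContinuously, bAntipode_restrictsContinuously,
    bAntipodeInv_restrictsContinuously⟩,
    ⟨braidingInv_comp_braiding, braiding_comp_braidingInv⟩,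
    bAntipodeInv_comp_bAntipode, bAntipode_comp_bAntipodeInv⟩
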